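/- **Theorem 4.6 (Curvature recovered from $\Gamma_2$).** Let $M$ be a smooth connected (Hausdorff, second countable) $n$-manifold, $\mu$ a $\sigma$-finite Borel measure of full support that is smooth and positive (locally $w\,dx$ with $w\in C^\infty$, $w>0$), and $(P_t)_{t\ge 0}$ a conservative symmetric Markov $C_0$-semigroup on $L^2(M,\mu)$ with generator $L$, whose Dirichlet form $\mathcal E(f,g)=\lim_{t\downarrow0}\frac1t\langle f-P_tf,g\rangle$ is strongly local and regular. Let $\mathcal A$ be a smooth core: an algebra of functions with $C_c^\infty(M)\subset\mathcal A\subset C^\infty(M)$, $\mathcal A\subset\mathrm{Dom}(L)$ and $L\mathcal A\subset\mathcal A$. Assume that for all $f,g\in\mathcal A$ the limit $$\Gamma(f,g)=\lim_{t\downarrow0}\frac1{2t}\bigl(P_t(fg)-(P_tf)(P_tg)\bigr)$$ exists pointwise (almost everywhere along every sequence $t_k\downarrow0$) and is a smooth function, that $\Gamma$ is symmetric, bilinear and local ($\Gamma(f,g)=0$ if $g$ is constant near $\operatorname{supp}f$), that $\Gamma(f,g)(x)$ depends only on $df(x),dg(x)$, and that $\Gamma$ satisfies on $\mathcal A$ the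 Leibniz rule and the one-variable chain rule $\Gamma(\phi\circ f,g)=\phi'(f)\Gamma(f,g)$, and likewise in the second argument. Assume non-degeneracy: the form induced by $\Gamma$ on $T_x^*M$ is positive definite for every $x$. For $f,h\in\mathcal A$ put $$\Gamma_2(f)=\tfrac12L\Gamma(f,f)-\Gamma(f,Lf),\qquad \Gamma_2(f,h)=\tfrac14\bigl(\Gamma_2(f+h)-\Gamma_2(f-h)\bigr).$$ Then there are a unique smooth Riemannian metric $g$ and a unique smooth function $\rho>0$ with $\Gamma(f,h)=\langle df,dh\rangle_{g^{-1}}$ for all $f,h\in\mathcal A$ and $\mu=\rho\,\mathrm{vol}_g$. Let $\nabla^2$ be the covariant Hessian of $g$ and let $$\mathrm{Ric}_\mu:=\mathrm{Ric}_g-\nabla^2\log\rho$$ be the Bakry–Émery Ricci tensor of $(M,g,\mu)$ (equivalently $\mathrm{Ric}_g+\nabla^2V$ for $\rho=e^{-V}$). Then $\Gamma_2$ uniquely determines $\mathrm{Ric}_\mu$, in the following sense. 1. For all $f,h\in\mathcal A$, pointwise on $M$, $$\Gamma_2(f,h)=\langle\nabla^2f,\nabla^2h\rangle_g+\mathrm{Ric}_\mu(\nabla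 f,\nabla h).$$ 2. For all $x\in M$ and $v,w\in T_xM$ there are $f,h\in C_c^\infty(M)$ with $\nabla f(x)=v$, $\nabla h(x)=w$ and $\nabla^2f(x)=\nabla^2h(x)=0$; and for all $f,h\in\mathcal A$ with these properties, $\mathrm{Ric}_\mu(v,w)=\Gamma_2(f,h)(x)$. 3. If $\rho$ is constant, then $\mathrm{Ric}_\mu=\mathrm{Ric}_g$. 4. If two such diffusions on $M$ (with their own measures, semigroups and cores), recovering $(g,\rho)$ and $(g',\rho')$, have $\Gamma_2(f)=\Gamma_2'(f)$ for all $f\in C_c^\infty(M)$, then $g=g'$ and $\mathrm{Ric}_g-\nabla^2\log\rho=\mathrm{Ric}_{g'}-\nabla'^2\log\rho'$; moreover $\mathrm{Ric}_g+\nabla^2\log\rho=\mathrm{Ric}_{g'}+\nabla'^2\log\rho'$. -/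

import Mathlib

open Set Filter Topology MeasureTheory Bundle
open scoped Manifold ContDiff NNReal ENNReal

noncomputable section

namespace DiffGeo

/-! ### Smooth test functions -/

/-- The real-valued smooth functions on `M`. -/
def IsSmooth (n : ℕ) {M : Type*} [TopologicalSpace M]
    [ChartedSpace (EuclideanSpace ℝ (Fin n)) M] (f : M → ℝ) : Prop :=
  ContMDiff (𝓡 n) 𝓘(ℝ, ℝ) ∞ f

/-- The differential `df(x)`, a covector at `x`. -/
abbrev differential (n : ℕ) {M : Type*} [TopologicalSpace M]
    [ChartedSpace (EuclideanSpace ℝ (Fin n)) M] (f : M → ℝ) (x : M) :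
    TangentSpace (𝓡 n) x →L[ℝ] ℝ :=
  mvfderiv (𝓡 n) f x

/-! ### Measures with a density in charts -/

/-- In the preferred chart at each point `x`, the measure `μ` is `w x` times Lebesgue measure. -/
def HasChartDensity {n : ℕ} {M : Type*} [TopologicalSpace M]
    [ChartedSpace (EuclideanSpace ℝ (Fin n)) M] [MeasurableSpace M] (μ : Measure M)
    (w : M → EuclideanSpace ℝ (Fin n) → ℝ) : Prop :=
  ∀ (x : M) (A : Set (EuclideanSpace ℝ (Fin n))), MeasurableSet A →
    A ⊆ (extChartAt (𝓡 n) x).target →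
    μ ((extChartAt (𝓡 n) x).source ∩ extChartAt (𝓡 n) x ⁻¹' A) =
      ∫⁻ y in A, ENNReal.ofReal (w x y)

/-- A smooth positive measure: locally `ρ dx` with `ρ` smooth and positive. -/
def IsSmoothPositiveMeasure {n : ℕ} {M : Type*} [TopologicalSpace M]
    [ChartedSpace (EuclideanSpace ℝ (Fin n)) M] [MeasurableSpace M] (μ : Measure M) : Prop :=
  ∃ w : M → EuclideanSpace ℝ (Fin n) → ℝ,
    (∀ x, ContDiffOn ℝ ∞ (w x) (extChartAt (𝓡 n) x).target) ∧
    (∀ x, ∀ y ∈ (extChartAt (𝓡 n) x).target, 0 < w x y) ∧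
    HasChartDensity μ w

/-! ### Diffusion semigroups -/

/-- The data: a reference measure `μ`, a family `(P_t)` of bounded operators on `L²(M, μ)`, and a
set of functions, the smooth core on which the diffusion calculus is understood. -/
structure DiffusionData (M : Type*) [MeasurableSpace M] where
  μ : Measure M
  P : ℝ≥0 → (Lp ℝ 2 μ →L[ℝ] Lp ℝ 2 μ)
  core : Set (M → ℝ)

namespace DiffusionData

section Form

variable {M : Type*} [MeasurableSpace M]

/-- The domain of the form: `⟨f - P_t f, f⟩ / t` has a finite limit as `t ↓ 0`. -/
def formDomain (D : DiffusionData M) : Set (Lp ℝ 2 D.μ) :=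
  {f | ∃ l : ℝ, Tendsto (fun t : ℝ≥0 => inner ℝ (f - D.P t f) f / (t : ℝ)) (𝓝[>] 0) (𝓝 l)}

/-- The form `𝓔(f, g) = lim_{t ↓ 0} ⟨f - P_t f, g⟩ / t`. -/
def form (D : DiffusionData M) (f g : Lp ℝ 2 D.μ) : ℝ :=
  limUnder (𝓝[>] (0 : ℝ≥0)) (fun t : ℝ≥0 => inner ℝ (f - D.P t f) g / (t : ℝ))

/-- `f ∈ Dom(L)` and `L f = h`: the difference quotients converge in `L²(μ)`. -/
def IsGeneratorValue (D : DiffusionData M) (f h : M → ℝ) : Prop :=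
  ∃ (hf : MemLp f 2 D.μ) (hh : MemLp h 2 D.μ),
    Tendsto (fun t : ℝ≥0 => (t : ℝ)⁻¹ • (D.P t (hf.toLp f) - hf.toLp f)) (𝓝[>] 0)
      (𝓝 (hh.toLp h))

/-- `G` is the pointwise limit of `(P_t (f g) - (P_t f) (P_t g)) / (2 t)` as `t ↓ 0`. Since each
`P_t f` is an `L²` class, the limit is taken almost everywhere along every sequence `t_k ↓ 0`. -/
def IsCarreDuChampLimit (D : DiffusionData M) (f g G : M → ℝ) : Prop :=
  ∃ (hf : MemLp f 2 D.μ) (hg : MemLp g 2 D.μ) (hfg : MemLp (f * g) 2 D.μ),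
    ∀ t : ℕ → ℝ≥0, (∀ k, 0 < t k) → Tendsto t atTop (𝓝 0) →
      ∀ᵐ x ∂D.μ, Tendsto
        (fun k => (D.P (t k) (hfg.toLp (f * g)) x -
          D.P (t k) (hf.toLp f) x * D.P (t k) (hg.toLp g) x) / (2 * (t k : ℝ)))
        atTop (𝓝 (G x))

end Form

/-- A conservative symmetric Markov `C₀`-semigroup on `L²(M, μ)`, with `μ` σ-finite, of full
support, smooth and positive, whose form is strongly local and regular. -/
structure IsDiffusion (n : ℕ) {M : Type*} [TopologicalSpace M]
    [ChartedSpace (EuclideanSpace ℝ (Fin n)) M] [MeasurableSpace M]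
    (D : DiffusionData M) : Prop where
  sigmaFinite : SigmaFinite D.μ
  fullSupport : D.μ.IsOpenPosMeasure
  smoothMeasure : IsSmoothPositiveMeasure (n := n) D.μ
  semigroup_zero : D.P 0 = ContinuousLinearMap.id ℝ _
  semigroup_add : ∀ s t, D.P (s + t) = (D.P s).comp (D.P t)
  strongContinuity : ∀ f, Tendsto (fun t => D.P t f) (𝓝[>] 0) (𝓝 f)
  markov : ∀ t (f : Lp ℝ 2 D.μ), (∀ᵐ x ∂D.μ, 0 ≤ f x ∧ f x ≤ 1) →
    ∀ᵐ x ∂D.μ, 0 ≤ D.P t f x ∧ D.P t f x ≤ 1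
  /-- `P_t 1 = 1`, where `P_t 1` is the monotone limit of `P_t f_k` for `0 ≤ f_k ↑ 1`. -/
  conservative : ∀ t (f : ℕ → Lp ℝ 2 D.μ),
    (∀ᵐ x ∂D.μ, (∀ k, 0 ≤ f k x) ∧ Monotone (fun k => f k x) ∧
      Tendsto (fun k => f k x) atTop (𝓝 1)) →
    ∀ᵐ x ∂D.μ, Tendsto (fun k => D.P t (f k) x) atTop (𝓝 1)
  symmetric : ∀ t (f g : Lp ℝ 2 D.μ), inner ℝ (D.P t f) g = inner ℝ f (D.P t g)
  /-- `𝓔(f, g) = 0` if `f` is constant on a neighbourhood `U` of the support of `g`. -/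
  stronglyLocal : ∀ f ∈ D.formDomain, ∀ g ∈ D.formDomain, ∀ U K : Set M,
    IsOpen U → IsClosed K → K ⊆ U → (∀ᵐ x ∂D.μ, x ∉ K → g x = 0) →
    (∃ c : ℝ, ∀ᵐ x ∂D.μ, x ∈ U → f x = c) → D.form f g = 0
  regular_form : ∀ f ∈ D.formDomain, ∀ ε : ℝ, 0 < ε →
    ∃ (φ : M → ℝ) (hφ : MemLp φ 2 D.μ), Continuous φ ∧ HasCompactSupport φ ∧
      hφ.toLp φ ∈ D.formDomain ∧
      D.form (f - hφ.toLp φ) (f - hφ.toLp φ) + ‖f - hφ.toLp φ‖ ^ 2 < ε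
  regular_uniform : ∀ φ : M → ℝ, Continuous φ → HasCompactSupport φ → ∀ ε : ℝ, 0 < ε →
    ∃ (ψ : M → ℝ) (hψ : MemLp ψ 2 D.μ), Continuous ψ ∧ HasCompactSupport ψ ∧
      hψ.toLp ψ ∈ D.formDomain ∧ ∀ x, |φ x - ψ x| < ε

open Classical in
/-- The generator on smooth functions: `L f` is the smooth function representing the `L²` limit of
`(P_t f - f) / t`, if there is one. -/
def generator (n : ℕ) {M : Type*} [TopologicalSpace M]
    [ChartedSpace (EuclideanSpace ℝ (Fin n)) M] [MeasurableSpace M]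
    (D : DiffusionData M) (f : M → ℝ) : M → ℝ :=
  if h : ∃ u : M → ℝ, IsSmooth n u ∧ D.IsGeneratorValue f u then h.choose else 0

open Classical in
/-- The carré du champ `Γ(f, g)`: the smooth limit of `(P_t (f g) - (P_t f) (P_t g)) / (2 t)`, if
there is one. -/
def carreDuChamp (n : ℕ) {M : Type*} [TopologicalSpace M]
    [ChartedSpace (EuclideanSpace ℝ (Fin n)) M] [MeasurableSpace M]
    (D : DiffusionData M) (f g : M → ℝ) : M → ℝ :=
  if h : ∃ u : M → ℝ, IsSmooth n u ∧ D.IsCarreDuChampLimit f g u then h.choose else 0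

/-- The iterated carré du champ `Γ₂(f) = ½ L Γ(f) - Γ(f, L f)`. -/
def gammaTwo (n : ℕ) {M : Type*} [TopologicalSpace M]
    [ChartedSpace (EuclideanSpace ℝ (Fin n)) M] [MeasurableSpace M]
    (D : DiffusionData M) (f : M → ℝ) : M → ℝ := fun x =>
  (1 / 2) * D.generator n (D.carreDuChamp n f f) x - D.carreDuChamp n f (D.generator n f) x

/-- The polarized `Γ₂(f, h) = ¼ (Γ₂(f + h) - Γ₂(f - h))`. -/
def gammaTwoPolar (n : ℕ) {M : Type*} [TopologicalSpace M]
    [ChartedSpace (EuclideanSpace ℝ (Fin n)) M] [MeasurableSpace M]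
    (D : DiffusionData M) (f h : M → ℝ) : M → ℝ := fun x =>
  (1 / 4) * (D.gammaTwo n (f + h) x - D.gammaTwo n (f - h) x)

/-- The core is an algebra of smooth functions that contains the compactly supported ones, lies in
`Dom(L)`, and is mapped into itself by `L`. -/
structure IsSmoothCore (n : ℕ) {M : Type*} [TopologicalSpace M]
    [ChartedSpace (EuclideanSpace ℝ (Fin n)) M] [MeasurableSpace M]
    (D : DiffusionData M) : Prop where
  smooth : ∀ f ∈ D.core, IsSmooth n f
  testFunctions : ∀ f, IsSmooth n f → HasCompactSupport f → f ∈ D.core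
  add : ∀ f ∈ D.core, ∀ g ∈ D.core, f + g ∈ D.core
  smul : ∀ (c : ℝ), ∀ f ∈ D.core, c • f ∈ D.core
  mul : ∀ f ∈ D.core, ∀ g ∈ D.core, f * g ∈ D.core
  generator_mem : ∀ f ∈ D.core, ∃ u ∈ D.core, D.IsGeneratorValue f u

/-- The smooth first-order diffusion calculus on the core. -/
structure HasSmoothCalculus (n : ℕ) {M : Type*} [TopologicalSpace M]
    [ChartedSpace (EuclideanSpace ℝ (Fin n)) M] [MeasurableSpace M]
    (D : DiffusionData M) : Prop where
  exists_limit : ∀ f ∈ D.core, ∀ g ∈ D.core,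
    ∃ G : M → ℝ, IsSmooth n G ∧ D.IsCarreDuChampLimit f g G
  symm : ∀ f ∈ D.core, ∀ g ∈ D.core, D.carreDuChamp n f g = D.carreDuChamp n g f
  add_left : ∀ f ∈ D.core, ∀ g ∈ D.core, ∀ h ∈ D.core,
    D.carreDuChamp n (f + g) h = D.carreDuChamp n f h + D.carreDuChamp n g h
  smul_left : ∀ (c : ℝ), ∀ f ∈ D.core, ∀ h ∈ D.core,
    D.carreDuChamp n (c • f) h = c • D.carreDuChamp n f h
  /-- `Γ(f, g)(x)` depends only on `df(x)` and `dg(x)`. -/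
  firstOrder : ∀ f ∈ D.core, ∀ f' ∈ D.core, ∀ g ∈ D.core, ∀ g' ∈ D.core, ∀ x,
    differential n f x = differential n f' x → differential n g x = differential n g' x →
    D.carreDuChamp n f g x = D.carreDuChamp n f' g' x
  isLocal : ∀ f ∈ D.core, ∀ g ∈ D.core, ∀ U : Set M, IsOpen U → tsupport f ⊆ U →
    (∃ c, ∀ x ∈ U, g x = c) → D.carreDuChamp n f g = 0
  leibniz_left : ∀ f ∈ D.core, ∀ g ∈ D.core, ∀ h ∈ D.core,
    D.carreDuChamp n (f * g) h = f * D.carreDuChamp n g h + g * D.carreDuChamp n f h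
  leibniz_right : ∀ f ∈ D.core, ∀ g ∈ D.core, ∀ h ∈ D.core,
    D.carreDuChamp n h (f * g) = f * D.carreDuChamp n h g + g * D.carreDuChamp n h f
  chain_left : ∀ φ : ℝ → ℝ, ContDiff ℝ ∞ φ → ∀ f ∈ D.core, ∀ g ∈ D.core, φ ∘ f ∈ D.core →
    D.carreDuChamp n (φ ∘ f) g = (deriv φ ∘ f) * D.carreDuChamp n f g
  chain_right : ∀ φ : ℝ → ℝ, ContDiff ℝ ∞ φ → ∀ f ∈ D.core, ∀ g ∈ D.core, φ ∘ g ∈ D.core →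
    D.carreDuChamp n f (φ ∘ g) = (deriv φ ∘ g) * D.carreDuChamp n f g

/-- The form that `Γ` induces on each cotangent space is positive definite. -/
def IsNondegenerate (n : ℕ) {M : Type*} [TopologicalSpace M]
    [ChartedSpace (EuclideanSpace ℝ (Fin n)) M] [MeasurableSpace M]
    (D : DiffusionData M) : Prop :=
  ∀ x, ∀ f ∈ D.core, differential n f x ≠ 0 → 0 < D.carreDuChamp n f f x

end DiffusionData

/-! ### Curvature of a metric given by a matrix of functions on Euclidean space -/

section Coordinates

variable {n : ℕ}

/-- The partial derivative `∂_k F` at `y`. -/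
def partialDeriv (k : Fin n) (F : EuclideanSpace ℝ (Fin n) → ℝ) (y : EuclideanSpace ℝ (Fin n)) :
    ℝ :=
  fderiv ℝ F y (EuclideanSpace.single k 1)

/-- `Γ^k_{ij} = ½ g^{kl} (∂_i g_{jl} + ∂_j g_{il} - ∂_l g_{ij})`. -/
def christoffel (G : EuclideanSpace ℝ (Fin n) → Matrix (Fin n) (Fin n) ℝ) (k i j : Fin n)
    (y : EuclideanSpace ℝ (Fin n)) : ℝ :=
  (1 / 2) * ∑ l, (G y)⁻¹ k l *
    (partialDeriv i (fun z => G z j l) y + partialDeriv j (fun z => G z i l) y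
      - partialDeriv l (fun z => G z i j) y)

/-- `R_{ij} = ∂_k Γ^k_{ij} - ∂_i Γ^k_{kj} + Γ^k_{kl} Γ^l_{ij} - Γ^k_{il} Γ^l_{kj}`. -/
def ricciCoord (G : EuclideanSpace ℝ (Fin n) → Matrix (Fin n) (Fin n) ℝ) (i j : Fin n)
    (y : EuclideanSpace ℝ (Fin n)) : ℝ :=
  (∑ k, (partialDeriv k (christoffel G k i j) y - partialDeriv i (christoffel G k k j) y)) +
    ∑ k, ∑ l, (christoffel G k k l y * christoffel G l i j y
      - christoffel G k i l y * christoffel G l k j y)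

/-- `(∇²F)_{ij} = ∂_i ∂_j F - Γ^k_{ij} ∂_k F`. -/
def hessianCoord (G : EuclideanSpace ℝ (Fin n) → Matrix (Fin n) (Fin n) ℝ)
    (F : EuclideanSpace ℝ (Fin n) → ℝ) (i j : Fin n) (y : EuclideanSpace ℝ (Fin n)) : ℝ :=
  partialDeriv i (partialDeriv j F) y - ∑ k, christoffel G k i j y * partialDeriv k F y

end Coordinates

/-! ### Riemannian geometry on `M` -/

/-- Smooth Riemannian metrics on `M`. -/
abbrev Metric (n : ℕ) (M : Type*) [TopologicalSpace M]
    [ChartedSpace (EuclideanSpace ℝ (Fin n)) M] [IsManifold (𝓡 n) ∞ M] :=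
  ContMDiffRiemannianMetric (𝓡 n) ∞ (EuclideanSpace ℝ (Fin n))
    (fun x : M => TangentSpace (𝓡 n) x)

namespace Metric

variable {n : ℕ} {M : Type*} [TopologicalSpace M] [ChartedSpace (EuclideanSpace ℝ (Fin n)) M]
  [IsManifold (𝓡 n) ∞ M]

theorem exists_gradient (g : Metric n M) (f : M → ℝ) (x : M) :
    ∃ v : TangentSpace (𝓡 n) x, ∀ w, g.inner x v w = differential n f x w := by
  have : FiniteDimensional ℝ (TangentSpace (𝓡 n) x) :=
    inferInstanceAs (FiniteDimensional ℝ (EuclideanSpace ℝ (Fin n)))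
  let T : TangentSpace (𝓡 n) x →ₗ[ℝ] Module.Dual ℝ (TangentSpace (𝓡 n) x) :=
    { toFun := fun v => (g.inner x v : TangentSpace (𝓡 n) x →ₗ[ℝ] ℝ)
      map_add' := fun v w => by ext; simp
      map_smul' := fun c v => by ext; simp }
  have hinj : Function.Injective T := by
    rw [injective_iff_map_eq_zero]
    intro v hv
    by_contra hne
    have h0 : g.inner x v v = 0 := LinearMap.congr_fun hv v
    exact absurd h0 (g.pos x v hne).ne'
  have hsurj : Function.Surjective T :=
    (LinearMap.injective_iff_surjective_of_finrank_eq_finrank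
      (Subspace.dual_finrank_eq).symm).1 hinj
  obtain ⟨v, hv⟩ := hsurj (differential n f x : TangentSpace (𝓡 n) x →ₗ[ℝ] ℝ)
  exact ⟨v, fun w => LinearMap.congr_fun hv w⟩

/-- The gradient `∇f(x)`: the tangent vector with `⟨∇f(x), w⟩_g = df(x)(w)` for all `w`. -/
def gradient (g : Metric n M) (f : M → ℝ) (x : M) : TangentSpace (𝓡 n) x :=
  (exists_gradient g f x).choose

/-- `⟨df, dh⟩_{g⁻¹}(x)`. -/
def cometric (g : Metric n M) (f h : M → ℝ) (x : M) : ℝ :=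
  g.inner x (gradient g f x) (gradient g h x)

/-- The components `g_{ij} = g(∂_i, ∂_j)` in the preferred chart at `x`, as functions of the
coordinates. -/
def matrix (g : Metric n M) (x : M) (y : EuclideanSpace ℝ (Fin n)) :
    Matrix (Fin n) (Fin n) ℝ :=
  Matrix.of fun i j => g.inner ((extChartAt (𝓡 n) x).symm y)
    (mfderiv 𝓘(ℝ, EuclideanSpace ℝ (Fin n)) (𝓡 n) (extChartAt (𝓡 n) x).symm y
      (EuclideanSpace.single i 1))
    (mfderiv 𝓘(ℝ, EuclideanSpace ℝ (Fin n)) (𝓡 n) (extChartAt (𝓡 n) x).symm y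
      (EuclideanSpace.single j 1))

/-- The components of `v ∈ T_x M` in the preferred chart at `x`. -/
def component {x : M} (v : TangentSpace (𝓡 n) x) (i : Fin n) : ℝ :=
  (mvfderiv (𝓡 n) (extChartAt (𝓡 n) x) x v : EuclideanSpace ℝ (Fin n)) i

/-- The components at `x` of the covariant Hessian of `f`, in the preferred chart at `x`. -/
def hessianComponent (g : Metric n M) (f : M → ℝ) (x : M) (i j : Fin n) : ℝ :=
  hessianCoord (matrix g x) (f ∘ (extChartAt (𝓡 n) x).symm) i j (extChartAt (𝓡 n) x x)

/-- The covariant Hessian `∇²f(v, w)` for the Levi-Civita connection. -/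
def hessian (g : Metric n M) (f : M → ℝ) (x : M) (v w : TangentSpace (𝓡 n) x) : ℝ :=
  ∑ i, ∑ j, hessianComponent g f x i j * component v i * component w j

/-- `⟨∇²f, ∇²h⟩ = g^{ia} g^{jb} (∇²f)_{ij} (∇²h)_{ab}` at `x`. -/
def hessianInner (g : Metric n M) (f h : M → ℝ) (x : M) : ℝ :=
  ∑ i, ∑ j, ∑ a, ∑ b,
    (matrix g x (extChartAt (𝓡 n) x x))⁻¹ i a * (matrix g x (extChartAt (𝓡 n) x x))⁻¹ j b *
      hessianComponent g f x i j * hessianComponent g h x a b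

/-- The Ricci tensor `Ric_g(v, w)`. -/
def ricci (g : Metric n M) (x : M) (v w : TangentSpace (𝓡 n) x) : ℝ :=
  ∑ i, ∑ j, ricciCoord (matrix g x) i j (extChartAt (𝓡 n) x x) * component v i * component w j

/-- The Bakry-Émery Ricci tensor of `(M, g, ρ vol_g)`: with `ρ = e^{-V}` it is `Ric_g + ∇²V`, that
is `Ric_g - ∇² log ρ`. -/
def bakryEmeryRicci (g : Metric n M) (ρ : M → ℝ) (x : M) (v w : TangentSpace (𝓡 n) x) : ℝ :=
  ricci g x v w - hessian g (fun y => Real.log (ρ y)) x v w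

/-- `μ = ρ vol_g`: in charts `μ` is `ρ √(det g_{ij}) dx`. -/
def IsWeightedVolume [MeasurableSpace M] (g : Metric n M) (ρ : M → ℝ) (μ : Measure M) : Prop :=
  HasChartDensity μ fun x y =>
    ρ ((extChartAt (𝓡 n) x).symm y) * Real.sqrt (matrix g x y).det

end Metric

/-- `(M, g, ρ vol_g)` is the weighted Riemannian manifold recovered from the diffusion:
`Γ(f, h) = ⟨df, dh⟩_{g⁻¹}` on the core, and `μ = ρ vol_g` with `ρ` smooth and positive. -/
structure DiffusionData.IsRecovered {n : ℕ} {M : Type*} [TopologicalSpace M]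
    [ChartedSpace (EuclideanSpace ℝ (Fin n)) M] [IsManifold (𝓡 n) ∞ M] [MeasurableSpace M]
    (D : DiffusionData M) (g : Metric n M) (ρ : M → ℝ) : Prop where
  carreDuChamp_eq : ∀ f ∈ D.core, ∀ h ∈ D.core, ∀ x,
    D.carreDuChamp n f h x = g.cometric f h x
  density_smooth : IsSmooth n ρ
  density_pos : ∀ x, 0 < ρ x
  measure_eq : g.IsWeightedVolume ρ D.μ

end DiffGeo

end

/-!
The argument is local: everything is expressed in the preferred chart at a point, with functions of
the coordinates in place of functions on `M`.

*Recovering `(g, ρ)`.* Since `Γ(f, h)(p)` depends only on the differentials, in a chart it is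
`A^{ij} ∂_i f ∂_j h` with `A^{ij} = Γ(u_i, u_j)` for test functions `u_i` that agree with the
coordinates (`exists_carreDuChamp_matrix`). Keeping the `u_i` fixed near a point shows that `A` is
smooth, and non-degeneracy that it is positive definite; the metric is the form dual to `Γ` and its
matrix is `A⁻¹` (`exists_metric`). Under a change of chart, the density of `μ` and `√det g` are
both multiplied by the Jacobian, so that their quotient `ρ` is a function on `M`
(`Metric.exists_density`). Uniqueness holds because test functions realize every covector, and
because a continuous density is determined by its measure.

*The generator is the weighted Laplacian.* Comparing the limits that define `Γ` and `L`
gives `2 Γ(f, h) = L(fh) - f Lh - h Lf` (`carreDuChamp_eq_generator`). Locality of `Γ`, tested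
against a cutoff, gives `∫ Lu dμ = 0` for a test function `u` (`integral_generator_eq_zero`), so
that `∫ h Lf dμ = -∫ Γ(f, h) dμ` for a test function `h`, by symmetry (`integral_mul_generator`).
In a chart an integration by parts against `μ = ρ √det g dx` turns this into
`L f = Δ_g f + ⟨d log ρ, df⟩` (`IsRecovered.generator_symm`).

*The Bochner identity.* With `L` and `Γ` known in coordinates, the identity
`½ L Γ(f, f) - Γ(f, Lf) = |∇²f|² + (Ric - ∇² log ρ)(∇f, ∇f)` is a pointwise computation with
Christoffel symbols (`IsMetricField.bochner`). It uses that the derivatives of `log √det g` are the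
traces `Γ^k_{ki}`, from Jacobi's formula for the derivative of a determinant (`partialDeriv_det`).

*Consequences.* Second-order jets of test functions can be prescribed
(`exists_testFunction_jet`). A test function with zero covariant Hessian at `x` and prescribed
gradient isolates the tensor `Ric_μ`; one with zero differential and second derivatives `q_i q_j`
has `Γ₂(f)(x) = (g^{ij} q_i q_j)²`, which determines `g⁻¹` since it is positive definite. So `Γ₂`
determines `g`, then `Ric_μ`, and then `Ric_g + ∇² log ρ = 2 Ric_g - Ric_μ`.
-/

noncomputable section

namespace DiffGeo

/-! ### Calculus of partial derivatives -/

section PartialDeriv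

variable {n : ℕ} {F H : EuclideanSpace ℝ (Fin n) → ℝ} {y : EuclideanSpace ℝ (Fin n)}

theorem contDiffAt_partialDeriv (hF : ContDiffAt ℝ ∞ F y) (k : Fin n) :
    ContDiffAt ℝ ∞ (partialDeriv k F) y :=
  (hF.fderiv_right (m := ∞) (by simp)).clm_apply contDiffAt_const

theorem contDiffOn_partialDeriv {U : Set (EuclideanSpace ℝ (Fin n))} (hU : IsOpen U)
    (hF : ContDiffOn ℝ ∞ F U) (k : Fin n) : ContDiffOn ℝ ∞ (partialDeriv k F) U :=
  fun _ hz => (contDiffAt_partialDeriv (hF.contDiffAt (hU.mem_nhds hz)) k).contDiffWithinAt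

theorem partialDeriv_congr (h : F =ᶠ[𝓝 y] H) (k : Fin n) :
    partialDeriv k F y = partialDeriv k H y := by
  unfold partialDeriv; rw [h.fderiv_eq]

theorem partialDeriv_eventuallyEq (h : F =ᶠ[𝓝 y] H) (k : Fin n) :
    partialDeriv k F =ᶠ[𝓝 y] partialDeriv k H :=
  h.eventuallyEq_nhds.mono fun _ hz => partialDeriv_congr hz k

theorem partialDeriv_const (c : ℝ) (k : Fin n) : partialDeriv k (fun _ => c) y = 0 := by
  simp [partialDeriv]

theorem partialDeriv_add (hF : DifferentiableAt ℝ F y) (hH : DifferentiableAt ℝ H y)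
    (k : Fin n) :
    partialDeriv k (fun z => F z + H z) y = partialDeriv k F y + partialDeriv k H y := by
  unfold partialDeriv; rw [fderiv_fun_add hF hH]; rfl

theorem partialDeriv_mul (hF : DifferentiableAt ℝ F y) (hH : DifferentiableAt ℝ H y)
    (k : Fin n) : partialDeriv k (fun z => F z * H z) y =
      partialDeriv k F y * H y + F y * partialDeriv k H y := by
  unfold partialDeriv; rw [fderiv_fun_mul hF hH]; simp; ring

theorem partialDeriv_sum {ι : Type*} {s : Finset ι} {F : ι → EuclideanSpace ℝ (Fin n) → ℝ}
    (hF : ∀ i ∈ s, DifferentiableAt ℝ (F i) y) (k : Fin n) :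
    partialDeriv k (fun z => ∑ i ∈ s, F i z) y = ∑ i ∈ s, partialDeriv k (F i) y := by
  unfold partialDeriv; rw [fderiv_fun_sum hF]; simp

theorem partialDeriv_comp {φ : ℝ → ℝ} {c : ℝ} (hφ : HasDerivAt φ c (F y))
    (hF : DifferentiableAt ℝ F y) (k : Fin n) :
    partialDeriv k (fun z => φ (F z)) y = c * partialDeriv k F y := by
  unfold partialDeriv
  have h : HasFDerivAt (fun z => φ (F z)) (c • fderiv ℝ F y) y :=
    hφ.comp_hasFDerivAt y hF.hasFDerivAt
  rw [h.fderiv]; simp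

theorem partialDeriv_comm (hF : ContDiffAt ℝ ∞ F y) (i j : Fin n) :
    partialDeriv i (partialDeriv j F) y = partialDeriv j (partialDeriv i F) y := by
  have hd : DifferentiableAt ℝ (fderiv ℝ F) y :=
    (hF.fderiv_right (m := ∞) (by simp)).differentiableAt (by simp)
  have key : ∀ a b : Fin n, DiffGeo.partialDeriv a (DiffGeo.partialDeriv b F) y =
      fderiv ℝ (fderiv ℝ F) y (EuclideanSpace.single a 1) (EuclideanSpace.single b 1) := by
    intro a b
    unfold DiffGeo.partialDeriv
    rw [fderiv_clm_apply hd (differentiableAt_const _)]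
    simp
  rw [key, key]
  exact (hF.isSymmSndFDerivAt (by simpa using ENat.LEInfty.out)) _ _

theorem fderiv_eq_sum_partialDeriv (F : EuclideanSpace ℝ (Fin n) → ℝ)
    (v : EuclideanSpace ℝ (Fin n)) : fderiv ℝ F y v = ∑ i, v i * partialDeriv i F y := by
  have : v = ∑ i, v i • EuclideanSpace.single i (1 : ℝ) := by
    ext j; simp [Finset.sum_apply, Pi.single_apply]
  conv_lhs => rw [this]
  simp [partialDeriv]

end PartialDeriv

/-! ### Smooth families of matrices -/

section MatrixFamilies

variable {n : ℕ} {y : EuclideanSpace ℝ (Fin n)}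
  {G : EuclideanSpace ℝ (Fin n) → Matrix (Fin n) (Fin n) ℝ}

theorem contDiffAt_det {m : ℕ} {E : Type*} [NormedAddCommGroup E] [NormedSpace ℝ E] {y : E}
    {A : E → Matrix (Fin m) (Fin m) ℝ} (h : ∀ i j, ContDiffAt ℝ ∞ (fun z => A z i j) y) :
    ContDiffAt ℝ ∞ (fun z => (A z).det) y := by
  simp only [Matrix.det_apply]
  refine ContDiffAt.sum fun σ _ => ?_
  simp only [Units.smul_def, zsmul_eq_mul]
  exact contDiffAt_const.mul (contDiffAt_prod fun i _ => h _ _)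

theorem contDiffAt_inv_apply {m : ℕ} {E : Type*} [NormedAddCommGroup E] [NormedSpace ℝ E] {y : E}
    {A : E → Matrix (Fin m) (Fin m) ℝ} (h : ∀ i j, ContDiffAt ℝ ∞ (fun z => A z i j) y)
    (hdet : (A y).det ≠ 0) (i j : Fin m) : ContDiffAt ℝ ∞ (fun z => (A z)⁻¹ i j) y := by
  simp only [Matrix.inv_def, Matrix.smul_apply, smul_eq_mul, Ring.inverse_eq_inv',
    Matrix.adjugate_apply]
  refine ((contDiffAt_det h).inv hdet).mul (contDiffAt_det fun k l => ?_)
  by_cases hk : k = j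
  · subst hk; simpa using contDiffAt_const
  · simpa [Matrix.updateRow_ne hk] using h k l

/-- The matrix of the partial derivatives `∂_k G_{ij}`. -/
def partialMatrix (k : Fin n) (G : EuclideanSpace ℝ (Fin n) → Matrix (Fin n) (Fin n) ℝ)
    (y : EuclideanSpace ℝ (Fin n)) : Matrix (Fin n) (Fin n) ℝ :=
  Matrix.of fun i j => partialDeriv k (fun z => G z i j) y

theorem partialMatrix_mul {A B : EuclideanSpace ℝ (Fin n) → Matrix (Fin n) (Fin n) ℝ}
    (hA : ∀ i j, DifferentiableAt ℝ (fun z => A z i j) y)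
    (hB : ∀ i j, DifferentiableAt ℝ (fun z => B z i j) y) (k : Fin n) :
    partialMatrix k (fun z => A z * B z) y =
      partialMatrix k A y * B y + A y * partialMatrix k B y := by
  ext i j
  simp only [partialMatrix, Matrix.of_apply, Matrix.mul_apply, Matrix.add_apply]
  rw [partialDeriv_sum (fun l _ => (hA i l).fun_mul (hB l j)), ← Finset.sum_add_distrib]
  exact Finset.sum_congr rfl fun l _ => partialDeriv_mul (hA i l) (hB l j) k

theorem partialMatrix_inv (h : ∀ i j, ContDiffAt ℝ ∞ (fun z => G z i j) y)
    (hdet : (G y).det ≠ 0) (k : Fin n) :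
    partialMatrix k (fun z => (G z)⁻¹) y = -((G y)⁻¹ * partialMatrix k G y * (G y)⁻¹) := by
  have hd : ∀ i j, DifferentiableAt ℝ (fun z => G z i j) y := fun i j =>
    (h i j).differentiableAt (by simp)
  have hi : ∀ i j, DifferentiableAt ℝ (fun z => (G z)⁻¹ i j) y := fun i j =>
    (contDiffAt_inv_apply h hdet i j).differentiableAt (by simp)
  have hev : ∀ᶠ z in 𝓝 y, (G z).det ≠ 0 := (contDiffAt_det h).continuousAt.eventually_ne hdet
  have h0 : partialMatrix k (fun z => (G z)⁻¹ * G z) y = 0 := by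
    ext i j
    simp only [partialMatrix, Matrix.of_apply, Matrix.zero_apply]
    rw [partialDeriv_congr (H := fun _ => (1 : Matrix (Fin n) (Fin n) ℝ) i j), partialDeriv_const]
    filter_upwards [hev] with z hz
    rw [Matrix.nonsing_inv_mul _ (isUnit_iff_ne_zero.2 hz)]
  rw [partialMatrix_mul hi hd] at h0
  have hu := isUnit_iff_ne_zero.2 hdet
  calc partialMatrix k (fun z => (G z)⁻¹) y
      = partialMatrix k (fun z => (G z)⁻¹) y * G y * (G y)⁻¹ := by
        rw [Matrix.mul_assoc, Matrix.mul_nonsing_inv _ hu, Matrix.mul_one]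
    _ = _ := by rw [eq_neg_of_add_eq_zero_left h0, Matrix.neg_mul]

/-- Jacobi's formula `∂_k det G = det G · tr (G⁻¹ ∂_k G)`. -/
theorem partialDeriv_det (h : ∀ i j, ContDiffAt ℝ ∞ (fun z => G z i j) y)
    (hdet : (G y).det ≠ 0) (k : Fin n) :
    partialDeriv k (fun z => (G z).det) y =
      (G y).det * ((G y)⁻¹ * partialMatrix k G y).trace := by
  have hu := isUnit_iff_ne_zero.2 hdet
  -- The affine family `z ↦ G y + (z - y)_k ∂_k G` has the same first-order jet along `e_k` as `G`,
  -- and the determinant sees only that jet.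
  have hdetd : Differentiable ℝ fun A : Fin n → Fin n → ℝ => (Matrix.of A).det := by
    have : ContDiff ℝ ∞ fun A : Fin n → Fin n → ℝ => (Matrix.of A).det :=
      contDiff_iff_contDiffAt.2 fun A => contDiffAt_det (A := fun A => Matrix.of A) fun i j => by
        simp only [Matrix.of_apply]; fun_prop
    exact this.differentiable (by simp)
  set e : EuclideanSpace ℝ (Fin n) := EuclideanSpace.single k 1
  have hline : HasDerivAt (fun t : ℝ => fun i j => G (y + t • e) i j)
      (fun i j => partialMatrix k G y i j) 0 := by
    refine hasDerivAt_pi.2 fun i => hasDerivAt_pi.2 fun j => ?_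
    have h1 : HasFDerivAt (fun z => G z i j) (fderiv ℝ (fun z => G z i j) y) y :=
      ((h i j).differentiableAt (by simp)).hasFDerivAt
    exact h1.hasLineDerivAt e
  have hline2 : HasDerivAt (fun t : ℝ => fun i j => (G y + t • partialMatrix k G y) i j)
      (fun i j => partialMatrix k G y i j) 0 := by
    refine hasDerivAt_pi.2 fun i => hasDerivAt_pi.2 fun j => ?_
    simpa using ((hasDerivAt_id (0 : ℝ)).mul_const (partialMatrix k G y i j)).const_add (G y i j)
  have h1 := (hdetd (fun i j => G y i j)).hasFDerivAt
  have hA := HasFDerivAt.comp_hasDerivAt (x := (0 : ℝ))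
    (f := fun t : ℝ => fun i j => G (y + t • e) i j)
    (l := fun A : Fin n → Fin n → ℝ => (Matrix.of A).det) (by simpa using h1) hline
  have hB := HasFDerivAt.comp_hasDerivAt (x := (0 : ℝ))
    (f := fun t : ℝ => fun i j => (G y + t • partialMatrix k G y) i j)
    (l := fun A : Fin n → Fin n → ℝ => (Matrix.of A).det) (by simpa using h1) hline2
  have hC : HasDerivAt (fun t : ℝ => (G (y + t • e)).det)
      (partialDeriv k (fun z => (G z).det) y) 0 :=
    (((contDiffAt_det h).differentiableAt (by simp)).hasFDerivAt).hasLineDerivAt e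
  have hD : HasDerivAt (fun t : ℝ => (G y + t • partialMatrix k G y).det)
      ((G y).det * ((G y)⁻¹ * partialMatrix k G y).trace) 0 := by
    have heq : (fun t : ℝ => (G y + t • partialMatrix k G y).det) = fun t : ℝ =>
        (G y).det * (1 + ((G y)⁻¹ * partialMatrix k G y).trace * t +
          ((1 + (Polynomial.X : Polynomial ℝ) •
            ((G y)⁻¹ * partialMatrix k G y).map Polynomial.C).det.divX.divX).eval t * t ^ 2) := by
      funext t
      rw [← Matrix.det_one_add_smul, ← Matrix.det_mul, Matrix.mul_add, Matrix.mul_one,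
        Matrix.mul_smul, ← Matrix.mul_assoc, Matrix.mul_nonsing_inv _ hu, Matrix.one_mul]
    rw [heq]
    generalize ((1 + (Polynomial.X : Polynomial ℝ) •
            ((G y)⁻¹ * partialMatrix k G y).map Polynomial.C).det.divX.divX) = q
    generalize ((G y)⁻¹ * partialMatrix k G y).trace = τ
    have h2 := (((hasDerivAt_id (0 : ℝ)).const_mul τ).const_add 1).add
      ((q.hasDerivAt 0).mul ((hasDerivAt_id (0 : ℝ)).pow 2))
    simpa using h2.const_mul (G y).det
  rw [hC.unique hA, hD.unique hB]

end MatrixFamilies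

/-! ### The Bochner identity in coordinates -/

section Bochner

variable {n : ℕ}

/-- The index bookkeeping of the Bochner identity: `X` stands for the gradient, `dX k i` for
`∂_k X^i`, `C k i j` for the Christoffel symbols `Γ^k_{ij}`, `s` for the logarithm of the density
and `Y i k` for `∇_i X^k`. -/
theorem bochner_algebra (X s : Fin n → ℝ) (dX ss Y : Fin n → Fin n → ℝ)
    (ddX C dY : Fin n → Fin n → Fin n → ℝ) (dC : Fin n → Fin n → Fin n → Fin n → ℝ)
    (hdd : ∀ i k l, ddX i k l = ddX k i l)
    (hC : ∀ k i j, C k i j = C k j i)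
    (hY : ∀ i k, Y i k = dX i k + ∑ l, C k i l * X l)
    (hdY : ∀ m i k, dY m i k = ddX m i k + ∑ l, (dC m k i l * X l + C k i l * dX m l)) :
    ∑ k, ∑ i, (dX k i * Y i k + X i * dY k i k) +
        ∑ k, (∑ l, C l l k + s k) * ∑ i, X i * Y i k -
        ∑ i, X i * (∑ k, dY i k k + ∑ k, (ss i k * X k + s k * dX i k)) =
      ∑ i, ∑ k, Y k i * Y i k +
        ∑ i, ∑ j, (((∑ k, (dC k k i j - dC i k k j)) +
          ∑ k, ∑ l, (C k k l * C l i j - C k i l * C l k j)) -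
          (ss i j - ∑ k, C k i j * s k)) * (X i * X j) := by
  have hdX : ∀ i k, dX i k = Y i k - ∑ l, C k i l * X l := fun i k => by rw [hY]; ring
  simp only [hdY, hdX, add_mul, sub_mul, mul_add, mul_sub, Finset.mul_sum, Finset.sum_mul,
    Finset.sum_add_distrib, Finset.sum_sub_distrib]
  have swap : ∀ f : Fin n → Fin n → Fin n → ℝ,
      ∑ a, ∑ b, ∑ c, f a b c = ∑ a, ∑ c, ∑ b, f a b c :=
    fun f => Finset.sum_congr rfl fun a _ => Finset.sum_comm
  have rot : ∀ f : Fin n → Fin n → Fin n → ℝ,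
      ∑ a, ∑ b, ∑ c, f a b c = ∑ b, ∑ c, ∑ a, f a b c := fun f => by
    rw [Finset.sum_comm]; exact Finset.sum_congr rfl fun b _ => Finset.sum_comm
  have e1 : ∑ x, ∑ k, Y x k * Y k x = ∑ i, ∑ k, Y k i * Y i k := by simp only [mul_comm]
  have e2 : ∑ k, ∑ i, X i * ddX k i k = ∑ i, ∑ k, X i * ddX i k k := by
    rw [Finset.sum_comm]; simp only [hdd]
  have e3 : ∑ q, ∑ r, ∑ p, X r * (C q r p * Y q p) = ∑ p, ∑ q, ∑ r, C q p r * X r * Y q p := by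
    rw [rot fun p q r => C q p r * X r * Y q p]
    refine Finset.sum_congr rfl fun q _ => Finset.sum_congr rfl fun r _ =>
      Finset.sum_congr rfl fun p _ => ?_
    rw [hC q r p]; ring
  have e4 : ∑ k, ∑ i, ∑ j, X i * (dC k k i j * X j) =
      ∑ i, ∑ j, ∑ k, dC k k i j * (X i * X j) := by
    rw [rot fun k i j => X i * (dC k k i j * X j)]
    simp only [mul_left_comm]
  have e5 : ∑ i, ∑ k, ∑ j, X i * (dC i k k j * X j) =
      ∑ i, ∑ j, ∑ k, dC i k k j * (X i * X j) := by
    rw [swap fun i k j => X i * (dC i k k j * X j)]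
    simp only [mul_left_comm]
  have e6 : ∑ k, ∑ i, ∑ l, ∑ j, X i * (C k i l * (C l k j * X j)) =
      ∑ i, ∑ j, ∑ k, ∑ l, C k i l * C l k j * (X i * X j) := by
    rw [Finset.sum_comm]
    refine Finset.sum_congr rfl fun i _ => ?_
    rw [rot fun k l j => X i * (C k i l * (C l k j * X j)),
      rot fun l j k => X i * (C k i l * (C l k j * X j))]
    refine Finset.sum_congr rfl fun j _ => Finset.sum_congr rfl fun k _ =>
      Finset.sum_congr rfl fun l _ => by ring
  have e7 : ∑ k, ∑ i, ∑ l, C l l k * (X i * Y i k) = ∑ i, ∑ l, ∑ k, X i * (C l l k * Y i k) := by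
    rw [rot fun k i l => C l l k * (X i * Y i k)]
    simp only [mul_left_comm]
  have e8 : ∑ k, ∑ i, s k * (X i * Y i k) = ∑ i, ∑ k, X i * (s k * Y i k) := by
    rw [Finset.sum_comm]; simp only [mul_left_comm]
  have e9 : ∑ i, ∑ k, ∑ l, ∑ j, X i * (C k k l * (C l i j * X j)) =
      ∑ i, ∑ j, ∑ k, ∑ l, C k k l * C l i j * (X i * X j) := by
    refine Finset.sum_congr rfl fun i _ => ?_
    rw [rot fun k l j => X i * (C k k l * (C l i j * X j)),
      rot fun l j k => X i * (C k k l * (C l i j * X j))]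
    refine Finset.sum_congr rfl fun j _ => Finset.sum_congr rfl fun k _ =>
      Finset.sum_congr rfl fun l _ => by ring
  have e10 : ∑ i, ∑ j, X i * (ss i j * X j) = ∑ i, ∑ j, ss i j * (X i * X j) := by
    simp only [mul_left_comm]
  have e11 : ∑ i, ∑ k, ∑ j, X i * (s k * (C k i j * X j)) =
      ∑ i, ∑ j, ∑ k, C k i j * s k * (X i * X j) := by
    rw [swap fun i k j => X i * (s k * (C k i j * X j))]
    refine Finset.sum_congr rfl fun j _ => Finset.sum_congr rfl fun k _ =>
      Finset.sum_congr rfl fun l _ => by ring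
  linarith

/-- Metrics on an open set of Euclidean space, given by a smooth field of positive definite
matrices. -/
structure IsMetricField (U : Set (EuclideanSpace ℝ (Fin n)))
    (G : EuclideanSpace ℝ (Fin n) → Matrix (Fin n) (Fin n) ℝ) : Prop where
  isOpen : IsOpen U
  smooth : ∀ i j, ContDiffOn ℝ ∞ (fun z => G z i j) U
  posDef : ∀ y ∈ U, (G y).PosDef

/-- The components `X^i = G^{ij} ∂_j F` of the gradient. -/
def gradCoord (G : EuclideanSpace ℝ (Fin n) → Matrix (Fin n) (Fin n) ℝ)
    (F : EuclideanSpace ℝ (Fin n) → ℝ) (i : Fin n) (y : EuclideanSpace ℝ (Fin n)) : ℝ :=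
  ∑ j, (G y)⁻¹ i j * partialDeriv j F y

/-- `⟨dF, dH⟩ = G^{ij} ∂_i F ∂_j H`. -/
def cometricCoord (G : EuclideanSpace ℝ (Fin n) → Matrix (Fin n) (Fin n) ℝ)
    (F H : EuclideanSpace ℝ (Fin n) → ℝ) (y : EuclideanSpace ℝ (Fin n)) : ℝ :=
  ∑ i, ∑ j, (G y)⁻¹ i j * partialDeriv i F y * partialDeriv j H y

/-- The weighted Laplacian `ΔF + ⟨d log ρ, dF⟩`, with `s = log ρ`, as
`∂_i X^i + (Γ^l_{li} + ∂_i s) X^i` for `X` the gradient of `F`. -/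
def weightedLaplacian (G : EuclideanSpace ℝ (Fin n) → Matrix (Fin n) (Fin n) ℝ)
    (s F : EuclideanSpace ℝ (Fin n) → ℝ) (y : EuclideanSpace ℝ (Fin n)) : ℝ :=
  ∑ i, (partialDeriv i (gradCoord G F i) y +
    (∑ l, christoffel G l l i y + partialDeriv i s y) * gradCoord G F i y)

/-- The components `∇_i X^k` of the covariant derivative of the gradient. -/
def covDerivGrad (G : EuclideanSpace ℝ (Fin n) → Matrix (Fin n) (Fin n) ℝ)
    (F : EuclideanSpace ℝ (Fin n) → ℝ) (i k : Fin n) (y : EuclideanSpace ℝ (Fin n)) : ℝ :=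
  partialDeriv i (gradCoord G F k) y + ∑ l, christoffel G k i l y * gradCoord G F l y

namespace IsMetricField

variable {U : Set (EuclideanSpace ℝ (Fin n))}
  {G : EuclideanSpace ℝ (Fin n) → Matrix (Fin n) (Fin n) ℝ} {y : EuclideanSpace ℝ (Fin n)}
  {F s : EuclideanSpace ℝ (Fin n) → ℝ}

theorem contDiffAt (h : IsMetricField U G) (hy : y ∈ U) (i j : Fin n) :
    ContDiffAt ℝ ∞ (fun z => G z i j) y :=
  (h.smooth i j).contDiffAt (h.isOpen.mem_nhds hy)

theorem det_pos (h : IsMetricField U G) (hy : y ∈ U) : 0 < (G y).det := (h.posDef y hy).det_pos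

theorem apply_comm (h : IsMetricField U G) (hy : y ∈ U) (i j : Fin n) : G y i j = G y j i := by
  simpa using (h.posDef y hy).isHermitian.apply j i

theorem inv_comm (h : IsMetricField U G) (hy : y ∈ U) (i j : Fin n) :
    (G y)⁻¹ i j = (G y)⁻¹ j i := by
  simpa using (h.posDef y hy).inv.isHermitian.apply j i

theorem contDiffAt_inv (h : IsMetricField U G) (hy : y ∈ U) (i j : Fin n) :
    ContDiffAt ℝ ∞ (fun z => (G z)⁻¹ i j) y :=
  contDiffAt_inv_apply (h.contDiffAt hy) (h.det_pos hy).ne' i j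

theorem partialDeriv_apply_comm (h : IsMetricField U G) (hy : y ∈ U) (k i j : Fin n) :
    partialDeriv k (fun z => G z i j) y = partialDeriv k (fun z => G z j i) y :=
  partialDeriv_congr (by
    filter_upwards [h.isOpen.mem_nhds hy] with z hz using h.apply_comm hz i j) k

theorem contDiffAt_christoffel (h : IsMetricField U G) (hy : y ∈ U) (k i j : Fin n) :
    ContDiffAt ℝ ∞ (christoffel G k i j) y := by
  unfold christoffel
  refine contDiffAt_const.mul (ContDiffAt.sum fun l _ => (h.contDiffAt_inv hy k l).mul ?_)
  exact ((contDiffAt_partialDeriv (h.contDiffAt hy _ _) _).add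
    (contDiffAt_partialDeriv (h.contDiffAt hy _ _) _)).sub
      (contDiffAt_partialDeriv (h.contDiffAt hy _ _) _)

theorem christoffel_comm (h : IsMetricField U G) (hy : y ∈ U) (k i j : Fin n) :
    christoffel G k i j y = christoffel G k j i y := by
  unfold christoffel
  congr 1
  refine Finset.sum_congr rfl fun l _ => ?_
  rw [h.partialDeriv_apply_comm hy l i j]; ring

theorem contDiffAt_gradCoord (h : IsMetricField U G) (hy : y ∈ U) (hF : ContDiffAt ℝ ∞ F y)
    (i : Fin n) : ContDiffAt ℝ ∞ (gradCoord G F i) y :=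
  ContDiffAt.sum fun j _ => (h.contDiffAt_inv hy i j).mul (contDiffAt_partialDeriv hF j)

/-- Lowering the upper index: `G_{ml} Γ^l_{ij} = ½ (∂_i G_{jm} + ∂_j G_{im} - ∂_m G_{ij})`. -/
theorem sum_mul_christoffel (h : IsMetricField U G) (hy : y ∈ U) (m i j : Fin n) :
    ∑ l, G y m l * christoffel G l i j y = (1 / 2) * (partialDeriv i (fun z => G z j m) y +
      partialDeriv j (fun z => G z i m) y - partialDeriv m (fun z => G z i j) y) := by
  set c : Fin n → ℝ := fun q => (1 / 2) * (partialDeriv i (fun z => G z j q) y +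
    partialDeriv j (fun z => G z i q) y - partialDeriv q (fun z => G z i j) y)
  have h1 : (fun l => christoffel G l i j y) = (G y)⁻¹.mulVec c := by
    funext l
    simp only [christoffel, Matrix.mulVec, dotProduct, Finset.mul_sum, c]
    exact Finset.sum_congr rfl fun q _ => by ring
  have h2 : (G y).mulVec (fun l => christoffel G l i j y) = c := by
    rw [h1, Matrix.mulVec_mulVec, Matrix.mul_nonsing_inv _ (h.det_pos hy).ne'.isUnit,
      Matrix.one_mulVec]
  exact congrFun h2 m

/-- Metric compatibility `∂_k G = G Γ_k + (G Γ_k)ᵀ`, where `(Γ_k)^l_j = Γ^l_{kj}`. -/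
theorem partialMatrix_eq (h : IsMetricField U G) (hy : y ∈ U) (k : Fin n) :
    partialMatrix k G y = G y * Matrix.of (fun l j => christoffel G l k j y) +
      (G y * Matrix.of (fun l j => christoffel G l k j y)).transpose := by
  ext i j
  simp only [partialMatrix, Matrix.of_apply, Matrix.add_apply, Matrix.mul_apply,
    Matrix.transpose_apply, h.sum_mul_christoffel hy]
  rw [h.partialDeriv_apply_comm hy k j i, h.partialDeriv_apply_comm hy j k i,
    h.partialDeriv_apply_comm hy i k j]
  ring

/-- `∂_k G^{ij} = - Γ^i_{kl} G^{lj} - Γ^j_{kl} G^{il}`. -/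
theorem partialDeriv_inv (h : IsMetricField U G) (hy : y ∈ U) (k i j : Fin n) :
    partialDeriv k (fun z => (G z)⁻¹ i j) y =
      -∑ l, christoffel G i k l y * (G y)⁻¹ l j - ∑ l, christoffel G j k l y * (G y)⁻¹ i l := by
  have hu := (h.det_pos hy).ne'.isUnit
  have hs : (G y).transpose = G y := by ext a b; exact h.apply_comm hy b a
  have key : partialMatrix k (fun z => (G z)⁻¹) y =
      -(Matrix.of (fun l j => christoffel G l k j y) * (G y)⁻¹) -
        (G y)⁻¹ * (Matrix.of (fun l j => christoffel G l k j y)).transpose := by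
    rw [partialMatrix_inv (h.contDiffAt hy) (h.det_pos hy).ne', h.partialMatrix_eq hy,
      Matrix.transpose_mul, hs, Matrix.mul_add, Matrix.add_mul, ← Matrix.mul_assoc,
      Matrix.nonsing_inv_mul _ hu, Matrix.one_mul, ← Matrix.mul_assoc,
      Matrix.mul_assoc _ (G y) (G y)⁻¹, Matrix.mul_nonsing_inv _ hu, Matrix.mul_one]
    abel
  have := congrFun (congrFun key i) j
  simpa [partialMatrix, Matrix.mul_apply, mul_comm] using this

/-- `∂_k log √(det G) = Γ^l_{lk}`. -/
theorem partialDeriv_log_sqrt_det (h : IsMetricField U G) (hy : y ∈ U) (k : Fin n) :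
    partialDeriv k (fun z => Real.log (Real.sqrt (G z).det)) y = ∑ l, christoffel G l l k y := by
  have hu := (h.det_pos hy).ne'.isUnit
  have hs : (G y).transpose = G y := by ext a b; exact h.apply_comm hy b a
  have hp := h.det_pos hy
  have h1 : HasDerivAt (fun t : ℝ => Real.log (Real.sqrt t)) (((G y).det)⁻¹ / 2) (G y).det := by
    have : HasDerivAt (fun t : ℝ => Real.log t / 2) (((G y).det)⁻¹ / 2) (G y).det :=
      (Real.hasDerivAt_log hp.ne').div_const 2
    refine this.congr_of_eventuallyEq ?_
    filter_upwards [lt_mem_nhds hp] with t ht using Real.log_sqrt ht.le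
  rw [partialDeriv_comp h1 ((contDiffAt_det (h.contDiffAt hy)).differentiableAt (by simp)),
    partialDeriv_det (h.contDiffAt hy) hp.ne', h.partialMatrix_eq hy, Matrix.mul_add,
    Matrix.trace_add, Matrix.transpose_mul, hs, ← Matrix.mul_assoc, Matrix.nonsing_inv_mul _ hu,
    Matrix.one_mul, Matrix.trace_mul_comm, Matrix.mul_assoc, Matrix.mul_nonsing_inv _ hu,
    Matrix.mul_one, Matrix.trace_transpose]
  simp only [Matrix.trace, Matrix.diag, Matrix.of_apply, h.christoffel_comm hy _ _ k]
  field_simp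
  ring

theorem hessianCoord_comm (h : IsMetricField U G) (hy : y ∈ U) (hF : ContDiffAt ℝ ∞ F y)
    (i j : Fin n) : hessianCoord G F i j y = hessianCoord G F j i y := by
  unfold hessianCoord
  rw [partialDeriv_comm hF]
  simp only [h.christoffel_comm hy _ i j]

/-- The Ricci tensor is symmetric since `Γ^k_{kj}` is a gradient. -/
theorem ricciCoord_comm (h : IsMetricField U G) (hy : y ∈ U) (i j : Fin n) :
    ricciCoord G i j y = ricciCoord G j i y := by
  have hlog : ContDiffAt ℝ ∞ (fun z => Real.log (Real.sqrt (G z).det)) y :=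
    ((contDiffAt_det (h.contDiffAt hy)).sqrt (h.det_pos hy).ne').log
      (Real.sqrt_pos.2 (h.det_pos hy)).ne'
  have key : ∀ i j : Fin n, ∑ k, partialDeriv i (christoffel G k k j) y =
      partialDeriv i (partialDeriv j (fun z => Real.log (Real.sqrt (G z).det))) y := by
    intro i j
    rw [← partialDeriv_sum fun k _ =>
      (h.contDiffAt_christoffel hy k k j).differentiableAt (by simp)]
    refine (partialDeriv_congr ?_ i).symm
    filter_upwards [h.isOpen.mem_nhds hy] with z hz using h.partialDeriv_log_sqrt_det hz j
  have hc : ∀ k i j : Fin n, partialDeriv k (christoffel G k i j) y =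
      partialDeriv k (christoffel G k j i) y := fun k i j => partialDeriv_congr (by
    filter_upwards [h.isOpen.mem_nhds hy] with z hz using h.christoffel_comm hz k i j) k
  unfold ricciCoord
  simp only [Finset.sum_sub_distrib, key, hc _ i j, partialDeriv_comm hlog i j,
    h.christoffel_comm hy _ i j]
  congr 2
  rw [Finset.sum_comm]
  refine Finset.sum_congr rfl fun k _ => Finset.sum_congr rfl fun l _ => ?_
  rw [h.christoffel_comm hy l i k, h.christoffel_comm hy k l j]
  rw [h.christoffel_comm hy l k i, h.christoffel_comm hy k j l]
  ring

/-- Raising an index of the Hessian: `∇_i X^k = G^{kj} (∇²F)_{ij}`. -/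
theorem covDerivGrad_eq (h : IsMetricField U G) (hy : y ∈ U) (hF : ContDiffAt ℝ ∞ F y)
    (i k : Fin n) :
    covDerivGrad G F i k y = ∑ j, (G y)⁻¹ k j * hessianCoord G F i j y := by
  unfold covDerivGrad
  have h1 : partialDeriv i (gradCoord G F k) y = ∑ j,
      (partialDeriv i (fun z => (G z)⁻¹ k j) y * partialDeriv j F y +
        (G y)⁻¹ k j * partialDeriv i (partialDeriv j F) y) := by
    have hd : ∀ j, DifferentiableAt ℝ (fun z => (G z)⁻¹ k j) y := fun j =>
      (h.contDiffAt_inv hy k j).differentiableAt (by simp)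
    have hp : ∀ j, DifferentiableAt ℝ (partialDeriv j F) y := fun j =>
      (contDiffAt_partialDeriv hF j).differentiableAt (by simp)
    have : gradCoord G F k = fun z => ∑ j, (G z)⁻¹ k j * partialDeriv j F z := rfl
    rw [this, partialDeriv_sum fun j _ => (hd j).fun_mul (hp j)]
    exact Finset.sum_congr rfl fun j _ => partialDeriv_mul (hd j) (hp j) i
  rw [h1]
  simp only [h.partialDeriv_inv hy, gradCoord, hessianCoord, mul_sub, sub_mul, neg_mul,
    Finset.sum_add_distrib, Finset.sum_sub_distrib, Finset.mul_sum, Finset.sum_mul,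
    Finset.sum_neg_distrib]
  have e1 : ∑ l, ∑ j, christoffel G k i l y * ((G y)⁻¹ l j * partialDeriv j F y) =
      ∑ j, ∑ l, christoffel G k i l y * (G y)⁻¹ l j * partialDeriv j F y := by
    rw [Finset.sum_comm]; simp only [mul_assoc]
  have e2 : ∑ j, ∑ l, (G y)⁻¹ k j * (christoffel G l i j y * partialDeriv l F y) =
      ∑ j, ∑ l, christoffel G j i l y * (G y)⁻¹ k l * partialDeriv j F y := by
    rw [Finset.sum_comm]
    exact Finset.sum_congr rfl fun j _ => Finset.sum_congr rfl fun l _ => by ring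
  linarith

theorem cometricCoord_eq_sum (h : IsMetricField U G) (hy : y ∈ U)
    (F H : EuclideanSpace ℝ (Fin n) → ℝ) :
    cometricCoord G F H y = ∑ i, gradCoord G F i y * partialDeriv i H y := by
  rw [cometricCoord, Finset.sum_comm]
  refine Finset.sum_congr rfl fun i _ => ?_
  rw [gradCoord, Finset.sum_mul]
  exact Finset.sum_congr rfl fun j _ => by rw [h.inv_comm hy j i]

/-- `½ ∂_k ⟨dF, dF⟩ = X^l (∇²F)_{kl}`. -/
theorem partialDeriv_cometricCoord_self (h : IsMetricField U G) (hy : y ∈ U)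
    (hF : ContDiffAt ℝ ∞ F y) (k : Fin n) :
    partialDeriv k (cometricCoord G F F) y =
      2 * ∑ l, gradCoord G F l y * hessianCoord G F k l y := by
  have hX : ∀ i, DifferentiableAt ℝ (gradCoord G F i) y := fun i =>
    (h.contDiffAt_gradCoord hy hF i).differentiableAt (by simp)
  have hp : ∀ j, DifferentiableAt ℝ (partialDeriv j F) y := fun j =>
    (contDiffAt_partialDeriv hF j).differentiableAt (by simp)
  have h0 : cometricCoord G F F =ᶠ[𝓝 y] fun z => ∑ i, gradCoord G F i z * partialDeriv i F z := by
    refine Eventually.of_forall fun z => ?_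
    simp only [cometricCoord, gradCoord, Finset.sum_mul]
    exact Finset.sum_congr rfl fun i _ => Finset.sum_congr rfl fun j _ => by ring
  have h1 : ∀ i, partialDeriv k (gradCoord G F i) y = ∑ j, (G y)⁻¹ i j * hessianCoord G F k j y -
      ∑ l, christoffel G i k l y * gradCoord G F l y := fun i => by
    rw [← h.covDerivGrad_eq hy hF, covDerivGrad]; ring
  rw [partialDeriv_congr h0, partialDeriv_sum fun i _ => (hX i).fun_mul (hp i)]
  simp only [partialDeriv_mul (hX _) (hp _), h1, sub_mul, Finset.sum_add_distrib,
    Finset.sum_sub_distrib, Finset.sum_mul]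
  have e1 : ∑ i, ∑ j, (G y)⁻¹ i j * hessianCoord G F k j y * partialDeriv i F y =
      ∑ l, gradCoord G F l y * hessianCoord G F k l y := by
    rw [Finset.sum_comm]
    refine Finset.sum_congr rfl fun j _ => ?_
    rw [gradCoord, Finset.sum_mul]
    exact Finset.sum_congr rfl fun i _ => by rw [h.inv_comm hy i j]; ring
  have e2 : ∑ l, gradCoord G F l y * hessianCoord G F k l y =
      ∑ i, gradCoord G F i y * partialDeriv k (partialDeriv i F) y -
        ∑ i, ∑ l, christoffel G i k l y * gradCoord G F l y * partialDeriv i F y := by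
    rw [Finset.sum_comm, ← Finset.sum_sub_distrib]
    refine Finset.sum_congr rfl fun l _ => ?_
    simp only [hessianCoord, mul_sub, Finset.mul_sum]
    congr 1
    exact Finset.sum_congr rfl fun i _ => by ring
  linarith

theorem gradCoord_cometricCoord_self (h : IsMetricField U G) (hy : y ∈ U)
    (hF : ContDiffAt ℝ ∞ F y) (k : Fin n) :
    gradCoord G (cometricCoord G F F) k y =
      2 * ∑ i, gradCoord G F i y * covDerivGrad G F i k y := by
  simp only [h.covDerivGrad_eq hy hF]
  rw [gradCoord]
  simp only [h.partialDeriv_cometricCoord_self hy hF, Finset.mul_sum]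
  rw [Finset.sum_comm]
  refine Finset.sum_congr rfl fun l _ => Finset.sum_congr rfl fun j _ => ?_
  rw [h.hessianCoord_comm hy hF]; ring

/-- The weighted Laplacian is the divergence `∇_k X^k + ∂_k s X^k`. -/
theorem weightedLaplacian_eq (y : EuclideanSpace ℝ (Fin n)) :
    weightedLaplacian G s F y = ∑ k, covDerivGrad G F k k y +
      ∑ k, partialDeriv k s y * gradCoord G F k y := by
  simp only [weightedLaplacian, covDerivGrad, add_mul, Finset.sum_add_distrib, Finset.sum_mul]
  rw [Finset.sum_comm (f := fun i l => christoffel G l l i y * gradCoord G F i y)]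
  ring

/-- The weighted Bochner identity
`½ L ⟨dF, dF⟩ - ⟨dF, d(LF)⟩ = |∇²F|² + (Ric - ∇²s)(∇F, ∇F)`. -/
theorem bochner (h : IsMetricField U G) (hy : y ∈ U) (hF : ContDiffOn ℝ ∞ F U)
    (hs : ContDiffOn ℝ ∞ s U) :
    (1 / 2) * weightedLaplacian G s (cometricCoord G F F) y -
        cometricCoord G F (weightedLaplacian G s F) y =
      ∑ i, ∑ j, ∑ a, ∑ b, (G y)⁻¹ i a * (G y)⁻¹ j b * hessianCoord G F i j y *
          hessianCoord G F a b y +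
        ∑ i, ∑ j, (ricciCoord G i j y - hessianCoord G s i j y) *
          (gradCoord G F i y * gradCoord G F j y) := by
  have hFy : ∀ z ∈ U, ContDiffAt ℝ ∞ F z := fun z hz => hF.contDiffAt (h.isOpen.mem_nhds hz)
  have hsy := hs.contDiffAt (h.isOpen.mem_nhds hy)
  have hX : ∀ i, ContDiffAt ℝ ∞ (gradCoord G F i) y := fun i =>
    h.contDiffAt_gradCoord hy (hFy y hy) i
  have hXd : ∀ i, DifferentiableAt ℝ (gradCoord G F i) y := fun i =>
    (hX i).differentiableAt (by simp)
  have hdXd : ∀ i k, DifferentiableAt ℝ (partialDeriv k (gradCoord G F i)) y := fun i k =>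
    (contDiffAt_partialDeriv (hX i) k).differentiableAt (by simp)
  have hCd : ∀ k i j, DifferentiableAt ℝ (christoffel G k i j) y := fun k i j =>
    (h.contDiffAt_christoffel hy k i j).differentiableAt (by simp)
  have hsd : ∀ k, DifferentiableAt ℝ (partialDeriv k s) y := fun k =>
    (contDiffAt_partialDeriv hsy k).differentiableAt (by simp)
  have hYd : ∀ i k, DifferentiableAt ℝ (covDerivGrad G F i k) y := fun i k =>
    (hdXd k i).add (DifferentiableAt.fun_sum fun l _ => (hCd k i l).mul (hXd l))
  have hdY : ∀ m i k, partialDeriv m (covDerivGrad G F i k) y =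
      partialDeriv m (partialDeriv i (gradCoord G F k)) y +
        ∑ l, (partialDeriv m (christoffel G k i l) y * gradCoord G F l y +
          christoffel G k i l y * partialDeriv m (gradCoord G F l) y) := by
    intro m i k
    have : covDerivGrad G F i k = fun z => partialDeriv i (gradCoord G F k) z +
      ∑ l, christoffel G k i l z * gradCoord G F l z := rfl
    rw [this, partialDeriv_add (hdXd k i)
      (DifferentiableAt.fun_sum fun l _ => (hCd k i l).fun_mul (hXd l)),
      partialDeriv_sum fun l _ => (hCd k i l).fun_mul (hXd l)]
    simp only [partialDeriv_mul (hCd _ _ _) (hXd _)]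
  have key := bochner_algebra (fun i => gradCoord G F i y) (fun k => partialDeriv k s y)
    (fun k i => partialDeriv k (gradCoord G F i) y)
    (fun i k => partialDeriv i (partialDeriv k s) y) (fun i k => covDerivGrad G F i k y)
    (fun m i k => partialDeriv m (partialDeriv i (gradCoord G F k)) y)
    (fun k i j => christoffel G k i j y) (fun m i k => partialDeriv m (covDerivGrad G F i k) y)
    (fun m k i j => partialDeriv m (christoffel G k i j) y)
    (fun i k l => partialDeriv_comm (hX l) i k) (fun k i j => h.christoffel_comm hy k i j)
    (fun i k => rfl) hdY
  have hL : (1 / 2) * weightedLaplacian G s (cometricCoord G F F) y =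
      ∑ k, ∑ i, (partialDeriv k (gradCoord G F i) y * covDerivGrad G F i k y +
        gradCoord G F i y * partialDeriv k (covDerivGrad G F i k) y) +
      ∑ k, (∑ l, christoffel G l l k y + partialDeriv k s y) *
        ∑ i, gradCoord G F i y * covDerivGrad G F i k y := by
    have h1 : ∀ k, partialDeriv k (gradCoord G (cometricCoord G F F) k) y =
        2 * ∑ i, (partialDeriv k (gradCoord G F i) y * covDerivGrad G F i k y +
        gradCoord G F i y * partialDeriv k (covDerivGrad G F i k) y) := by
      intro k
      rw [partialDeriv_congr (H := fun z => 2 * ∑ i, gradCoord G F i z * covDerivGrad G F i k z)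
        (by filter_upwards [h.isOpen.mem_nhds hy] with z hz using
              h.gradCoord_cometricCoord_self hz (hFy z hz) k),
        partialDeriv_mul (differentiableAt_const _)
          (DifferentiableAt.fun_sum fun i _ => (hXd i).fun_mul (hYd i k)), partialDeriv_const,
        partialDeriv_sum fun i _ => (hXd i).fun_mul (hYd i k)]
      simp only [partialDeriv_mul (hXd _) (hYd _ _)]
      ring
    rw [weightedLaplacian, ← Finset.sum_add_distrib, Finset.mul_sum]
    refine Finset.sum_congr rfl fun k _ => ?_
    rw [h1, h.gradCoord_cometricCoord_self hy (hFy y hy)]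
    ring
  have hR : cometricCoord G F (weightedLaplacian G s F) y =
      ∑ i, gradCoord G F i y * (∑ k, partialDeriv i (covDerivGrad G F k k) y +
        ∑ k, (partialDeriv i (partialDeriv k s) y * gradCoord G F k y +
          partialDeriv k s y * partialDeriv i (gradCoord G F k) y)) := by
    have h1 : ∀ i, partialDeriv i (weightedLaplacian G s F) y =
        ∑ k, partialDeriv i (covDerivGrad G F k k) y +
        ∑ k, (partialDeriv i (partialDeriv k s) y * gradCoord G F k y +
          partialDeriv k s y * partialDeriv i (gradCoord G F k) y) := by
      intro i
      rw [partialDeriv_congr (Eventually.of_forall weightedLaplacian_eq),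
        partialDeriv_add (DifferentiableAt.fun_sum fun k _ => hYd k k)
          (DifferentiableAt.fun_sum fun k _ => (hsd k).fun_mul (hXd k)),
        partialDeriv_sum fun k _ => hYd k k,
        partialDeriv_sum fun k _ => (hsd k).fun_mul (hXd k)]
      simp only [partialDeriv_mul (hsd _) (hXd _)]
    simp only [cometricCoord, h1]
    rw [Finset.sum_comm]
    refine Finset.sum_congr rfl fun i _ => ?_
    rw [← Finset.sum_mul]
    congr 1
    exact Finset.sum_congr rfl fun j _ => by rw [h.inv_comm hy]
  have hYY : ∑ i, ∑ k, covDerivGrad G F k i y * covDerivGrad G F i k y =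
      ∑ i, ∑ j, ∑ a, ∑ b, (G y)⁻¹ i a * (G y)⁻¹ j b * hessianCoord G F i j y *
          hessianCoord G F a b y := by
    simp only [h.covDerivGrad_eq hy (hFy y hy), Finset.sum_mul_sum]
    refine Finset.sum_congr rfl fun i _ => ?_
    rw [Finset.sum_comm, Finset.sum_congr rfl fun a _ => Finset.sum_comm, Finset.sum_comm]
    refine Finset.sum_congr rfl fun j _ => Finset.sum_congr rfl fun a _ =>
      Finset.sum_congr rfl fun k _ => ?_
    rw [h.inv_comm hy k j, h.hessianCoord_comm hy (hFy y hy) k a]; ring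
  rw [hL, hR, key, hYY]
  rfl

end IsMetricField

end Bochner

/-! ### Charts, chart frames and test functions -/

section Charts

variable {n : ℕ} {M : Type*} [TopologicalSpace M] [ChartedSpace (EuclideanSpace ℝ (Fin n)) M]

/-- The linear map `ℝⁿ → T_p M` that sends `v` to the tangent vector with components `v` in the
preferred chart at `x`, where `p` is the point with coordinates `y`. -/
def chartVector (x : M) (y : EuclideanSpace ℝ (Fin n)) :
    EuclideanSpace ℝ (Fin n) →L[ℝ] TangentSpace (𝓡 n) ((extChartAt (𝓡 n) x).symm y) :=
  mfderiv 𝓘(ℝ, EuclideanSpace ℝ (Fin n)) (𝓡 n) (extChartAt (𝓡 n) x).symm y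

/-- Extension by zero to `M` of a function of the coordinates in the preferred chart at `x`. -/
def extendChart (x : M) (ψ : EuclideanSpace ℝ (Fin n) → ℝ) : M → ℝ :=
  (extChartAt (𝓡 n) x).source.indicator (ψ ∘ extChartAt (𝓡 n) x)

theorem chartVector_eq_sum (x : M) (y v : EuclideanSpace ℝ (Fin n)) :
    chartVector x y v = ∑ i, v i • chartVector x y (EuclideanSpace.single i 1) := by
  have : v = ∑ i, v i • EuclideanSpace.single i (1 : ℝ) := by
    ext j; simp [Finset.sum_apply, Pi.single_apply]
  conv_lhs => rw [this]
  simp only [map_sum, map_smul]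

theorem extendChart_symm {x : M} (ψ : EuclideanSpace ℝ (Fin n) → ℝ)
    {y : EuclideanSpace ℝ (Fin n)} (hy : y ∈ (extChartAt (𝓡 n) x).target) :
    extendChart x ψ ((extChartAt (𝓡 n) x).symm y) = ψ y := by
  rw [extendChart, indicator_of_mem ((extChartAt (𝓡 n) x).map_target hy), Function.comp_apply,
    (extChartAt (𝓡 n) x).right_inv hy]

theorem extendChart_comp_symm_eventuallyEq {x : M} (ψ : EuclideanSpace ℝ (Fin n) → ℝ)
    {y : EuclideanSpace ℝ (Fin n)} (hy : y ∈ (extChartAt (𝓡 n) x).target) :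
    extendChart x ψ ∘ (extChartAt (𝓡 n) x).symm =ᶠ[𝓝 y] ψ := by
  filter_upwards [(isOpen_extChartAt_target x).mem_nhds hy] with z hz using extendChart_symm ψ hz

theorem isCompact_image_tsupport {x : M} {ψ : EuclideanSpace ℝ (Fin n) → ℝ}
    (hc : HasCompactSupport ψ) (hs : tsupport ψ ⊆ (extChartAt (𝓡 n) x).target) :
    IsCompact ((extChartAt (𝓡 n) x).symm '' tsupport ψ) :=
  hc.isCompact.image_of_continuousOn ((continuousOn_extChartAt_symm x).mono hs)

theorem tsupport_extendChart_subset [T2Space M] {x : M} {ψ : EuclideanSpace ℝ (Fin n) → ℝ}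
    (hc : HasCompactSupport ψ) (hs : tsupport ψ ⊆ (extChartAt (𝓡 n) x).target) :
    tsupport (extendChart x ψ) ⊆ (extChartAt (𝓡 n) x).symm '' tsupport ψ := by
  refine closure_minimal ?_ (isCompact_image_tsupport hc hs).isClosed
  intro p hp
  by_cases hps : p ∈ (extChartAt (𝓡 n) x).source
  · refine ⟨extChartAt (𝓡 n) x p, subset_tsupport _ ?_, (extChartAt (𝓡 n) x).left_inv hps⟩
    rwa [Function.mem_support, extendChart, indicator_of_mem hps] at hp
  · exact absurd (indicator_of_notMem hps _) hp

theorem hasCompactSupport_extendChart [T2Space M] {x : M} {ψ : EuclideanSpace ℝ (Fin n) → ℝ}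
    (hc : HasCompactSupport ψ) (hs : tsupport ψ ⊆ (extChartAt (𝓡 n) x).target) :
    HasCompactSupport (extendChart x ψ) :=
  (isCompact_image_tsupport hc hs).of_isClosed_subset (isClosed_tsupport _)
    (tsupport_extendChart_subset hc hs)

theorem tsupport_extendChart_subset_source [T2Space M] {x : M}
    {ψ : EuclideanSpace ℝ (Fin n) → ℝ}
    (hc : HasCompactSupport ψ) (hs : tsupport ψ ⊆ (extChartAt (𝓡 n) x).target) :
    tsupport (extendChart x ψ) ⊆ (extChartAt (𝓡 n) x).source := by
  intro p hp
  obtain ⟨y, hy, rfl⟩ := tsupport_extendChart_subset hc hs hp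
  exact (extChartAt (𝓡 n) x).map_target (hs hy)

theorem isSmooth_of_contDiffAt_comp_symm {f : M → ℝ}
    (h : ∀ x : M, ContDiffAt ℝ ∞ (f ∘ (extChartAt (𝓡 n) x).symm) (extChartAt (𝓡 n) x x)) :
    IsSmooth n f := by
  intro x
  have h1 : ContMDiffAt (𝓡 n) 𝓘(ℝ, ℝ) ∞
      ((f ∘ (extChartAt (𝓡 n) x).symm) ∘ extChartAt (𝓡 n) x) x :=
    (h x).contMDiffAt.comp x contMDiffAt_extChartAt
  refine h1.congr_of_eventuallyEq ?_
  filter_upwards [extChartAt_source_mem_nhds (I := 𝓡 n) x] with q hq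
  simp only [Function.comp_apply, (extChartAt (𝓡 n) x).left_inv hq]

variable [IsManifold (𝓡 n) ∞ M]

instance : IsManifold (𝓡 n) 1 M := IsManifold.of_le (n := ∞) (by simp)

theorem isSmooth_extendChart [T2Space M] {x : M} {ψ : EuclideanSpace ℝ (Fin n) → ℝ}
    (hψ : ContDiff ℝ ∞ ψ) (hc : HasCompactSupport ψ)
    (hs : tsupport ψ ⊆ (extChartAt (𝓡 n) x).target) : IsSmooth n (extendChart x ψ) := by
  refine contMDiff_of_tsupport fun p hp => ?_
  have hps := tsupport_extendChart_subset_source hc hs hp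
  have h1 : ContMDiffAt (𝓡 n) 𝓘(ℝ, ℝ) ∞ (ψ ∘ extChartAt (𝓡 n) x) p :=
    hψ.contMDiff.contMDiffAt.comp p (contMDiffAt_extChartAt' (by simpa using hps))
  refine h1.congr_of_eventuallyEq ?_
  filter_upwards [(isOpen_extChartAt_source x).mem_nhds hps] with q hq
  exact indicator_of_mem hq _

theorem IsSmooth.contDiffOn_comp_symm {f : M → ℝ} (hf : IsSmooth n f) (x : M) :
    ContDiffOn ℝ ∞ (f ∘ (extChartAt (𝓡 n) x).symm) (extChartAt (𝓡 n) x).target :=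
  (hf.comp_contMDiffOn (contMDiffOn_extChartAt_symm x)).contDiffOn

theorem isInvertible_mfderiv_symm {x : M} {y : EuclideanSpace ℝ (Fin n)}
    (hy : y ∈ (extChartAt (𝓡 n) x).target) :
    (mfderiv 𝓘(ℝ, EuclideanSpace ℝ (Fin n)) (𝓡 n) (extChartAt (𝓡 n) x).symm y).IsInvertible := by
  have h := isInvertible_mfderivWithin_extChartAt_symm (I := 𝓡 n) hy
  simpa [mfderivWithin_univ] using h

theorem chartVector_bijective {x : M} {y : EuclideanSpace ℝ (Fin n)}
    (hy : y ∈ (extChartAt (𝓡 n) x).target) : Function.Bijective (chartVector x y) :=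
  (isInvertible_mfderiv_symm hy).bijective

theorem mdifferentiableAt_symm {x : M} {y : EuclideanSpace ℝ (Fin n)}
    (hy : y ∈ (extChartAt (𝓡 n) x).target) :
    MDifferentiableAt 𝓘(ℝ, EuclideanSpace ℝ (Fin n)) (𝓡 n) (extChartAt (𝓡 n) x).symm y := by
  have h := mdifferentiableWithinAt_extChartAt_symm (I := 𝓡 n) hy
  simpa [mdifferentiableWithinAt_univ] using h

theorem differential_chartVector {f : M → ℝ} (hf : IsSmooth n f) {x : M}
    {y : EuclideanSpace ℝ (Fin n)} (hy : y ∈ (extChartAt (𝓡 n) x).target)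
    (v : EuclideanSpace ℝ (Fin n)) :
    differential n f ((extChartAt (𝓡 n) x).symm y) (chartVector x y v) =
      fderiv ℝ (f ∘ (extChartAt (𝓡 n) x).symm) y v := by
  have h := mfderiv_comp_apply y ((hf.mdifferentiable (by simp)) _) (mdifferentiableAt_symm hy) v
  rw [mfderiv_eq_fderiv] at h
  exact h.symm

theorem differential_chartVector_single {f : M → ℝ} (hf : IsSmooth n f) {x : M}
    {y : EuclideanSpace ℝ (Fin n)} (hy : y ∈ (extChartAt (𝓡 n) x).target) (i : Fin n) :
    differential n f ((extChartAt (𝓡 n) x).symm y) (chartVector x y (EuclideanSpace.single i 1)) =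
      partialDeriv i (f ∘ (extChartAt (𝓡 n) x).symm) y :=
  differential_chartVector hf hy _

end Charts

/-- A smooth function can be cut off to a test function without changing it near a point. -/
theorem exists_testFunction {n : ℕ} {U : Set (EuclideanSpace ℝ (Fin n))} (hU : IsOpen U)
    {y : EuclideanSpace ℝ (Fin n)} (hy : y ∈ U) {F : EuclideanSpace ℝ (Fin n) → ℝ}
    (hF : ContDiff ℝ ∞ F) :
    ∃ ψ : EuclideanSpace ℝ (Fin n) → ℝ, ContDiff ℝ ∞ ψ ∧ HasCompactSupport ψ ∧ tsupport ψ ⊆ U ∧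
      ψ =ᶠ[𝓝 y] F := by
  obtain ⟨r, hr, hrU⟩ := Metric.nhds_basis_closedBall.mem_iff.1 (hU.mem_nhds hy)
  let b : ContDiffBump y := ⟨r / 2, r, by positivity, by linarith⟩
  refine ⟨fun z => b z * F z, b.contDiff.mul hF, b.hasCompactSupport.mul_right, ?_, ?_⟩
  · refine (closure_mono (Function.support_mul_subset_left _ _)).trans ?_
    change tsupport b ⊆ U
    rw [b.tsupport_eq]; exact hrU
  · filter_upwards [b.eventuallyEq_one] with z hz
    simp [hz]

/-! ### Metrics in charts -/

section MetricCharts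

variable {n : ℕ} {M : Type*} [TopologicalSpace M] [ChartedSpace (EuclideanSpace ℝ (Fin n)) M]
  [IsManifold (𝓡 n) ∞ M]

theorem symm_trivializationAt_eq_chartVector {x : M} {y : EuclideanSpace ℝ (Fin n)}
    (hy : y ∈ (extChartAt (𝓡 n) x).target) (v : EuclideanSpace ℝ (Fin n)) :
    (trivializationAt (EuclideanSpace ℝ (Fin n)) (TangentSpace (𝓡 n) : M → Type _) x).symm
      ((extChartAt (𝓡 n) x).symm y) v = chartVector x y v := by
  have hp : (extChartAt (𝓡 n) x).symm y ∈ (chartAt (EuclideanSpace ℝ (Fin n)) x).source := by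
    simpa using (extChartAt (𝓡 n) x).map_target hy
  have h := TangentBundle.symmL_trivializationAt (I := 𝓡 n) hp
  have h2 : (trivializationAt (EuclideanSpace ℝ (Fin n)) (TangentSpace (𝓡 n) : M → Type _) x).symmL
      ℝ ((extChartAt (𝓡 n) x).symm y) v = chartVector x y v := by
    rw [h, (extChartAt (𝓡 n) x).right_inv hy]
    simp only [modelWithCornersSelf_coe, range_id, mfderivWithin_univ]
    rfl
  rw [← h2, Trivialization.symmL_apply _ (by simpa using hp)]

theorem contDiffAt_clm_of_apply {E F G : Type*} [NormedAddCommGroup E] [NormedSpace ℝ E]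
    [NormedAddCommGroup F] [NormedSpace ℝ F] [FiniteDimensional ℝ F]
    [NormedAddCommGroup G] [NormedSpace ℝ G] {A : E → F →L[ℝ] G} {y : E}
    (h : ∀ v, ContDiffAt ℝ ∞ (fun z => A z v) y) : ContDiffAt ℝ ∞ A y := by
  let b := Module.finBasis ℝ F
  have hA : A = fun z => ∑ i, (ContinuousLinearMap.smulRightL ℝ F G
      (LinearMap.toContinuousLinearMap (b.coord i))) (A z (b i)) := by
    funext z
    ext v
    have hv : A z v = ∑ i, b.repr v i • A z (b i) := by
      conv_lhs => rw [← b.sum_repr v, map_sum]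
      simp only [map_smul]
    simpa using hv
  rw [hA]
  exact ContDiffAt.sum fun i _ => (ContinuousLinearMap.contDiff _).contDiffAt.comp y (h (b i))

theorem contDiffAt_bilin_iff {A : EuclideanSpace ℝ (Fin n) → EuclideanSpace ℝ (Fin n) →L[ℝ]
      EuclideanSpace ℝ (Fin n) →L[ℝ] ℝ} {y : EuclideanSpace ℝ (Fin n)} :
    ContDiffAt ℝ ∞ A y ↔ ∀ i j : Fin n, ContDiffAt ℝ ∞ (fun z =>
      A z (EuclideanSpace.single i 1) (EuclideanSpace.single j 1)) y := by
  constructor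
  · intro h i j
    exact (h.clm_apply contDiffAt_const).clm_apply contDiffAt_const
  · intro h
    refine contDiffAt_clm_of_apply fun v => contDiffAt_clm_of_apply fun w => ?_
    have hsum : ∀ v : EuclideanSpace ℝ (Fin n), v = ∑ i, v i • EuclideanSpace.single i (1 : ℝ) :=
      fun v => by ext j; simp [Finset.sum_apply, Pi.single_apply]
    rw [hsum v, hsum w]
    simp only [map_sum, map_smul, sum_apply, smul_apply, smul_eq_mul]
    exact ContDiffAt.sum fun i _ => contDiffAt_const.mul
      (ContDiffAt.sum fun j _ => contDiffAt_const.mul (h j i))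

theorem contMDiffAt_iff_comp_symm {F : Type*} [NormedAddCommGroup F] [NormedSpace ℝ F] {f : M → F}
    {x : M} {y : EuclideanSpace ℝ (Fin n)} (hy : y ∈ (extChartAt (𝓡 n) x).target) :
    ContMDiffAt (𝓡 n) 𝓘(ℝ, F) ∞ f ((extChartAt (𝓡 n) x).symm y) ↔
      ContDiffAt ℝ ∞ (f ∘ (extChartAt (𝓡 n) x).symm) y := by
  have hp : (extChartAt (𝓡 n) x).symm y ∈ (extChartAt (𝓡 n) x).source :=
    (extChartAt (𝓡 n) x).map_target hy
  constructor
  · intro h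
    exact (h.comp y ((contMDiffOn_extChartAt_symm x).contMDiffAt
      ((isOpen_extChartAt_target x).mem_nhds hy))).contDiffAt
  · intro h
    have h1 := ContMDiffAt.comp ((extChartAt (𝓡 n) x).symm y)
      (g := f ∘ (extChartAt (𝓡 n) x).symm)
      (by rw [(extChartAt (𝓡 n) x).right_inv hy]; exact h.contMDiffAt)
      (contMDiffAt_extChartAt' (n := ∞) (by rwa [← extChartAt_source (𝓡 n)]))
    refine h1.congr_of_eventuallyEq ?_
    filter_upwards [(isOpen_extChartAt_source x).mem_nhds hp] with q hq
    simp only [Function.comp_apply, (extChartAt (𝓡 n) x).left_inv hq]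

set_option synthInstance.maxHeartbeats 200000 in
/-- A field of bilinear forms on the tangent spaces is smooth where its components in a chart
are. -/
theorem contMDiffAt_bilin_iff
    (s : ∀ p : M, TangentSpace (𝓡 n) p →L[ℝ] TangentSpace (𝓡 n) p →L[ℝ] ℝ) {x : M}
    {y : EuclideanSpace ℝ (Fin n)} (hy : y ∈ (extChartAt (𝓡 n) x).target) :
    ContMDiffAt (𝓡 n) ((𝓡 n).prod 𝓘(ℝ, EuclideanSpace ℝ (Fin n) →L[ℝ]
        EuclideanSpace ℝ (Fin n) →L[ℝ] ℝ)) ∞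
      (fun b ↦ TotalSpace.mk' (EuclideanSpace ℝ (Fin n) →L[ℝ] EuclideanSpace ℝ (Fin n) →L[ℝ] ℝ)
        (E := fun b => TangentSpace (𝓡 n) b →L[ℝ] TangentSpace (𝓡 n) b →L[ℝ] ℝ) b (s b))
      ((extChartAt (𝓡 n) x).symm y) ↔
    ∀ i j : Fin n, ContDiffAt ℝ ∞ (fun z => s ((extChartAt (𝓡 n) x).symm z)
      (chartVector x z (EuclideanSpace.single i 1))
      (chartVector x z (EuclideanSpace.single j 1))) y := by
  have hp : (extChartAt (𝓡 n) x).symm y ∈ (extChartAt (𝓡 n) x).source :=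
    (extChartAt (𝓡 n) x).map_target hy
  have hp' : (extChartAt (𝓡 n) x).symm y ∈ (chartAt (EuclideanSpace ℝ (Fin n)) x).source := by
    simpa using hp
  let e := trivializationAt (EuclideanSpace ℝ (Fin n) →L[ℝ] EuclideanSpace ℝ (Fin n) →L[ℝ] ℝ)
    (fun b : M => TangentSpace (𝓡 n) b →L[ℝ] TangentSpace (𝓡 n) b →L[ℝ] ℝ) x
  have key : ∀ z ∈ (extChartAt (𝓡 n) x).target, ∀ v w,
      (e ⟨(extChartAt (𝓡 n) x).symm z, s ((extChartAt (𝓡 n) x).symm z)⟩).2 v w =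
      s ((extChartAt (𝓡 n) x).symm z) (chartVector x z v) (chartVector x z w) := by
    intro z hz v w
    have hb : (extChartAt (𝓡 n) x).symm z ∈ (chartAt (EuclideanSpace ℝ (Fin n)) x).source := by
      simpa using (extChartAt (𝓡 n) x).map_target hz
    refine (inCoordinates_apply_eq₂ (E₁ := (TangentSpace (𝓡 n) : M → Type _))
      (E₂ := (TangentSpace (𝓡 n) : M → Type _)) (E₃ := fun _ : M => ℝ) (x₀ := x)
      (by simpa using hb) (by simpa using hb) (by simp)).trans ?_
    rw [symm_trivializationAt_eq_chartVector hz, symm_trivializationAt_eq_chartVector hz]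
    exact congrArg (fun L : ℝ →ₗ[ℝ] ℝ => L (s ((extChartAt (𝓡 n) x).symm z) (chartVector x z v)
      (chartVector x z w))) (Trivial.linearMapAt_trivialization ℝ M ℝ _)
  rw [Trivialization.contMDiffAt_section_iff e (by simpa [e] using hp')]
  rw [contMDiffAt_iff_comp_symm hy, contDiffAt_bilin_iff]
  have hev : ∀ i j : Fin n, (fun z => ((fun b => (e ⟨b, s b⟩).2) ∘ (extChartAt (𝓡 n) x).symm) z
      (EuclideanSpace.single i 1) (EuclideanSpace.single j 1)) =ᶠ[𝓝 y]
      fun z => s ((extChartAt (𝓡 n) x).symm z) (chartVector x z (EuclideanSpace.single i 1))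
        (chartVector x z (EuclideanSpace.single j 1)) := fun i j => by
    filter_upwards [(isOpen_extChartAt_target (I := 𝓡 n) x).mem_nhds hy] with z hz
    exact key z hz _ _
  exact forall_congr' fun i => forall_congr' fun j =>
    ⟨fun h => h.congr_of_eventuallyEq (hev i j).symm, fun h => h.congr_of_eventuallyEq (hev i j)⟩

namespace Metric

variable (g : Metric n M)

theorem matrix_apply (x : M) (y : EuclideanSpace ℝ (Fin n)) (i j : Fin n) :
    matrix g x y i j = g.inner ((extChartAt (𝓡 n) x).symm y)
      (chartVector x y (EuclideanSpace.single i 1)) (chartVector x y (EuclideanSpace.single j 1)) :=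
  rfl

theorem inner_chartVector (x : M) (y v w : EuclideanSpace ℝ (Fin n)) :
    g.inner ((extChartAt (𝓡 n) x).symm y) (chartVector x y v) (chartVector x y w) =
      ∑ i, ∑ j, v i * w j * matrix g x y i j := by
  rw [chartVector_eq_sum x y v, chartVector_eq_sum x y w]
  simp only [map_sum, map_smul, sum_apply, smul_apply, smul_eq_mul, matrix_apply, Finset.mul_sum]
  rw [Finset.sum_comm]
  exact Finset.sum_congr rfl fun i _ => Finset.sum_congr rfl fun j _ => by ring

theorem posDef_matrix {x : M} {y : EuclideanSpace ℝ (Fin n)}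
    (hy : y ∈ (extChartAt (𝓡 n) x).target) : (matrix g x y).PosDef := by
  refine Matrix.PosDef.of_dotProduct_mulVec_pos ?_ fun v hv => ?_
  · ext i j
    simp only [Matrix.conjTranspose_apply, star_trivial, matrix_apply]
    exact g.symm _ _ _
  · have hne : chartVector x y (WithLp.toLp 2 v) ≠ 0 := fun h0 => hv (by
      have := (chartVector_bijective hy).1 (h0.trans (map_zero _).symm)
      simpa using this)
    have h := g.pos _ _ hne
    rw [inner_chartVector] at h
    simp only [dotProduct, Matrix.mulVec, Pi.star_apply, star_trivial, Finset.mul_sum]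
    refine h.trans_eq (Finset.sum_congr rfl fun i _ => Finset.sum_congr rfl fun j _ => ?_)
    simp only
    ring

theorem isMetricField_matrix (x : M) : IsMetricField (extChartAt (𝓡 n) x).target (matrix g x) where
  isOpen := isOpen_extChartAt_target x
  smooth i j _ hy :=
    ((contMDiffAt_bilin_iff g.inner hy).1 g.contMDiff.contMDiffAt i j).contDiffWithinAt
  posDef _ hy := g.posDef_matrix hy

theorem inner_gradient (f : M → ℝ) (p : M) (w : TangentSpace (𝓡 n) p) :
    g.inner p (gradient g f p) w = differential n f p w :=
  (exists_gradient g f p).choose_spec w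

theorem eq_gradient {f : M → ℝ} {p : M} {v : TangentSpace (𝓡 n) p}
    (h : ∀ w, g.inner p v w = differential n f p w) : v = gradient g f p := by
  by_contra hne
  have h1 := g.pos p (v - gradient g f p) (sub_ne_zero.2 hne)
  rw [map_sub (g.inner p), sub_apply, h, inner_gradient, sub_self] at h1
  exact lt_irrefl _ h1

/-- In a chart the gradient has the components `G^{ij} ∂_j F`. -/
theorem gradient_symm {f : M → ℝ} (hf : IsSmooth n f) {x : M} {y : EuclideanSpace ℝ (Fin n)}
    (hy : y ∈ (extChartAt (𝓡 n) x).target) :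
    gradient g f ((extChartAt (𝓡 n) x).symm y) = chartVector x y
      (WithLp.toLp 2 fun i => gradCoord (matrix g x) (f ∘ (extChartAt (𝓡 n) x).symm) i y) := by
  refine (eq_gradient g fun w => ?_).symm
  obtain ⟨w, rfl⟩ := (chartVector_bijective hy).2 w
  rw [inner_chartVector, differential_chartVector hf hy, fderiv_eq_sum_partialDeriv,
    Finset.sum_comm]
  refine Finset.sum_congr rfl fun j _ => ?_
  have h1 : (matrix g x y).mulVec (fun i => gradCoord (matrix g x)
      (f ∘ (extChartAt (𝓡 n) x).symm) i y) =
        fun j => partialDeriv j (f ∘ (extChartAt (𝓡 n) x).symm) y := by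
    change (matrix g x y).mulVec ((matrix g x y)⁻¹.mulVec _) = _
    rw [Matrix.mulVec_mulVec, Matrix.mul_nonsing_inv _ (g.posDef_matrix hy).det_pos.ne'.isUnit,
      Matrix.one_mulVec]
  rw [← congrFun h1 j, Matrix.mulVec, dotProduct, Finset.mul_sum]
  refine Finset.sum_congr rfl fun i _ => ?_
  rw [(g.isMetricField_matrix x).apply_comm hy j i]
  simp only
  ring

theorem cometric_symm {f h : M → ℝ} (hf : IsSmooth n f) (hh : IsSmooth n h) {x : M}
    {y : EuclideanSpace ℝ (Fin n)} (hy : y ∈ (extChartAt (𝓡 n) x).target) :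
    cometric g f h ((extChartAt (𝓡 n) x).symm y) = cometricCoord (matrix g x)
      (f ∘ (extChartAt (𝓡 n) x).symm) (h ∘ (extChartAt (𝓡 n) x).symm) y := by
  rw [cometric, inner_gradient, gradient_symm g hh hy, differential_chartVector hf hy,
    fderiv_eq_sum_partialDeriv, cometricCoord]
  refine Finset.sum_congr rfl fun i _ => ?_
  simp only [gradCoord, Finset.sum_mul]
  exact Finset.sum_congr rfl fun j _ => by ring

omit g in
/-- The preferred chart at `x` identifies `T_x M` with `ℝⁿ`. -/
theorem component_eq (x : M) (u : EuclideanSpace ℝ (Fin n)) (i : Fin n) :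
    component (n := n) (x := x) u i = u i := by
  have h : mvfderiv (𝓡 n) (extChartAt (𝓡 n) x) x u = u :=
    congrArg (fun L : TangentSpace (𝓡 n) x →L[ℝ] EuclideanSpace ℝ (Fin n) => L u)
      (mfderiv_extChartAt_self (I := 𝓡 n) (x := x))
  exact congrArg (fun e : EuclideanSpace ℝ (Fin n) => e i) h

omit g in
theorem component_ext {x : M} {v w : TangentSpace (𝓡 n) x}
    (h : ∀ i, component v i = component w i) : v = w := by
  refine PiLp.ext (x := (v : EuclideanSpace ℝ (Fin n))) fun i => ?_
  exact (component_eq x v i).symm.trans ((h i).trans (component_eq x w i))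

omit g in
theorem mvfderiv_chartVector {x : M} {y : EuclideanSpace ℝ (Fin n)}
    (hy : y ∈ (extChartAt (𝓡 n) x).target) (v : EuclideanSpace ℝ (Fin n)) :
    mvfderiv (𝓡 n) (extChartAt (𝓡 n) x) ((extChartAt (𝓡 n) x).symm y) (chartVector x y v) = v := by
  have h := mfderiv_extChartAt_comp_mfderivWithin_extChartAt_symm (I := 𝓡 n) hy
  simp only [modelWithCornersSelf_coe, range_id, mfderivWithin_univ] at h
  exact congrArg (fun L : EuclideanSpace ℝ (Fin n) →L[ℝ] EuclideanSpace ℝ (Fin n) => L v) h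

theorem inner_eq_sum {x p : M} (hp : p ∈ (extChartAt (𝓡 n) x).source)
    (v w : TangentSpace (𝓡 n) p) :
    g.inner p v w = ∑ i, ∑ j, mvfderiv (𝓡 n) (extChartAt (𝓡 n) x) p v i *
      mvfderiv (𝓡 n) (extChartAt (𝓡 n) x) p w j * matrix g x (extChartAt (𝓡 n) x p) i j := by
  obtain ⟨y, hy, rfl⟩ : ∃ y ∈ (extChartAt (𝓡 n) x).target, (extChartAt (𝓡 n) x).symm y = p :=
    ⟨_, (extChartAt (𝓡 n) x).map_source hp, (extChartAt (𝓡 n) x).left_inv hp⟩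
  obtain ⟨v, rfl⟩ := (chartVector_bijective hy).2 v
  obtain ⟨w, rfl⟩ := (chartVector_bijective hy).2 w
  rw [(extChartAt (𝓡 n) x).right_inv hy, inner_chartVector, mvfderiv_chartVector hy,
    mvfderiv_chartVector hy]

theorem mvfderiv_gradient {f : M → ℝ} (hf : IsSmooth n f) {x p : M}
    (hp : p ∈ (extChartAt (𝓡 n) x).source) (i : Fin n) :
    mvfderiv (𝓡 n) (extChartAt (𝓡 n) x) p (gradient g f p) i =
      gradCoord (matrix g x) (f ∘ (extChartAt (𝓡 n) x).symm) i (extChartAt (𝓡 n) x p) := by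
  obtain ⟨y, hy, rfl⟩ : ∃ y ∈ (extChartAt (𝓡 n) x).target, (extChartAt (𝓡 n) x).symm y = p :=
    ⟨_, (extChartAt (𝓡 n) x).map_source hp, (extChartAt (𝓡 n) x).left_inv hp⟩
  rw [(extChartAt (𝓡 n) x).right_inv hy, gradient_symm g hf hy, mvfderiv_chartVector hy]

theorem component_gradient {f : M → ℝ} (hf : IsSmooth n f) (x : M) (i : Fin n) :
    component (gradient g f x) i =
      gradCoord (matrix g x) (f ∘ (extChartAt (𝓡 n) x).symm) i (extChartAt (𝓡 n) x x) :=
  mvfderiv_gradient g hf (mem_extChartAt_source x) i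

theorem cometric_eq {f h : M → ℝ} (hf : IsSmooth n f) (hh : IsSmooth n h) {x p : M}
    (hp : p ∈ (extChartAt (𝓡 n) x).source) :
    cometric g f h p = cometricCoord (matrix g x) (f ∘ (extChartAt (𝓡 n) x).symm)
      (h ∘ (extChartAt (𝓡 n) x).symm) (extChartAt (𝓡 n) x p) := by
  rw [← cometric_symm g hf hh ((extChartAt (𝓡 n) x).map_source hp),
    (extChartAt (𝓡 n) x).left_inv hp]

omit g in
theorem ext_matrix {g g' : Metric n M} (h : ∀ x, matrix g x (extChartAt (𝓡 n) x x) =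
    matrix g' x (extChartAt (𝓡 n) x x)) : g = g' := by
  have hi : g.inner = g'.inner := by
    funext x
    ext v w
    rw [inner_eq_sum g (mem_extChartAt_source x), inner_eq_sum g' (mem_extChartAt_source x), h]
  cases g; cases g'; congr

omit g in
theorem ext_inv_matrix {g g' : Metric n M} (h : ∀ x, (matrix g x (extChartAt (𝓡 n) x x))⁻¹ =
    (matrix g' x (extChartAt (𝓡 n) x x))⁻¹) : g = g' := by
  refine ext_matrix fun x => ?_
  have hy := mem_extChartAt_target (I := 𝓡 n) x
  rw [← Matrix.nonsing_inv_nonsing_inv _ (g.posDef_matrix hy).det_pos.ne'.isUnit, h,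
    Matrix.nonsing_inv_nonsing_inv _ (g'.posDef_matrix hy).det_pos.ne'.isUnit]

end Metric

end MetricCharts

/-! ### The generator and the carré du champ on the core -/

namespace DiffusionData

section CoreCalculus

variable {n : ℕ} {M : Type*} [TopologicalSpace M] [ChartedSpace (EuclideanSpace ℝ (Fin n)) M]
  [MeasurableSpace M] {D : DiffusionData M}

theorem IsDiffusion.eq_of_ae_eq (hD : D.IsDiffusion n) {f g : M → ℝ} (hf : Continuous f)
    (hg : Continuous g) (h : f =ᵐ[D.μ] g) : f = g :=
  have := hD.fullSupport
  (hf.ae_eq_iff_eq D.μ hg).1 h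

omit [TopologicalSpace M] in
theorem IsGeneratorValue.ae_eq {f u v : M → ℝ} (hu : D.IsGeneratorValue f u)
    (hv : D.IsGeneratorValue f v) : u =ᵐ[D.μ] v := by
  obtain ⟨_, hu', h1⟩ := hu
  obtain ⟨_, hv', h2⟩ := hv
  exact (MemLp.toLp_eq_toLp_iff hu' hv').1 (tendsto_nhds_unique h1 h2)

theorem IsSmoothCore.generator_spec (hD : D.IsDiffusion n) (hC : D.IsSmoothCore n) {f : M → ℝ}
    (hf : f ∈ D.core) : D.generator n f ∈ D.core ∧ D.IsGeneratorValue f (D.generator n f) := by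
  obtain ⟨u, hu, hfu⟩ := hC.generator_mem f hf
  have hex : ∃ u : M → ℝ, IsSmooth n u ∧ D.IsGeneratorValue f u := ⟨u, hC.smooth u hu, hfu⟩
  have hg : D.generator n f = hex.choose := dif_pos hex
  have hspec := hex.choose_spec
  rw [← hg] at hspec
  refine ⟨?_, hspec.2⟩
  rwa [hD.eq_of_ae_eq hspec.1.continuous (hC.smooth u hu).continuous (hspec.2.ae_eq hfu)]

theorem IsSmoothCore.generator_mem_core (hD : D.IsDiffusion n) (hC : D.IsSmoothCore n) {f : M → ℝ}
    (hf : f ∈ D.core) : D.generator n f ∈ D.core := (hC.generator_spec hD hf).1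

theorem IsSmoothCore.memLp (hC : D.IsSmoothCore n) {f : M → ℝ} (hf : f ∈ D.core) :
    MemLp f 2 D.μ :=
  let ⟨_, _, h, _⟩ := hC.generator_mem f hf; h

theorem IsSmoothCore.sub (hC : D.IsSmoothCore n) {f g : M → ℝ} (hf : f ∈ D.core)
    (hg : g ∈ D.core) : f - g ∈ D.core := by
  have := hC.add f hf _ (hC.smul (-1) g hg)
  rwa [neg_one_smul, ← sub_eq_add_neg] at this

theorem HasSmoothCalculus.carreDuChamp_spec (hS : D.HasSmoothCalculus n) {f g : M → ℝ}
    (hf : f ∈ D.core) (hg : g ∈ D.core) : IsSmooth n (D.carreDuChamp n f g) ∧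
      D.IsCarreDuChampLimit f g (D.carreDuChamp n f g) := by
  have hex := hS.exists_limit f hf g hg
  have h : D.carreDuChamp n f g = hex.choose := dif_pos hex
  rw [h]
  exact hex.choose_spec

omit [TopologicalSpace M] in
theorem IsGeneratorValue.exists_subseq {f u : M → ℝ} (h : D.IsGeneratorValue f u)
    (hf : MemLp f 2 D.μ) {t : ℕ → ℝ≥0} (ht : ∀ k, 0 < t k) (ht0 : Tendsto t atTop (𝓝 0)) :
    ∃ ns : ℕ → ℕ, StrictMono ns ∧ ∀ᵐ x ∂D.μ,
      Tendsto (fun k => (D.P (t (ns k)) (hf.toLp f) x - f x) / (t (ns k) : ℝ)) atTop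
        (𝓝 (u x)) := by
  obtain ⟨_, hu, hlim⟩ := h
  have ht' : Tendsto t atTop (𝓝[>] 0) :=
    tendsto_nhdsWithin_iff.2 ⟨ht0, Eventually.of_forall ht⟩
  obtain ⟨ns, hns, hae⟩ := (tendstoInMeasure_of_tendsto_Lp (hlim.comp ht')).exists_seq_tendsto_ae
  refine ⟨ns, hns, ?_⟩
  have hq : ∀ k, ((((t k : ℝ)⁻¹ • (D.P (t k) (hf.toLp f) - hf.toLp f) : Lp ℝ 2 D.μ)) : M → ℝ)
      =ᵐ[D.μ] fun x => (D.P (t k) (hf.toLp f) x - f x) / (t k : ℝ) := by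
    intro k
    filter_upwards [Lp.coeFn_smul ((t k : ℝ)⁻¹) (D.P (t k) (hf.toLp f) - hf.toLp f),
      Lp.coeFn_sub (D.P (t k) (hf.toLp f)) (hf.toLp f), hf.coeFn_toLp] with x h1 h2 h3
    rw [h1, Pi.smul_apply, h2, Pi.sub_apply, h3, smul_eq_mul, div_eq_inv_mul]
  filter_upwards [hae, hu.coeFn_toLp, ae_all_iff.2 hq] with x h1 h2 h3
  rw [h2] at h1
  exact h1.congr fun k => h3 (ns k)

/-- `Γ(f, g) = ½ (L(fg) - f Lg - g Lf)`: along a sequence `t_k ↓ 0` for which the three difference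
quotients converge almost everywhere, `P(fg) - Pf Pg` is
`(P(fg) - fg) - (Pf - f) Pg - f (Pg - g)`. -/
theorem carreDuChamp_eq_generator (hD : D.IsDiffusion n) (hC : D.IsSmoothCore n)
    (hS : D.HasSmoothCalculus n) {f g : M → ℝ} (hf : f ∈ D.core) (hg : g ∈ D.core) (x : M) :
    D.carreDuChamp n f g x = (1 / 2) * (D.generator n (f * g) x - f x * D.generator n g x -
      g x * D.generator n f x) := by
  have hfg := hC.mul f hf g hg
  obtain ⟨hsm, mf, mg, mfg, hlim⟩ := hS.carreDuChamp_spec hf hg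
  have cont : ∀ {h}, h ∈ D.core → Continuous h := fun hh => (hC.smooth _ hh).continuous
  have hcont := ((cont (hC.generator_mem_core hD hfg)).sub
    ((cont hf).mul (cont (hC.generator_mem_core hD hg)))).sub
    ((cont hg).mul (cont (hC.generator_mem_core hD hf)))
  refine congrFun (hD.eq_of_ae_eq (g := fun x => (1 / 2) * (D.generator n (f * g) x -
    f x * D.generator n g x - g x * D.generator n f x)) hsm.continuous
    (continuous_const.mul hcont) ?_) x
  let t : ℕ → ℝ≥0 := fun k => 1 / ((k : ℝ≥0) + 1)
  have ht : ∀ k, 0 < t k := fun k => by positivity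
  have ht0 : Tendsto t atTop (𝓝 0) := tendsto_one_div_add_atTop_nhds_zero_nat
  obtain ⟨n1, hn1, h1⟩ := (hC.generator_spec hD hf).2.exists_subseq mf ht ht0
  obtain ⟨n2, hn2, h2⟩ := (hC.generator_spec hD hg).2.exists_subseq mg (fun k => ht (n1 k))
    (ht0.comp hn1.tendsto_atTop)
  obtain ⟨n3, hn3, h3⟩ := (hC.generator_spec hD hfg).2.exists_subseq mfg
    (fun k => ht (n1 (n2 k))) ((ht0.comp hn1.tendsto_atTop).comp hn2.tendsto_atTop)
  have ht0' : Tendsto (fun k => t (n1 (n2 (n3 k)))) atTop (𝓝 0) :=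
    ((ht0.comp hn1.tendsto_atTop).comp hn2.tendsto_atTop).comp hn3.tendsto_atTop
  filter_upwards [h1, h2, h3, hlim (fun k => t (n1 (n2 (n3 k)))) (fun k => ht _) ht0']
    with x h1 h2 h3 h4
  have h1' := (h1.comp hn2.tendsto_atTop).comp hn3.tendsto_atTop
  have h2' := h2.comp hn3.tendsto_atTop
  have hτ : Tendsto (fun k => (t (n1 (n2 (n3 k))) : ℝ)) atTop (𝓝 0) := by
    simpa using NNReal.tendsto_coe.2 ht0'
  have h5 := ((h3.sub (h2'.const_mul (f x))).sub
    (((hτ.mul h2').add_const (g x)).mul h1')).const_mul (1 / 2)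
  rw [zero_mul, zero_add] at h5
  refine tendsto_nhds_unique h4 (h5.congr ?_)
  intro k
  have hne : (t (n1 (n2 (n3 k))) : ℝ) ≠ 0 := by exact_mod_cast (ht _).ne'
  simp only [Function.comp_apply, Pi.mul_apply]
  field_simp
  ring

theorem carreDuChamp_mem_core (hD : D.IsDiffusion n) (hC : D.IsSmoothCore n)
    (hS : D.HasSmoothCalculus n) {f g : M → ℝ} (hf : f ∈ D.core) (hg : g ∈ D.core) :
    D.carreDuChamp n f g ∈ D.core := by
  have h := hC.smul (1 / 2) _ (hC.sub (hC.sub (hC.generator_mem_core hD (hC.mul f hf g hg))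
    (hC.mul f hf _ (hC.generator_mem_core hD hg)))
    (hC.mul g hg _ (hC.generator_mem_core hD hf)))
  convert h using 1
  funext x
  rw [carreDuChamp_eq_generator hD hC hS hf hg]
  rfl

theorem integrable_mul_core (hC : D.IsSmoothCore n) {f g : M → ℝ}
    (hf : f ∈ D.core) (hg : g ∈ D.core) : Integrable (fun x => f x * g x) D.μ :=
  (hC.memLp hf).integrable_mul (hC.memLp hg)

theorem integral_mul_generator_comm (hD : D.IsDiffusion n) (hC : D.IsSmoothCore n) {f g : M → ℝ}
    (hf : f ∈ D.core) (hg : g ∈ D.core) :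
    ∫ x, g x * D.generator n f x ∂D.μ = ∫ x, f x * D.generator n g x ∂D.μ := by
  obtain ⟨mf, mLf, h1⟩ := (hC.generator_spec hD hf).2
  obtain ⟨mg, mLg, h2⟩ := (hC.generator_spec hD hg).2
  have e : ∀ t : ℝ≥0, inner ℝ (mg.toLp g) ((t : ℝ)⁻¹ • (D.P t (mf.toLp f) - mf.toLp f)) =
      inner ℝ (mf.toLp f) ((t : ℝ)⁻¹ • (D.P t (mg.toLp g) - mg.toLp g)) := by
    intro t
    rw [inner_smul_right, inner_smul_right, inner_sub_right, inner_sub_right,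
      ← hD.symmetric t (mg.toLp g) (mf.toLp f), real_inner_comm (mf.toLp f) (D.P t (mg.toLp g)),
      real_inner_comm (mf.toLp f) (mg.toLp g)]
  have h3 := tendsto_nhds_unique ((Tendsto.inner tendsto_const_nhds h1).congr e)
    (Tendsto.inner tendsto_const_nhds h2)
  rw [L2.inner_def, L2.inner_def] at h3
  convert h3 using 1
  · refine integral_congr_ae ?_
    filter_upwards [mg.coeFn_toLp, mLf.coeFn_toLp] with x h1 h2
    rw [h1, h2]; simp [mul_comm]
  · refine integral_congr_ae ?_
    filter_upwards [mf.coeFn_toLp, mLg.coeFn_toLp] with x h1 h2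
    rw [h1, h2]; simp [mul_comm]

variable [IsManifold (𝓡 n) ∞ M] [T2Space M] [SecondCountableTopology M]

omit [MeasurableSpace M] in
theorem exists_cutoff {K : Set M} (hK : IsCompact K) :
    ∃ (χ : M → ℝ) (U : Set M), IsSmooth n χ ∧ HasCompactSupport χ ∧ IsOpen U ∧ K ⊆ U ∧
      ∀ x ∈ U, χ x = 1 := by
  have : LocallyCompactSpace M := Manifold.locallyCompact_of_finiteDimensional (𝓡 n)
  obtain ⟨K', hK', hsub⟩ := exists_compact_superset hK
  obtain ⟨χ, h1, h0, -⟩ := exists_contMDiffMap_one_nhds_of_subset_interior (𝓡 n)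
    (n := (⊤ : ℕ∞)) hK.isClosed hsub
  obtain ⟨U, hU, hKU, hU1⟩ := eventually_nhdsSet_iff_exists.1 h1
  exact ⟨χ, U, χ.contMDiff, HasCompactSupport.intro hK' fun x hx => h0 x hx, hU, hKU, hU1⟩

/-- `∫ Lu dμ = 0` for a test function `u`. If `χ` is a cutoff with `χ = 1` near the support of `u`,
then `Γ(u, χ) = 0` reads `(1 - χ) Lu = u Lχ`; both sides vanish, so that
`∫ Lu = ⟨Lu, χ⟩ = ⟨u, Lχ⟩ = 0`. -/
theorem integral_generator_eq_zero (hD : D.IsDiffusion n) (hC : D.IsSmoothCore n)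
    (hS : D.HasSmoothCalculus n) {u : M → ℝ} (hu : IsSmooth n u) (huc : HasCompactSupport u) :
    Integrable (D.generator n u) D.μ ∧ ∫ x, D.generator n u x ∂D.μ = 0 := by
  obtain ⟨χ, U, hχ, hχc, hU, hsU, hχU⟩ := exists_cutoff (n := n) huc.isCompact
  have hu' := hC.testFunctions u hu huc
  have hχ' := hC.testFunctions χ hχ hχc
  have hΓ := hS.isLocal u hu' χ hχ' U hU hsU ⟨1, hχU⟩
  have huχ : u * χ = u := by
    funext x
    by_cases hx : x ∈ U
    · simp [hχU x hx]
    · have : u x = 0 := image_eq_zero_of_notMem_tsupport fun h => hx (hsU h)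
      simp [this]
  have h1 : ∀ x, D.generator n u x - u x * D.generator n χ x - χ x * D.generator n u x = 0 := by
    intro x
    have := carreDuChamp_eq_generator hD hC hS hu' hχ' x
    rw [hΓ, huχ, Pi.zero_apply] at this
    linarith
  have h2 : ∀ x, u x * D.generator n χ x = 0 := by
    intro x
    by_cases hx : u x = 0
    · simp [hx]
    · have := h1 x
      rw [hχU x (hsU (subset_tsupport _ hx))] at this
      linarith
  have h3 : D.generator n u = fun x => χ x * D.generator n u x := by
    funext x; linarith [h1 x, h2 x]
  constructor
  · rw [h3]; exact integrable_mul_core hC hχ' (hC.generator_mem_core hD hu')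
  · rw [h3, integral_mul_generator_comm hD hC hu' hχ']
    simp [h2]

theorem integral_mul_generator (hD : D.IsDiffusion n) (hC : D.IsSmoothCore n)
    (hS : D.HasSmoothCalculus n) {f u : M → ℝ} (hf : f ∈ D.core) (hu : IsSmooth n u)
    (huc : HasCompactSupport u) :
    ∫ x, u x * D.generator n f x ∂D.μ = -∫ x, D.carreDuChamp n f u x ∂D.μ := by
  have hu' := hC.testFunctions u hu huc
  have hfu : IsSmooth n (f * u) := hC.smooth _ (hC.mul f hf u hu')
  obtain ⟨hi, h0⟩ := integral_generator_eq_zero hD hC hS hfu (huc.mul_left)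
  have hi1 := integrable_mul_core hC hf (hC.generator_mem_core hD hu')
  have hi2 := integrable_mul_core hC hu' (hC.generator_mem_core hD hf)
  simp only [carreDuChamp_eq_generator hD hC hS hf hu']
  have hi3 : Integrable (fun x => D.generator n (f * u) x - f x * D.generator n u x) D.μ :=
    hi.sub hi1
  rw [integral_const_mul, integral_sub hi3 hi2, integral_sub hi hi1, h0,
    integral_mul_generator_comm hD hC hf hu']
  ring

end CoreCalculus

end DiffusionData

/-! ### Integration in charts -/

section ChartIntegration

variable {n : ℕ}

theorem continuous_mul_of_tsupport_subset {U : Set (EuclideanSpace ℝ (Fin n))} (hU : IsOpen U)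
    {A ψ : EuclideanSpace ℝ (Fin n) → ℝ} (hA : ContinuousOn A U) (hψ : Continuous ψ)
    (hs : tsupport ψ ⊆ U) : Continuous fun y => A y * ψ y := by
  refine continuous_iff_continuousAt.2 fun y => ?_
  by_cases hy : y ∈ U
  · exact (hA.continuousAt (hU.mem_nhds hy)).mul hψ.continuousAt
  · have h0 : ψ =ᶠ[𝓝 y] 0 := notMem_tsupport_iff_eventuallyEq.1 fun h => hy (hs h)
    refine (continuousAt_const (y := (0 : ℝ))).congr ?_
    filter_upwards [h0] with z hz
    simp [hz]

theorem integrable_mul_of_tsupport_subset {U : Set (EuclideanSpace ℝ (Fin n))} (hU : IsOpen U)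
    {A ψ : EuclideanSpace ℝ (Fin n) → ℝ} (hA : ContinuousOn A U) (hψ : Continuous ψ)
    (hc : HasCompactSupport ψ) (hs : tsupport ψ ⊆ U) : Integrable fun y => A y * ψ y :=
  (continuous_mul_of_tsupport_subset hU hA hψ hs).integrable_of_hasCompactSupport hc.mul_left

theorem tsupport_partialDeriv_subset (k : Fin n) (ψ : EuclideanSpace ℝ (Fin n) → ℝ) :
    tsupport (partialDeriv k ψ) ⊆ tsupport ψ := by
  refine closure_minimal (fun y hy => ?_) (isClosed_tsupport _)
  by_contra h
  have h0 : ψ =ᶠ[𝓝 y] fun _ => 0 := notMem_tsupport_iff_eventuallyEq.1 h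
  exact hy (by rw [partialDeriv_congr h0, partialDeriv_const])

theorem continuous_partialDeriv {ψ : EuclideanSpace ℝ (Fin n) → ℝ} (hψ : ContDiff ℝ ∞ ψ)
    (k : Fin n) : Continuous (partialDeriv k ψ) :=
  (hψ.continuous_fderiv (by simp)).clm_apply continuous_const

theorem setIntegral_mul_of_tsupport_subset {U : Set (EuclideanSpace ℝ (Fin n))}
    {A ψ : EuclideanSpace ℝ (Fin n) → ℝ} (hs : tsupport ψ ⊆ U) :
    ∫ y in U, A y * ψ y = ∫ y, A y * ψ y :=
  setIntegral_eq_integral_of_forall_compl_eq_zero fun y hy => by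
    rw [image_eq_zero_of_notMem_tsupport fun h => hy (hs h), mul_zero]

theorem setIntegral_mul_partialDeriv {U : Set (EuclideanSpace ℝ (Fin n))} (hU : IsOpen U)
    {V ψ : EuclideanSpace ℝ (Fin n) → ℝ} (hV : ContDiffOn ℝ ∞ V U) (hψ : ContDiff ℝ ∞ ψ)
    (hc : HasCompactSupport ψ) (hs : tsupport ψ ⊆ U) (k : Fin n) :
    ∫ y in U, V y * partialDeriv k ψ y = -∫ y in U, partialDeriv k V y * ψ y := by
  have hs' := (tsupport_partialDeriv_subset k ψ).trans hs
  rw [setIntegral_mul_of_tsupport_subset hs, setIntegral_mul_of_tsupport_subset hs']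
  refine integral_mul_fderiv_eq_neg_fderiv_mul_of_integrable
    (integrable_mul_of_tsupport_subset hU (contDiffOn_partialDeriv hU hV k).continuousOn
      hψ.continuous hc hs)
    (integrable_mul_of_tsupport_subset hU hV.continuousOn (continuous_partialDeriv hψ k)
      (hc.of_isClosed_subset (isClosed_tsupport _) (tsupport_partialDeriv_subset k ψ)) hs')
    (integrable_mul_of_tsupport_subset hU hV.continuousOn hψ.continuous hc hs)
    (fun y hy => ((hV.contDiffAt (hU.mem_nhds (hs hy))).differentiableAt (by simp)))
    (fun y _ => hψ.differentiable (by simp) y)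

/-- The fundamental lemma of the calculus of variations for continuous functions. -/
theorem eqOn_zero_of_setIntegral_eq_zero {U : Set (EuclideanSpace ℝ (Fin n))} (hU : IsOpen U)
    {A : EuclideanSpace ℝ (Fin n) → ℝ} (hA : ContinuousOn A U)
    (h : ∀ ψ : EuclideanSpace ℝ (Fin n) → ℝ, ContDiff ℝ ∞ ψ → HasCompactSupport ψ →
      tsupport ψ ⊆ U → ∫ y in U, A y * ψ y = 0) : EqOn A 0 U := by
  have hae := hU.ae_eq_zero_of_integral_contDiff_smul_eq_zero (μ := volume) (f := A)
    (hA.locallyIntegrableOn hU.measurableSet) fun ψ h1 h2 h3 => by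
      rw [← h ψ h1 h2 h3, setIntegral_mul_of_tsupport_subset h3]
      simp [mul_comm]
  exact Measure.eqOn_open_of_ae_eq ((ae_restrict_iff' hU.measurableSet).2 hae) hU hA
    continuousOn_const

variable {M : Type*} [TopologicalSpace M] [ChartedSpace (EuclideanSpace ℝ (Fin n)) M]
  [MeasurableSpace M] [BorelSpace M] {μ : Measure M} {w : M → EuclideanSpace ℝ (Fin n) → ℝ}

theorem HasChartDensity.map_restrict (h : HasChartDensity μ w) (x : M) :
    (μ.restrict (extChartAt (𝓡 n) x).source).map (extChartAt (𝓡 n) x) =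
      (volume.restrict (extChartAt (𝓡 n) x).target).withDensity
        fun y => ENNReal.ofReal (w x y) := by
  have hsrc := (isOpen_extChartAt_source (I := 𝓡 n) x).measurableSet
  have htgt := (isOpen_extChartAt_target (I := 𝓡 n) x).measurableSet
  ext A hA
  rw [Measure.map_apply_of_aemeasurable ((continuousOn_extChartAt x).aemeasurable hsrc) hA,
    Measure.restrict_apply' hsrc, withDensity_apply _ hA, Measure.restrict_restrict hA,
    ← h x _ (hA.inter htgt) inter_subset_right]
  congr 1
  ext p
  constructor
  · rintro ⟨h1, h2⟩
    exact ⟨h2, h1, (extChartAt (𝓡 n) x).map_source h2⟩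
  · rintro ⟨h1, h2, -⟩
    exact ⟨h2, h1⟩

theorem HasChartDensity.integral_eq (h : HasChartDensity μ w) {x : M}
    (hw : ContinuousOn (w x) (extChartAt (𝓡 n) x).target)
    (hw0 : ∀ y ∈ (extChartAt (𝓡 n) x).target, 0 < w x y) {f : M → ℝ} (hf : Continuous f)
    (hfs : ∀ p ∉ (extChartAt (𝓡 n) x).source, f p = 0) :
    ∫ p, f p ∂μ = ∫ y in (extChartAt (𝓡 n) x).target,
      w x y * f ((extChartAt (𝓡 n) x).symm y) := by
  have hsrc := (isOpen_extChartAt_source (I := 𝓡 n) x).measurableSet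
  have htgt := (isOpen_extChartAt_target (I := 𝓡 n) x).measurableSet
  have hmeas : AEStronglyMeasurable (f ∘ (extChartAt (𝓡 n) x).symm)
      (volume.restrict (extChartAt (𝓡 n) x).target) :=
    (hf.comp_continuousOn (continuousOn_extChartAt_symm x)).aestronglyMeasurable htgt
  calc ∫ p, f p ∂μ = ∫ p in (extChartAt (𝓡 n) x).source, f p ∂μ :=
        (setIntegral_eq_integral_of_forall_compl_eq_zero hfs).symm
    _ = ∫ p in (extChartAt (𝓡 n) x).source,
          (f ∘ (extChartAt (𝓡 n) x).symm) (extChartAt (𝓡 n) x p) ∂μ := by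
        refine setIntegral_congr_fun hsrc fun p hp => ?_
        simp only [Function.comp_apply, (extChartAt (𝓡 n) x).left_inv hp]
    _ = ∫ y, (f ∘ (extChartAt (𝓡 n) x).symm) y
          ∂((μ.restrict (extChartAt (𝓡 n) x).source).map (extChartAt (𝓡 n) x)) := by
        rw [integral_map ((continuousOn_extChartAt x).aemeasurable hsrc)]
        rw [h.map_restrict]
        exact hmeas.mono_ac (withDensity_absolutelyContinuous _ _)
    _ = _ := by
        rw [h.map_restrict, integral_withDensity_eq_integral_toReal_smul₀
          (hw.aemeasurable htgt).ennreal_ofReal (Eventually.of_forall fun _ => by simp)]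
        refine setIntegral_congr_fun htgt fun y hy => ?_
        simp [ENNReal.toReal_ofReal (hw0 y hy).le]

theorem eqOn_of_setLIntegral_eq {U : Set (EuclideanSpace ℝ (Fin n))} (hU : IsOpen U)
    {v w : EuclideanSpace ℝ (Fin n) → ℝ} (hv : ContinuousOn v U) (hw : ContinuousOn w U)
    (hv0 : ∀ y ∈ U, 0 < v y) (hw0 : ∀ y ∈ U, 0 < w y)
    (h : ∀ A, MeasurableSet A → A ⊆ U →
      ∫⁻ y in A, ENNReal.ofReal (v y) = ∫⁻ y in A, ENNReal.ofReal (w y)) : EqOn v w U := by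
  have hm := hU.measurableSet
  have h1 : (volume.restrict U).withDensity (fun y => ENNReal.ofReal (v y)) =
      (volume.restrict U).withDensity fun y => ENNReal.ofReal (w y) := by
    ext A hA
    rw [withDensity_apply _ hA, withDensity_apply _ hA, Measure.restrict_restrict hA]
    exact h _ (hA.inter hm) inter_subset_right
  rw [withDensity_eq_iff_of_sigmaFinite (hv.aemeasurable hm).ennreal_ofReal
    (hw.aemeasurable hm).ennreal_ofReal] at h1
  refine Measure.eqOn_open_of_ae_eq (μ := volume) ?_ hU hv hw
  filter_upwards [h1, ae_restrict_mem hm] with y hy hyU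
  exact (ENNReal.ofReal_eq_ofReal_iff (hv0 y hyU).le (hw0 y hyU).le).1 hy

omit [BorelSpace M] in
/-- A continuous density is determined by the measure. -/
theorem HasChartDensity.eqOn {w' : M → EuclideanSpace ℝ (Fin n) → ℝ} (h : HasChartDensity μ w)
    (h' : HasChartDensity μ w') {x : M}
    (hw : ContinuousOn (w x) (extChartAt (𝓡 n) x).target)
    (hw' : ContinuousOn (w' x) (extChartAt (𝓡 n) x).target)
    (hw0 : ∀ y ∈ (extChartAt (𝓡 n) x).target, 0 < w x y)
    (hw0' : ∀ y ∈ (extChartAt (𝓡 n) x).target, 0 < w' x y) :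
    EqOn (w x) (w' x) (extChartAt (𝓡 n) x).target :=
  eqOn_of_setLIntegral_eq (isOpen_extChartAt_target x) hw hw' hw0 hw0' fun A hA hAs =>
    (h x A hA hAs).symm.trans (h' x A hA hAs)

end ChartIntegration

/-! ### The generator in charts -/

namespace DiffusionData

variable {n : ℕ} {M : Type*} [TopologicalSpace M] [ChartedSpace (EuclideanSpace ℝ (Fin n)) M]
  [IsManifold (𝓡 n) ∞ M] [MeasurableSpace M] {D : DiffusionData M} {g : Metric n M} {ρ : M → ℝ}

theorem IsRecovered.contDiffOn_density (hR : D.IsRecovered g ρ) (x : M) :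
    ContDiffOn ℝ ∞ (fun y => ρ ((extChartAt (𝓡 n) x).symm y) * Real.sqrt (g.matrix x y).det)
      (extChartAt (𝓡 n) x).target := by
  refine (hR.density_smooth.contDiffOn_comp_symm x).mul fun _ hy => ?_
  have hG := g.isMetricField_matrix x
  exact ((contDiffAt_det (hG.contDiffAt hy)).sqrt (hG.det_pos hy).ne').contDiffWithinAt

theorem IsRecovered.density_pos' (hR : D.IsRecovered g ρ) {x : M}
    {y : EuclideanSpace ℝ (Fin n)} (hy : y ∈ (extChartAt (𝓡 n) x).target) :
    0 < ρ ((extChartAt (𝓡 n) x).symm y) * Real.sqrt (g.matrix x y).det :=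
  mul_pos (hR.density_pos _) (Real.sqrt_pos.2 ((g.isMetricField_matrix x).det_pos hy))

theorem IsRecovered.contDiffOn_log (hR : D.IsRecovered g ρ) (x : M) :
    ContDiffOn ℝ ∞ ((fun p => Real.log (ρ p)) ∘ (extChartAt (𝓡 n) x).symm)
      (extChartAt (𝓡 n) x).target :=
  (hR.density_smooth.contDiffOn_comp_symm x).log fun _ _ => (hR.density_pos _).ne'

variable [BorelSpace M] [T2Space M] [SecondCountableTopology M]

/-- In a chart, `Lf` is the weighted Laplacian. -/
theorem IsRecovered.generator_symm (hR : D.IsRecovered g ρ) (hD : D.IsDiffusion n)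
    (hC : D.IsSmoothCore n) (hS : D.HasSmoothCalculus n) {f : M → ℝ} (hf : f ∈ D.core) {x : M}
    {y : EuclideanSpace ℝ (Fin n)} (hy : y ∈ (extChartAt (𝓡 n) x).target) :
    D.generator n f ((extChartAt (𝓡 n) x).symm y) =
      weightedLaplacian (g.matrix x) ((fun p => Real.log (ρ p)) ∘ (extChartAt (𝓡 n) x).symm)
        (f ∘ (extChartAt (𝓡 n) x).symm) y := by
  set Ω := (extChartAt (𝓡 n) x).target
  set G := g.matrix x
  set F := f ∘ (extChartAt (𝓡 n) x).symm
  set s := (fun p => Real.log (ρ p)) ∘ (extChartAt (𝓡 n) x).symm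
  set W : EuclideanSpace ℝ (Fin n) → ℝ := fun y =>
    ρ ((extChartAt (𝓡 n) x).symm y) * Real.sqrt (G y).det
  have hΩ : IsOpen Ω := isOpen_extChartAt_target x
  have hG : IsMetricField Ω G := g.isMetricField_matrix x
  have hfs := hC.smooth f hf
  have hF : ContDiffOn ℝ ∞ F Ω := hfs.contDiffOn_comp_symm x
  have hW : ContDiffOn ℝ ∞ W Ω := hR.contDiffOn_density x
  have hX : ∀ i, ContDiffOn ℝ ∞ (gradCoord G F i) Ω := fun i z hz =>
    (hG.contDiffAt_gradCoord hz (hF.contDiffAt (hΩ.mem_nhds hz)) i).contDiffWithinAt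
  have hWX : ∀ i, ContDiffOn ℝ ∞ (fun z => W z * gradCoord G F i z) Ω := fun i => hW.mul (hX i)
  have hLf : ContinuousOn (fun z => D.generator n f ((extChartAt (𝓡 n) x).symm z)) Ω :=
    ((hC.smooth _ (hC.generator_mem_core hD hf)).contDiffOn_comp_symm x).continuousOn
  have hdiv : ContinuousOn (fun z => ∑ i, partialDeriv i (fun z => W z * gradCoord G F i z) z) Ω :=
    continuousOn_finsetSum _ fun i _ => (contDiffOn_partialDeriv hΩ (hWX i) i).continuousOn
  -- The weak form of `W Lf = ∂_i (W X^i)`.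
  have hweak : EqOn (fun z => W z * D.generator n f ((extChartAt (𝓡 n) x).symm z) -
      ∑ i, partialDeriv i (fun z => W z * gradCoord G F i z) z) 0 Ω := by
    refine eqOn_zero_of_setIntegral_eq_zero hΩ ((hW.continuousOn.mul hLf).sub hdiv) ?_
    intro ψ hψ hψc hψs
    have hu := isSmooth_extendChart hψ hψc hψs
    have huc := hasCompactSupport_extendChart hψc hψs
    have hus := tsupport_extendChart_subset_source hψc hψs
    have hu' := hC.testFunctions _ hu huc
    have hu0 : ∀ p ∉ (extChartAt (𝓡 n) x).source, extendChart x ψ p = 0 := fun p hp =>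
      image_eq_zero_of_notMem_tsupport fun h => hp (hus h)
    have key := integral_mul_generator hD hC hS hf hu huc
    have hΓ0 : ∀ p ∉ (extChartAt (𝓡 n) x).source, D.carreDuChamp n f (extendChart x ψ) p = 0 := by
      intro p hp
      have h0 : extendChart x ψ =ᶠ[𝓝 p] fun _ => 0 :=
        notMem_tsupport_iff_eventuallyEq.1 fun h => hp (hus h)
      rw [hR.carreDuChamp_eq f hf _ hu', Metric.cometric, g.symm, Metric.inner_gradient]
      have : differential n (extendChart x ψ) p = 0 := by
        have h1 : mfderiv (𝓡 n) 𝓘(ℝ, ℝ) (extendChart x ψ) p = 0 := by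
          rw [h0.mfderiv_eq]; exact mfderiv_const
        unfold differential mvfderiv
        rw [h1]; simp
      rw [this]; rfl
    rw [hR.measure_eq.integral_eq hW.continuousOn (fun _ hy => hR.density_pos' hy)
        (f := fun p => extendChart x ψ p * D.generator n f p)
        (hu.continuous.mul (hC.smooth _ (hC.generator_mem_core hD hf)).continuous)
        (fun p hp => by simp [hu0 p hp]),
      hR.measure_eq.integral_eq hW.continuousOn (fun _ hy => hR.density_pos' hy)
        (hS.carreDuChamp_spec hf hu').1.continuous hΓ0] at key
    have e1 : ∫ z in Ω, W z * (extendChart x ψ ((extChartAt (𝓡 n) x).symm z) *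
        D.generator n f ((extChartAt (𝓡 n) x).symm z)) =
        ∫ z in Ω, W z * D.generator n f ((extChartAt (𝓡 n) x).symm z) * ψ z := by
      refine setIntegral_congr_fun hΩ.measurableSet fun z hz => ?_
      simp only [extendChart_symm ψ hz]
      ring
    have e2 : ∫ z in Ω, W z * D.carreDuChamp n f (extendChart x ψ) ((extChartAt (𝓡 n) x).symm z) =
        ∫ z in Ω, ∑ i, W z * gradCoord G F i z * partialDeriv i ψ z := by
      refine setIntegral_congr_fun hΩ.measurableSet fun z hz => ?_
      rw [hR.carreDuChamp_eq f hf _ hu', Metric.cometric_symm g hfs hu hz,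
        hG.cometricCoord_eq_sum hz, Finset.mul_sum]
      refine Finset.sum_congr rfl fun i _ => ?_
      rw [partialDeriv_congr (extendChart_comp_symm_eventuallyEq ψ hz)]
      ring
    have hint : ∀ i, Integrable (fun z => W z * gradCoord G F i z * partialDeriv i ψ z)
        (volume.restrict Ω) := fun i =>
      (integrable_mul_of_tsupport_subset hΩ (hWX i).continuousOn (continuous_partialDeriv hψ i)
        (hψc.of_isClosed_subset (isClosed_tsupport _) (tsupport_partialDeriv_subset i ψ))
        ((tsupport_partialDeriv_subset i ψ).trans hψs)).integrableOn
    have hint' : ∀ i, Integrable (fun z => partialDeriv i (fun z => W z * gradCoord G F i z) z *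
        ψ z) (volume.restrict Ω) := fun i =>
      (integrable_mul_of_tsupport_subset hΩ (contDiffOn_partialDeriv hΩ (hWX i) i).continuousOn
        hψ.continuous hψc hψs).integrableOn
    have hint'' : Integrable (fun z => W z * D.generator n f ((extChartAt (𝓡 n) x).symm z) * ψ z)
        (volume.restrict Ω) :=
      (integrable_mul_of_tsupport_subset hΩ (hW.continuousOn.mul hLf)
        hψ.continuous hψc hψs).integrableOn
    rw [e1, e2, integral_finsetSum _ fun i _ => hint i] at key
    simp only [setIntegral_mul_partialDeriv hΩ (hWX _) hψ hψc hψs, Finset.sum_neg_distrib,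
      neg_neg] at key
    simp only [sub_mul, Finset.sum_mul]
    rw [integral_sub hint'' (integrable_finsetSum _ fun i _ => hint' i),
      integral_finsetSum _ fun i _ => hint' i, key, sub_self]
  have hWpos : 0 < W y := hR.density_pos' hy
  have hyU := hΩ.mem_nhds hy
  have hWd : DifferentiableAt ℝ W y := (hW.contDiffAt hyU).differentiableAt (by simp)
  have hXd : ∀ i, DifferentiableAt ℝ (gradCoord G F i) y := fun i =>
    ((hX i).contDiffAt hyU).differentiableAt (by simp)
  have hsd : DifferentiableAt ℝ s y :=
    ((hR.contDiffOn_log x).contDiffAt hyU).differentiableAt (by simp)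
  have hld : DifferentiableAt ℝ (fun z => Real.log (Real.sqrt (G z).det)) y :=
    (((contDiffAt_det (hG.contDiffAt hy)).sqrt (hG.det_pos hy).ne').log
      (Real.sqrt_pos.2 (hG.det_pos hy)).ne').differentiableAt (by simp)
  -- `∂_i W = W ∂_i log W` with `log W = log ρ + log √(det G)`.
  have hdW : ∀ i, partialDeriv i W y =
      W y * (partialDeriv i s y + ∑ l, christoffel G l l i y) := by
    intro i
    rw [← hG.partialDeriv_log_sqrt_det hy, ← partialDeriv_add hsd hld]
    have h1 : (fun z => s z + Real.log (Real.sqrt (G z).det)) =ᶠ[𝓝 y] fun z => Real.log (W z) := by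
      filter_upwards [hyU] with z hz
      exact (Real.log_mul (hR.density_pos _).ne' (Real.sqrt_pos.2 (hG.det_pos hz)).ne').symm
    rw [partialDeriv_congr h1, partialDeriv_comp (Real.hasDerivAt_log hWpos.ne') hWd]
    field_simp
  have h0 := hweak hy
  simp only [partialDeriv_mul hWd (hXd _), hdW, Pi.zero_apply] at h0
  rw [sub_eq_zero] at h0
  refine mul_left_cancel₀ hWpos.ne' (h0.trans ?_)
  rw [weightedLaplacian, Finset.mul_sum]
  exact Finset.sum_congr rfl fun i _ => by ring

end DiffusionData

/-! ### Functions with prescribed second-order jet -/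

section Jets

variable {n : ℕ}

theorem partialDeriv_coord (k i : Fin n) (y : EuclideanSpace ℝ (Fin n)) (c : ℝ) :
    partialDeriv k (fun z : EuclideanSpace ℝ (Fin n) => z i - c) y = if i = k then 1 else 0 := by
  have h : HasFDerivAt (fun z : EuclideanSpace ℝ (Fin n) => z i - c)
      (EuclideanSpace.proj i : EuclideanSpace ℝ (Fin n) →L[ℝ] ℝ) y :=
    (EuclideanSpace.proj i : EuclideanSpace ℝ (Fin n) →L[ℝ] ℝ).hasFDerivAt.sub_const c
  rw [partialDeriv, h.fderiv]
  simp

theorem exists_jet (y : EuclideanSpace ℝ (Fin n)) (p : Fin n → ℝ) (c : Fin n → Fin n → ℝ)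
    (hc : ∀ i j, c i j = c j i) :
    ∃ F : EuclideanSpace ℝ (Fin n) → ℝ, ContDiff ℝ ∞ F ∧ (∀ i, partialDeriv i F y = p i) ∧
      ∀ i j, partialDeriv i (partialDeriv j F) y = c i j := by
  have hd : ∀ (i : Fin n) (z : EuclideanSpace ℝ (Fin n)),
      DifferentiableAt ℝ (fun z : EuclideanSpace ℝ (Fin n) => z i - y i) z := fun i z => by fun_prop
  have hlin : ∀ (q : Fin n → ℝ) (k : Fin n) (z : EuclideanSpace ℝ (Fin n)),
      partialDeriv k (fun z => ∑ j, q j * (z j - y j)) z = q k := by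
    intro q k z
    rw [partialDeriv_sum fun j _ => (hd j z).const_mul (q j)]
    simp [partialDeriv_mul (differentiableAt_const _) (hd _ z), partialDeriv_const,
      partialDeriv_coord]
  have hld : ∀ (q : Fin n → ℝ) (z : EuclideanSpace ℝ (Fin n)),
      DifferentiableAt ℝ (fun z : EuclideanSpace ℝ (Fin n) => ∑ j, q j * (z j - y j)) z :=
    fun q z => DifferentiableAt.fun_sum fun j _ => (hd j z).const_mul (q j)
  have h1 : ∀ k z, partialDeriv k (fun z : EuclideanSpace ℝ (Fin n) =>
      ∑ i, p i * (z i - y i) + (1 / 2) * ∑ i, (z i - y i) * ∑ j, c i j * (z j - y j)) z =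
      p k + ∑ j, c k j * (z j - y j) := by
    intro k z
    have hq : ∀ i, DifferentiableAt ℝ (fun z : EuclideanSpace ℝ (Fin n) =>
        (z i - y i) * ∑ j, c i j * (z j - y j)) z := fun i => (hd i z).fun_mul (hld _ z)
    rw [partialDeriv_add (hld p z) ((DifferentiableAt.fun_sum fun i _ => hq i).const_mul _), hlin,
      partialDeriv_mul (differentiableAt_const _) (DifferentiableAt.fun_sum fun i _ => hq i),
      partialDeriv_const, partialDeriv_sum fun i _ => hq i]
    simp only [partialDeriv_mul (hd _ z) (hld _ z), hlin, partialDeriv_coord, ite_mul, one_mul,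
      zero_mul, Finset.sum_add_distrib, Finset.sum_ite_eq', Finset.mem_univ,
      if_true, zero_add]
    have : ∑ i, (z i - y i) * c i k = ∑ j, c k j * (z j - y j) :=
      Finset.sum_congr rfl fun i _ => by rw [hc i k, mul_comm]
    rw [this]
    ring
  refine ⟨_, ?_, fun k => (h1 k y).trans (by simp), fun i j => ?_⟩
  · fun_prop
  · rw [partialDeriv_congr (Eventually.of_forall (h1 j)),
      partialDeriv_add (differentiableAt_const _) (hld _ y), partialDeriv_const, hlin, zero_add, hc]

end Jets

/-! ### Linearity and locality of the coordinate expressions -/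

section Coordinates

variable {n : ℕ} {G : EuclideanSpace ℝ (Fin n) → Matrix (Fin n) (Fin n) ℝ}
  {F H s : EuclideanSpace ℝ (Fin n) → ℝ} {y : EuclideanSpace ℝ (Fin n)}

theorem gradCoord_congr (h : F =ᶠ[𝓝 y] H) (i : Fin n) :
    gradCoord G F i =ᶠ[𝓝 y] gradCoord G H i := by
  have h' := eventually_all.2 fun j => partialDeriv_eventuallyEq h j
  filter_upwards [h'] with z hz
  simp only [gradCoord, hz]

theorem weightedLaplacian_congr (h : F =ᶠ[𝓝 y] H) :
    weightedLaplacian G s F y = weightedLaplacian G s H y :=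
  Finset.sum_congr rfl fun i _ => by
    rw [partialDeriv_congr (gradCoord_congr h i), (gradCoord_congr h i).eq_of_nhds]

theorem cometricCoord_congr (h : F =ᶠ[𝓝 y] H) (K : EuclideanSpace ℝ (Fin n) → ℝ) :
    cometricCoord G K F y = cometricCoord G K H y := by
  simp only [cometricCoord, partialDeriv_congr h]

theorem partialDeriv_add_smul (hF : DifferentiableAt ℝ F y) (hH : DifferentiableAt ℝ H y) (c : ℝ)
    (k : Fin n) : partialDeriv k (fun z => F z + c * H z) y =
      partialDeriv k F y + c * partialDeriv k H y := by
  rw [partialDeriv_add hF (hH.const_mul c), partialDeriv_mul (differentiableAt_const c) hH,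
    partialDeriv_const]
  ring

theorem gradCoord_add_smul (hF : DifferentiableAt ℝ F y) (hH : DifferentiableAt ℝ H y) (c : ℝ)
    (i : Fin n) : gradCoord G (fun z => F z + c * H z) i y =
      gradCoord G F i y + c * gradCoord G H i y := by
  simp only [gradCoord, partialDeriv_add_smul hF hH, mul_add, Finset.sum_add_distrib,
    Finset.mul_sum]
  congr 1
  exact Finset.sum_congr rfl fun j _ => by ring

theorem hessianCoord_add_smul (hF : ContDiffAt ℝ ∞ F y) (hH : ContDiffAt ℝ ∞ H y) (c : ℝ)
    (i j : Fin n) : hessianCoord G (fun z => F z + c * H z) i j y =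
      hessianCoord G F i j y + c * hessianCoord G H i j y := by
  have hd : ∀ {K : EuclideanSpace ℝ (Fin n) → ℝ}, ContDiffAt ℝ ∞ K y → DifferentiableAt ℝ K y :=
    fun h => h.differentiableAt (by simp)
  have hev : partialDeriv j (fun z => F z + c * H z) =ᶠ[𝓝 y]
      fun z => partialDeriv j F z + c * partialDeriv j H z := by
    have h1 : ∀ {K : EuclideanSpace ℝ (Fin n) → ℝ}, ContDiffAt ℝ ∞ K y →
        ∀ᶠ z in 𝓝 y, DifferentiableAt ℝ K z := fun h =>
      ((h.of_le (m := 1) (by simp)).eventually (by simp)).mono fun z hz =>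
        hz.differentiableAt (by simp)
    filter_upwards [h1 hF, h1 hH] with z hz1 hz2 using partialDeriv_add_smul hz1 hz2 c j
  simp only [hessianCoord, partialDeriv_congr hev, partialDeriv_add_smul (hd hF) (hd hH),
    partialDeriv_add_smul (hd (contDiffAt_partialDeriv hF j)) (hd (contDiffAt_partialDeriv hH j)),
    mul_add, Finset.sum_add_distrib, mul_sub, Finset.mul_sum]
  have : ∑ k, christoffel G k i j y * (c * partialDeriv k H y) =
      ∑ k, c * (christoffel G k i j y * partialDeriv k H y) :=
    Finset.sum_congr rfl fun k _ => by ring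
  rw [this]; ring

end Coordinates

/-! ### Test functions on the manifold -/

/-- There are test functions with prescribed second-order jet in a chart. -/
theorem exists_testFunction_jet {n : ℕ} {M : Type*} [TopologicalSpace M]
    [ChartedSpace (EuclideanSpace ℝ (Fin n)) M] [IsManifold (𝓡 n) ∞ M] [T2Space M] {x : M}
    {y : EuclideanSpace ℝ (Fin n)} (hy : y ∈ (extChartAt (𝓡 n) x).target) (p : Fin n → ℝ)
    (c : Fin n → Fin n → ℝ)
    (hc : ∀ i j, c i j = c j i) :
    ∃ f : M → ℝ, IsSmooth n f ∧ HasCompactSupport f ∧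
      (∀ i, partialDeriv i (f ∘ (extChartAt (𝓡 n) x).symm) y = p i) ∧
      ∀ i j, partialDeriv i (partialDeriv j (f ∘ (extChartAt (𝓡 n) x).symm)) y = c i j := by
  obtain ⟨F, hF, h1, h2⟩ := exists_jet y p c hc
  obtain ⟨ψ, hψ, hψc, hψs, hψF⟩ := exists_testFunction (isOpen_extChartAt_target x) hy hF
  have hev := (extendChart_comp_symm_eventuallyEq ψ hy).trans hψF
  refine ⟨extendChart x ψ, isSmooth_extendChart hψ hψc hψs, hasCompactSupport_extendChart hψc hψs,
    fun i => ?_, fun i j => ?_⟩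
  · rw [partialDeriv_congr hev, h1]
  · rw [partialDeriv_congr (partialDeriv_eventuallyEq hev j), h2]

namespace Metric

variable {n : ℕ} {M : Type*} [TopologicalSpace M] [ChartedSpace (EuclideanSpace ℝ (Fin n)) M]
  [IsManifold (𝓡 n) ∞ M] (g : Metric n M) {f h ρ : M → ℝ} {x : M}

theorem bakryEmeryRicci_eq (v w : TangentSpace (𝓡 n) x) : bakryEmeryRicci g ρ x v w =
    ∑ i, ∑ j, (ricciCoord (matrix g x) i j (extChartAt (𝓡 n) x x) -
      hessianComponent g (fun p => Real.log (ρ p)) x i j) * (component v i * component w j) := by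
  rw [bakryEmeryRicci, ricci, hessian, ← Finset.sum_sub_distrib]
  refine Finset.sum_congr rfl fun i _ => ?_
  rw [← Finset.sum_sub_distrib]
  exact Finset.sum_congr rfl fun j _ => by ring

theorem hessianComponent_eq_zero (h0 : g.hessian f x = 0) (i j : Fin n) :
    hessianComponent g f x i j = 0 := by
  have h1 : g.hessian f x (EuclideanSpace.single i (1 : ℝ) : EuclideanSpace ℝ (Fin n))
      (EuclideanSpace.single j (1 : ℝ) : EuclideanSpace ℝ (Fin n)) = 0 := by rw [h0]; rfl
  simpa [hessian, component_eq, Pi.single_apply] using h1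

theorem hessian_eq_zero (h0 : ∀ i j, hessianComponent g f x i j = 0) : g.hessian f x = 0 := by
  funext v w
  simp [hessian, h0]

theorem hessianInner_eq_zero (h0 : g.hessian f x = 0) : g.hessianInner f h x = 0 := by
  simp [hessianInner, hessianComponent_eq_zero g h0]

theorem exists_testFunction_gradient [T2Space M] (x : M) (v : TangentSpace (𝓡 n) x) :
    ∃ f : M → ℝ, IsSmooth n f ∧ HasCompactSupport f ∧ g.gradient f x = v ∧
      g.hessian f x = 0 := by
  have hG := g.isMetricField_matrix x
  have hy := mem_extChartAt_target (I := 𝓡 n) x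
  let p := (matrix g x (extChartAt (𝓡 n) x x)).mulVec (component v)
  obtain ⟨f, hf, hfc, h1, h2⟩ := exists_testFunction_jet hy p
    (fun i j => ∑ k, christoffel (matrix g x) k i j (extChartAt (𝓡 n) x x) * p k)
    (fun i j => by simp only [hG.christoffel_comm hy _ i j])
  refine ⟨f, hf, hfc, component_ext fun i => ?_, hessian_eq_zero g fun i j => ?_⟩
  · rw [component_gradient g hf]
    simp only [gradCoord, h1]
    have : (matrix g x (extChartAt (𝓡 n) x x))⁻¹.mulVec p = component v := by
      rw [Matrix.mulVec_mulVec, Matrix.nonsing_inv_mul _ (hG.det_pos hy).ne'.isUnit,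
        Matrix.one_mulVec]
    exact congrFun this i
  · rw [hessianComponent, hessianCoord, h2]
    simp only [h1, sub_self]

theorem bakryEmeryRicci_of_const (h : ∃ c : ℝ, ∀ x, ρ x = c) :
    g.bakryEmeryRicci ρ = g.ricci := by
  obtain ⟨c, hc⟩ := h
  have h0 : ∀ (j : Fin n) (b : ℝ),
      partialDeriv j (fun _ : EuclideanSpace ℝ (Fin n) => b) = fun _ => 0 :=
    fun j b => funext fun y => partialDeriv_const b j
  have : ∀ x i j, hessianComponent g (fun p => Real.log (ρ p)) x i j = 0 := fun x i j => by
    simp only [hessianComponent, hessianCoord, hc, Function.comp_def, h0, mul_zero,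
      Finset.sum_const_zero, sub_zero]
  funext x v w
  simp [bakryEmeryRicci, hessian, this]

end Metric

/-! ### The Bochner identity on the core -/

namespace DiffusionData

variable {n : ℕ} {M : Type*} [TopologicalSpace M] [ChartedSpace (EuclideanSpace ℝ (Fin n)) M]
  [IsManifold (𝓡 n) ∞ M] [MeasurableSpace M] {D : DiffusionData M} {g : Metric n M} {ρ : M → ℝ}
  [BorelSpace M] [T2Space M] [SecondCountableTopology M]

theorem IsRecovered.gammaTwo_eq (hR : D.IsRecovered g ρ) (hD : D.IsDiffusion n)
    (hC : D.IsSmoothCore n) (hS : D.HasSmoothCalculus n) {f : M → ℝ} (hf : f ∈ D.core) (x : M) :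
    D.gammaTwo n f x =
      g.hessianInner f f x + g.bakryEmeryRicci ρ x (g.gradient f x) (g.gradient f x) := by
  have hx := mem_extChartAt_source (I := 𝓡 n) x
  have hy := mem_extChartAt_target (I := 𝓡 n) x
  have hxy : (extChartAt (𝓡 n) x).symm (extChartAt (𝓡 n) x x) = x := extChartAt_to_inv x
  have hΩ := (isOpen_extChartAt_target (I := 𝓡 n) x).mem_nhds hy
  have hfs := hC.smooth f hf
  have hLf := hC.generator_mem_core hD hf
  have hΓ := carreDuChamp_mem_core hD hC hS hf hf
  have key := (g.isMetricField_matrix x).bochner hy (hfs.contDiffOn_comp_symm x)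
    (hR.contDiffOn_log x)
  have e1 : D.generator n (D.carreDuChamp n f f) x = weightedLaplacian (g.matrix x)
      ((fun p => Real.log (ρ p)) ∘ (extChartAt (𝓡 n) x).symm)
      (cometricCoord (g.matrix x) (f ∘ (extChartAt (𝓡 n) x).symm)
        (f ∘ (extChartAt (𝓡 n) x).symm)) (extChartAt (𝓡 n) x x) := by
    have h1 := hR.generator_symm hD hC hS hΓ hy
    rw [hxy] at h1
    rw [h1]
    refine weightedLaplacian_congr ?_
    filter_upwards [hΩ] with z hz
    rw [Function.comp_apply, hR.carreDuChamp_eq f hf f hf, g.cometric_symm hfs hfs hz]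
  have e2 : D.carreDuChamp n f (D.generator n f) x = cometricCoord (g.matrix x)
      (f ∘ (extChartAt (𝓡 n) x).symm) (weightedLaplacian (g.matrix x)
        ((fun p => Real.log (ρ p)) ∘ (extChartAt (𝓡 n) x).symm)
        (f ∘ (extChartAt (𝓡 n) x).symm)) (extChartAt (𝓡 n) x x) := by
    rw [hR.carreDuChamp_eq f hf _ hLf, g.cometric_eq hfs (hC.smooth _ hLf) hx]
    refine cometricCoord_congr ?_ _
    filter_upwards [hΩ] with z hz using hR.generator_symm hD hC hS hf hz
  rw [gammaTwo, e1, e2, key, g.bakryEmeryRicci_eq]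
  simp only [g.component_gradient hfs]
  rfl

/-- The weighted Bochner identity, polarized. -/
theorem IsRecovered.gammaTwoPolar_eq (hR : D.IsRecovered g ρ) (hD : D.IsDiffusion n)
    (hC : D.IsSmoothCore n) (hS : D.HasSmoothCalculus n) {f h : M → ℝ} (hf : f ∈ D.core)
    (hh : h ∈ D.core) (x : M) :
    D.gammaTwoPolar n f h x =
      g.hessianInner f h x + g.bakryEmeryRicci ρ x (g.gradient f x) (g.gradient h x) := by
  have hy := mem_extChartAt_target (I := 𝓡 n) x
  have hΩ := (isOpen_extChartAt_target (I := 𝓡 n) x).mem_nhds hy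
  have hG := g.isMetricField_matrix x
  have hfs := hC.smooth f hf
  have hhs := hC.smooth h hh
  have hFc := (hfs.contDiffOn_comp_symm x).contDiffAt hΩ
  have hHc := (hhs.contDiffOn_comp_symm x).contDiffAt hΩ
  have hFd := hFc.differentiableAt (by simp)
  have hHd := hHc.differentiableAt (by simp)
  have hp : ∀ c : ℝ, f + c • h ∈ D.core := fun c => hC.add f hf _ (hC.smul c h hh)
  have hcomp : ∀ c : ℝ, (f + c • h) ∘ (extChartAt (𝓡 n) x).symm = fun z =>
      (f ∘ (extChartAt (𝓡 n) x).symm) z + c * (h ∘ (extChartAt (𝓡 n) x).symm) z := fun c => rfl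
  have hgr : ∀ (c : ℝ) i, Metric.component (g.gradient (f + c • h) x) i =
      Metric.component (g.gradient f x) i + c * Metric.component (g.gradient h x) i := by
    intro c i
    rw [g.component_gradient (hC.smooth _ (hp c)), g.component_gradient hfs,
      g.component_gradient hhs, hcomp, gradCoord_add_smul hFd hHd]
  have hhe : ∀ (c : ℝ) i j, g.hessianComponent (f + c • h) x i j =
      g.hessianComponent f x i j + c * g.hessianComponent h x i j := by
    intro c i j
    rw [Metric.hessianComponent, hcomp, hessianCoord_add_smul hFc hHc]
    rfl
  have e1 : f + h = f + (1 : ℝ) • h := by rw [one_smul]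
  have e2 : f - h = f + (-1 : ℝ) • h := by rw [neg_one_smul, sub_eq_add_neg]
  -- Both quadratic forms are symmetric, so that polarization returns them.
  have hRsymm : ∀ i j, ricciCoord (g.matrix x) i j (extChartAt (𝓡 n) x x) -
      g.hessianComponent (fun p => Real.log (ρ p)) x i j =
      ricciCoord (g.matrix x) j i (extChartAt (𝓡 n) x x) -
      g.hessianComponent (fun p => Real.log (ρ p)) x j i := fun i j => by
    rw [hG.ricciCoord_comm hy i j]
    congr 1
    exact hG.hessianCoord_comm hy ((hR.contDiffOn_log x).contDiffAt hΩ) i j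
  set R : Fin n → Fin n → ℝ := fun i j => ricciCoord (g.matrix x) i j (extChartAt (𝓡 n) x x) -
      g.hessianComponent (fun p => Real.log (ρ p)) x i j with hRdef
  set v := Metric.component (g.gradient f x)
  set w := Metric.component (g.gradient h x)
  set A := g.hessianComponent f x
  set B := g.hessianComponent h x
  set a := (g.matrix x (extChartAt (𝓡 n) x x))⁻¹ with ha
  have hasymm : ∀ i j, a i j = a j i := fun i j => hG.inv_comm hy i j
  have hRic : ∑ i, ∑ j, R i j * (w i * v j) = ∑ i, ∑ j, R i j * (v i * w j) := by
    rw [Finset.sum_comm]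
    refine Finset.sum_congr rfl fun i _ => Finset.sum_congr rfl fun j _ => ?_
    rw [show R j i = R i j from hRsymm j i]; ring
  have hHes : ∑ i, ∑ j, ∑ p, ∑ q, a i p * a j q * B i j * A p q =
      ∑ i, ∑ j, ∑ p, ∑ q, a i p * a j q * A i j * B p q := by
    have : ∀ P : Fin n → Fin n → Fin n → Fin n → ℝ, ∑ i, ∑ j, ∑ p, ∑ q, P i j p q =
        ∑ p, ∑ q, ∑ i, ∑ j, P i j p q := fun P => by
      have h1 := Finset.sum_comm (s := (Finset.univ : Finset (Fin n × Fin n)))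
        (t := (Finset.univ : Finset (Fin n × Fin n))) (f := fun s t => P s.1 s.2 t.1 t.2)
      simpa only [Fintype.sum_prod_type] using h1
    rw [this]
    refine Finset.sum_congr rfl fun i _ => Finset.sum_congr rfl fun j _ =>
      Finset.sum_congr rfl fun p _ => Finset.sum_congr rfl fun q _ => ?_
    rw [hasymm p i, hasymm q j]; ring
  rw [gammaTwoPolar, e1, e2, hR.gammaTwo_eq hD hC hS (hp 1), hR.gammaTwo_eq hD hC hS (hp (-1)),
    g.bakryEmeryRicci_eq, g.bakryEmeryRicci_eq, g.bakryEmeryRicci_eq]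
  simp only [Metric.hessianInner, hgr, hhe]
  have expR : ∀ c : ℝ, ∑ i, ∑ j, R i j * ((v i + c * w i) * (v j + c * w j)) =
      ∑ i, ∑ j, R i j * (v i * v j) + c * (∑ i, ∑ j, R i j * (v i * w j) +
        ∑ i, ∑ j, R i j * (w i * v j)) + c ^ 2 * ∑ i, ∑ j, R i j * (w i * w j) := by
    intro c
    simp only [Finset.mul_sum, ← Finset.sum_add_distrib]
    exact Finset.sum_congr rfl fun i _ => Finset.sum_congr rfl fun j _ => by ring
  have expH : ∀ c : ℝ, ∑ i, ∑ j, ∑ p, ∑ q, a i p * a j q * (A i j + c * B i j) *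
      (A p q + c * B p q) = ∑ i, ∑ j, ∑ p, ∑ q, a i p * a j q * A i j * A p q +
      c * (∑ i, ∑ j, ∑ p, ∑ q, a i p * a j q * A i j * B p q +
        ∑ i, ∑ j, ∑ p, ∑ q, a i p * a j q * B i j * A p q) +
      c ^ 2 * ∑ i, ∑ j, ∑ p, ∑ q, a i p * a j q * B i j * B p q := by
    intro c
    simp only [Finset.mul_sum, ← Finset.sum_add_distrib]
    exact Finset.sum_congr rfl fun i _ => Finset.sum_congr rfl fun j _ =>
      Finset.sum_congr rfl fun p _ => Finset.sum_congr rfl fun q _ => by ring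
  rw [expR, expR, expH, expH, hRic, hHes]
  ring

theorem IsRecovered.bakryEmeryRicci_eq_gammaTwoPolar (hR : D.IsRecovered g ρ)
    (hD : D.IsDiffusion n) (hC : D.IsSmoothCore n) (hS : D.HasSmoothCalculus n) {f h : M → ℝ}
    (hf : f ∈ D.core) (hh : h ∈ D.core) {x : M} (h0 : g.hessian f x = 0) :
    g.bakryEmeryRicci ρ x (g.gradient f x) (g.gradient h x) = D.gammaTwoPolar n f h x := by
  rw [hR.gammaTwoPolar_eq hD hC hS hf hh, g.hessianInner_eq_zero h0, zero_add]

/-- A test function whose differential vanishes at `x` and whose second derivatives there are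
`q_i q_j` has `Γ₂(f)(x) = (G^{ij} q_i q_j)²`. -/
theorem exists_gammaTwo_eq_sq (x : M) (q : Fin n → ℝ) :
    ∃ f : M → ℝ, IsSmooth n f ∧ HasCompactSupport f ∧
      ∀ (D : DiffusionData M) (g : Metric n M) (ρ : M → ℝ), D.IsRecovered g ρ →
        D.IsDiffusion n → D.IsSmoothCore n → D.HasSmoothCalculus n →
        D.gammaTwo n f x =
          (∑ i, ∑ j, q i * (g.matrix x (extChartAt (𝓡 n) x x))⁻¹ i j * q j) ^ 2 := by
  obtain ⟨f, hf, hfc, h1, h2⟩ := exists_testFunction_jet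
    (mem_extChartAt_target (I := 𝓡 n) x) 0 (fun i j => q i * q j) fun i j => mul_comm _ _
  refine ⟨f, hf, hfc, fun D g ρ hR hD hC hS => ?_⟩
  rw [hR.gammaTwo_eq hD hC hS (hC.testFunctions f hf hfc), g.bakryEmeryRicci_eq]
  have hgr : ∀ i, Metric.component (g.gradient f x) i = 0 := fun i => by
    rw [g.component_gradient hf]
    simp only [gradCoord, h1, Pi.zero_apply, mul_zero, Finset.sum_const_zero]
  have hhe : ∀ i j, g.hessianComponent f x i j = q i * q j := fun i j => by
    simp only [Metric.hessianComponent, hessianCoord, h1, h2, Pi.zero_apply, mul_zero,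
      Finset.sum_const_zero, sub_zero]
  simp only [hgr, mul_zero, Finset.sum_const_zero, add_zero, Metric.hessianInner, hhe]
  rw [sq, Finset.sum_mul_sum]
  refine Finset.sum_congr rfl fun i _ => Finset.sum_congr rfl fun j _ => ?_
  rw [Finset.sum_mul_sum]
  exact Finset.sum_congr rfl fun p _ => Finset.sum_congr rfl fun r _ => by ring

end DiffusionData

/-- A symmetric matrix is determined by its quadratic form. -/
theorem matrix_eq_of_quadratic {n : ℕ} {a b : Matrix (Fin n) (Fin n) ℝ}
    (ha : ∀ i j, a i j = a j i) (hb : ∀ i j, b i j = b j i)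
    (h : ∀ q : Fin n → ℝ, ∑ i, ∑ j, q i * a i j * q j = ∑ i, ∑ j, q i * b i j * q j) : a = b := by
  have hd : ∀ i, a i i = b i i := fun i => by
    simpa [Pi.single_apply] using h (Pi.single i 1)
  ext i j
  have := h (Pi.single i 1 + Pi.single j 1)
  simp [Pi.single_apply, add_mul, mul_add, Finset.sum_add_distrib, ite_mul, mul_ite, hd i, hd j,
    ha j i, hb j i] at this
  linarith

/-- `Γ₂` determines the metric. -/
theorem DiffusionData.IsRecovered.metric_eq_of_gammaTwo_eq {n : ℕ} {M : Type*} [TopologicalSpace M]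
    [ChartedSpace (EuclideanSpace ℝ (Fin n)) M] [IsManifold (𝓡 n) ∞ M] [MeasurableSpace M]
    [BorelSpace M] [T2Space M] [SecondCountableTopology M] {D D' : DiffusionData M}
    {g g' : Metric n M} {ρ ρ' : M → ℝ} (hR : D.IsRecovered g ρ) (hD : D.IsDiffusion n)
    (hC : D.IsSmoothCore n) (hS : D.HasSmoothCalculus n) (hR' : D'.IsRecovered g' ρ')
    (hD' : D'.IsDiffusion n) (hC' : D'.IsSmoothCore n) (hS' : D'.HasSmoothCalculus n)
    (h : ∀ f : M → ℝ, IsSmooth n f → HasCompactSupport f → D.gammaTwo n f = D'.gammaTwo n f) :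
    g = g' := by
  refine Metric.ext_inv_matrix fun x => ?_
  have hy := mem_extChartAt_target (I := 𝓡 n) x
  have hG := g.isMetricField_matrix x
  have hG' := g'.isMetricField_matrix x
  refine matrix_eq_of_quadratic (hG.inv_comm hy) (hG'.inv_comm hy) fun q => ?_
  obtain ⟨f, hf, hfc, hΓ⟩ := DiffusionData.exists_gammaTwo_eq_sq x q
  have hsq := (hΓ D g ρ hR hD hC hS).symm.trans
    ((congrFun (h f hf hfc) x).trans (hΓ D' g' ρ' hR' hD' hC' hS'))
  have hnn : ∀ {A : Matrix (Fin n) (Fin n) ℝ}, A.PosDef →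
      0 ≤ ∑ i, ∑ j, q i * A⁻¹ i j * q j := fun hA => by
    have := hA.inv.posSemidef.dotProduct_mulVec_nonneg q
    simp only [dotProduct, Matrix.mulVec, Pi.star_apply, star_trivial, Finset.mul_sum] at this
    simpa only [mul_assoc] using this
  exact (sq_eq_sq₀ (hnn (hG.posDef _ hy)) (hnn (hG'.posDef _ hy))).1 hsq

/-! ### The metric recovered from the carré du champ -/

section MetricExistence

/-- The unit ball of a positive definite form on a finite-dimensional space is bounded. -/
theorem isVonNBounded_of_pos {E : Type*} [NormedAddCommGroup E] [NormedSpace ℝ E]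
    [FiniteDimensional ℝ E] (b : E →L[ℝ] E →L[ℝ] ℝ) (hb : ∀ v, v ≠ 0 → 0 < b v v) :
    Bornology.IsVonNBounded ℝ {v : E | b v v < 1} := by
  have hcont : Continuous fun v => b v v := by fun_prop
  obtain ⟨c, hc, hcb⟩ := (isCompact_sphere (0 : E) 1).exists_forall_le' (f := fun v => b v v)
    hcont.continuousOn (a := 0) fun v hv => hb v (by rintro rfl; simp at hv)
  rw [NormedSpace.isVonNBounded_iff]
  refine (Metric.isBounded_closedBall (x := (0 : E)) (r := 1 + 1 / c)).subset fun v hv => ?_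
  rw [mem_closedBall_zero_iff]
  by_cases h0 : v = 0
  · rw [h0, norm_zero]; positivity
  have hn : 0 < ‖v‖ := norm_pos_iff.2 h0
  have h1 := hcb (‖v‖⁻¹ • v) (by simp [norm_smul, hn.ne'])
  have h2 : c * ‖v‖ ^ 2 < 1 := by
    refine lt_of_le_of_lt ?_ hv
    simp only [map_smul, smul_apply, smul_eq_mul] at h1
    calc c * ‖v‖ ^ 2 ≤ (‖v‖⁻¹ * (‖v‖⁻¹ * b v v)) * ‖v‖ ^ 2 := by gcongr
      _ = b v v := by field_simp
  have h3 : ‖v‖ ^ 2 < 1 / c := by rw [lt_div_iff₀ hc]; linarith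
  nlinarith [sq_nonneg (‖v‖ - 1), h3]

variable {n : ℕ} {M : Type*} [TopologicalSpace M] [ChartedSpace (EuclideanSpace ℝ (Fin n)) M]
  [IsManifold (𝓡 n) ∞ M]

theorem differential_eq_of_partialDeriv_eq {f h : M → ℝ} (hf : IsSmooth n f) (hh : IsSmooth n h)
    {x : M} {y : EuclideanSpace ℝ (Fin n)} (hy : y ∈ (extChartAt (𝓡 n) x).target)
    (hp : ∀ i, partialDeriv i (f ∘ (extChartAt (𝓡 n) x).symm) y =
      partialDeriv i (h ∘ (extChartAt (𝓡 n) x).symm) y) :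
    differential n f ((extChartAt (𝓡 n) x).symm y) =
      differential n h ((extChartAt (𝓡 n) x).symm y) := by
  ext w
  obtain ⟨v, rfl⟩ := (chartVector_bijective hy).2 w
  rw [differential_chartVector hf hy, differential_chartVector hh hy, fderiv_eq_sum_partialDeriv,
    fderiv_eq_sum_partialDeriv]
  simp only [hp]

namespace DiffusionData

variable [MeasurableSpace M] {D : DiffusionData M}

theorem sum_smul_mem_core {M : Type*} [TopologicalSpace M]
    [ChartedSpace (EuclideanSpace ℝ (Fin n)) M] [MeasurableSpace M] {D : DiffusionData M}
    (hC : D.IsSmoothCore n) {ι : Type*} (s : Finset ι) (c : ι → ℝ)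
    (U : ι → M → ℝ) (hU : ∀ i, U i ∈ D.core) (h0 : (0 : M → ℝ) ∈ D.core) :
    ∑ i ∈ s, c i • U i ∈ D.core := by
  classical
  induction s using Finset.induction_on with
  | empty => simpa using h0
  | insert a s ha ih =>
    rw [Finset.sum_insert ha]
    exact hC.add _ (hC.smul _ _ (hU a)) _ ih

theorem carreDuChamp_sum_left {M : Type*} [TopologicalSpace M]
    [ChartedSpace (EuclideanSpace ℝ (Fin n)) M] [MeasurableSpace M] {D : DiffusionData M}
    (hC : D.IsSmoothCore n) (hS : D.HasSmoothCalculus n) {ι : Type*}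
    (s : Finset ι) (c : ι → ℝ) (U : ι → M → ℝ) (hU : ∀ i, U i ∈ D.core) {h : M → ℝ}
    (hh : h ∈ D.core) :
    D.carreDuChamp n (∑ i ∈ s, c i • U i) h = ∑ i ∈ s, c i • D.carreDuChamp n (U i) h := by
  classical
  have h0 : (0 : M → ℝ) ∈ D.core := by simpa using hC.smul 0 h hh
  induction s using Finset.induction_on with
  | empty => simpa using hS.smul_left 0 h hh h hh
  | insert a s ha ih =>
    rw [Finset.sum_insert ha, Finset.sum_insert ha, hS.add_left _ (hC.smul _ _ (hU a)) _
      (sum_smul_mem_core hC s c U hU h0) h hh, hS.smul_left _ _ (hU a) h hh, ih]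

variable [T2Space M]

/-- Test functions that agree with the coordinates of a chart near a point. -/
theorem exists_core_coordinates (hC : D.IsSmoothCore n) {x : M} {y : EuclideanSpace ℝ (Fin n)}
    (hy : y ∈ (extChartAt (𝓡 n) x).target) :
    ∃ U : Fin n → M → ℝ, (∀ i, U i ∈ D.core) ∧ ∀ᶠ z in 𝓝 y, ∀ i j,
      partialDeriv j (U i ∘ (extChartAt (𝓡 n) x).symm) z = if i = j then 1 else 0 := by
  have hex : ∀ i : Fin n, ∃ u ∈ D.core, ∀ᶠ z in 𝓝 y, ∀ j,
      partialDeriv j (u ∘ (extChartAt (𝓡 n) x).symm) z = if i = j then 1 else 0 := by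
    intro i
    obtain ⟨ψ, hψ, hψc, hψs, hψF⟩ := exists_testFunction (isOpen_extChartAt_target x) hy
      (F := fun z : EuclideanSpace ℝ (Fin n) => z i - 0) (by fun_prop)
    refine ⟨extendChart x ψ, hC.testFunctions _ (isSmooth_extendChart hψ hψc hψs)
      (hasCompactSupport_extendChart hψc hψs), ?_⟩
    have hev := (extendChart_comp_symm_eventuallyEq ψ hy).trans hψF
    filter_upwards [eventually_all.2 fun j => partialDeriv_eventuallyEq hev j] with z hz j
    rw [hz j, partialDeriv_coord]
  choose U hU hUp using hex
  exact ⟨U, hU, eventually_all.2 hUp⟩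

/-- In a chart, `Γ` is given by a smooth field of positive definite matrices. -/
theorem exists_carreDuChamp_matrix (hC : D.IsSmoothCore n) (hS : D.HasSmoothCalculus n)
    (hN : D.IsNondegenerate n) (x : M) :
    ∃ A : EuclideanSpace ℝ (Fin n) → Matrix (Fin n) (Fin n) ℝ,
      IsMetricField (extChartAt (𝓡 n) x).target A ∧
      ∀ f ∈ D.core, ∀ h ∈ D.core, ∀ y ∈ (extChartAt (𝓡 n) x).target,
        D.carreDuChamp n f h ((extChartAt (𝓡 n) x).symm y) =
          ∑ i, ∑ j, A y i j * partialDeriv i (f ∘ (extChartAt (𝓡 n) x).symm) y *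
            partialDeriv j (h ∘ (extChartAt (𝓡 n) x).symm) y := by
  set φ := extChartAt (𝓡 n) x with hφ
  have hex : ∀ y, ∃ U : Fin n → M → ℝ, y ∈ φ.target → (∀ i, U i ∈ D.core) ∧ ∀ᶠ z in 𝓝 y, ∀ i j,
      partialDeriv j (U i ∘ φ.symm) z = if i = j then 1 else 0 := by
    intro y
    by_cases hy : y ∈ φ.target
    · obtain ⟨U, hU⟩ := exists_core_coordinates hC hy
      exact ⟨U, fun _ => hU⟩
    · exact ⟨0, fun h => absurd h hy⟩
  choose U hU using hex
  have hUd : ∀ {y}, y ∈ φ.target → ∀ i j,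
      partialDeriv j (U y i ∘ φ.symm) y = if i = j then 1 else 0 := fun hy =>
    (hU _ hy).2.self_of_nhds
  -- A function of the core has the same differential as a combination of the coordinates.
  have hcomb : ∀ y ∈ φ.target, ∀ c : Fin n → ℝ, ∑ i, c i • U y i ∈ D.core ∧
      ∀ k, partialDeriv k ((∑ i, c i • U y i) ∘ φ.symm) y = c k := by
    intro y hy c
    refine ⟨?_, fun k => ?_⟩
    · exact sum_smul_mem_core hC _ c _ (hU y hy).1
        (hC.testFunctions (0 : M → ℝ) contMDiff_const HasCompactSupport.zero)
    · have hd : ∀ i, DifferentiableAt ℝ (U y i ∘ φ.symm) y := fun i =>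
        (((hC.smooth _ ((hU y hy).1 i)).contDiffOn_comp_symm x).contDiffAt
          ((isOpen_extChartAt_target x).mem_nhds hy)).differentiableAt (by simp)
      have : (∑ i, c i • U y i) ∘ φ.symm = fun z => ∑ i, c i * (U y i ∘ φ.symm) z := by
        funext z; simp [Finset.sum_apply]
      rw [this, partialDeriv_sum fun i _ => (hd i).const_mul (c i)]
      simp only [partialDeriv_mul (differentiableAt_const _) (hd _), partialDeriv_const, hUd hy]
      simp
  have hrep : ∀ f ∈ D.core, ∀ h ∈ D.core, ∀ y ∈ φ.target,
      D.carreDuChamp n f h (φ.symm y) =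
        ∑ i, ∑ j, D.carreDuChamp n (U y i) (U y j) (φ.symm y) * partialDeriv i (f ∘ φ.symm) y *
            partialDeriv j (h ∘ φ.symm) y := by
    intro f hf h hh y hy
    obtain ⟨hf1, hf2⟩ := hcomb y hy fun i => partialDeriv i (f ∘ φ.symm) y
    obtain ⟨hh1, hh2⟩ := hcomb y hy fun i => partialDeriv i (h ∘ φ.symm) y
    have hUc := (hU y hy).1
    rw [hS.firstOrder f hf _ hf1 h hh _ hh1 _
      (differential_eq_of_partialDeriv_eq (hC.smooth f hf) (hC.smooth _ hf1) hy fun i =>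
        (hf2 i).symm)
      (differential_eq_of_partialDeriv_eq (hC.smooth h hh) (hC.smooth _ hh1) hy fun i =>
        (hh2 i).symm), carreDuChamp_sum_left hC hS _ _ _ hUc hh1]
    simp only [Finset.sum_apply, Pi.smul_apply, smul_eq_mul, hS.symm _ (hUc _) _ hh1,
      carreDuChamp_sum_left hC hS _ _ _ hUc (hUc _), Finset.mul_sum]
    refine Finset.sum_congr rfl fun i _ => Finset.sum_congr rfl fun j _ => ?_
    rw [hS.symm _ (hUc j) _ (hUc i)]
    ring
  refine ⟨fun y => Matrix.of fun i j => D.carreDuChamp n (U y i) (U y j) (φ.symm y),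
    ⟨isOpen_extChartAt_target x, fun i j y hy => ?_, fun y hy => ?_⟩, hrep⟩
  · -- Near `y` the entries are those computed with the fixed coordinate functions `U y i`.
    have hUc := (hU y hy).1
    have h1 : ContDiffAt ℝ ∞ (D.carreDuChamp n (U y i) (U y j) ∘ φ.symm) y :=
      ((hS.carreDuChamp_spec (hUc i) (hUc j)).1.contDiffOn_comp_symm x).contDiffAt
        ((isOpen_extChartAt_target x).mem_nhds hy)
    refine (h1.congr_of_eventuallyEq ?_).contDiffWithinAt
    filter_upwards [(hU y hy).2, (isOpen_extChartAt_target x).mem_nhds hy] with z hz hzt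
    rw [Function.comp_apply, hrep _ (hUc i) _ (hUc j) z hzt]
    simp [hz]
  · have hUc := (hU y hy).1
    refine Matrix.PosDef.of_dotProduct_mulVec_pos ?_ fun q hq => ?_
    · ext i j
      simp only [Matrix.conjTranspose_apply, star_trivial, Matrix.of_apply]
      rw [hS.symm _ (hUc j) _ (hUc i)]
    · obtain ⟨hf1, hf2⟩ := hcomb y hy q
      have hne : differential n (∑ i, q i • U y i) (φ.symm y) ≠ 0 := by
        intro h0
        refine hq (funext fun i => ?_)
        rw [← hf2 i, ← differential_chartVector_single (hC.smooth _ hf1) hy i, h0]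
        rfl
      have hpos := hN _ _ hf1 hne
      rw [hrep _ hf1 _ hf1 y hy] at hpos
      simp only [hf2] at hpos
      simp only [dotProduct, Matrix.mulVec, Pi.star_apply, star_trivial, Finset.mul_sum,
        Matrix.of_apply]
      refine hpos.trans_eq (Finset.sum_congr rfl fun i _ => Finset.sum_congr rfl fun j _ => ?_)
      ring

/-- `b` is the inner product on `T_p M` dual to `Γ`: each `h` in the core has a gradient `X`, that
is a tangent vector with `df(X) = Γ(f, h)(p)` for all `f` and `b(X, ·) = dh`. -/
def IsDualForm (n : ℕ) {M : Type*} [TopologicalSpace M]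
    [ChartedSpace (EuclideanSpace ℝ (Fin n)) M] [MeasurableSpace M] (D : DiffusionData M) (p : M)
    (b : TangentSpace (𝓡 n) p →L[ℝ] TangentSpace (𝓡 n) p →L[ℝ] ℝ) : Prop :=
  (∀ v w, b v w = b w v) ∧ (∀ v, v ≠ 0 → 0 < b v v) ∧
    ∀ h ∈ D.core, ∃ X : TangentSpace (𝓡 n) p,
      (∀ f ∈ D.core, differential n f p X = D.carreDuChamp n f h p) ∧
      ∀ w, b X w = differential n h p w

theorem exists_isDualForm_symm (hC : D.IsSmoothCore n) (hS : D.HasSmoothCalculus n)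
    (hN : D.IsNondegenerate n) {x : M} {y : EuclideanSpace ℝ (Fin n)}
    (hy : y ∈ (extChartAt (𝓡 n) x).target) :
    ∃ b, IsDualForm n D ((extChartAt (𝓡 n) x).symm y) b := by
  obtain ⟨A, hA, hΓ⟩ := exists_carreDuChamp_matrix hC hS hN x
  let c : EuclideanSpace ℝ (Fin n) →L[ℝ] EuclideanSpace ℝ (Fin n) :=
    mvfderiv (𝓡 n) (extChartAt (𝓡 n) x) ((extChartAt (𝓡 n) x).symm y)
  let b : EuclideanSpace ℝ (Fin n) →L[ℝ] EuclideanSpace ℝ (Fin n) →L[ℝ] ℝ :=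
    ∑ i, ∑ j, (A y)⁻¹ i j • ((EuclideanSpace.proj i : EuclideanSpace ℝ (Fin n) →L[ℝ] ℝ).comp
      c).smulRight ((EuclideanSpace.proj j : EuclideanSpace ℝ (Fin n) →L[ℝ] ℝ).comp c)
  have hb : ∀ v w : EuclideanSpace ℝ (Fin n),
      b v w = ∑ i, ∑ j, (A y)⁻¹ i j * c v i * c w j := fun v w => by
    simp [b, sum_apply, mul_assoc]
  have hc : ∀ v : EuclideanSpace ℝ (Fin n), c (chartVector x y v) = v :=
    Metric.mvfderiv_chartVector hy
  refine ⟨b, fun v w => ?_, fun v hv => ?_, fun h hh => ?_⟩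
  · refine (hb v w).trans (Eq.trans ?_ (hb w v).symm)
    rw [Finset.sum_comm]
    refine Finset.sum_congr rfl fun i _ => Finset.sum_congr rfl fun j _ => ?_
    rw [hA.inv_comm hy j i]
    ring
  · obtain ⟨v, rfl⟩ := (chartVector_bijective hy).2 v
    have hv0 : (fun i => v i) ≠ 0 := fun h0 => hv (by
      have : v = 0 := by ext i; exact congrFun h0 i
      rw [this, map_zero])
    have hpos := (hA.posDef y hy).inv.dotProduct_mulVec_pos hv0
    refine lt_of_lt_of_eq hpos (Eq.trans ?_ (hb _ _).symm)
    simp only [hc, dotProduct, Matrix.mulVec, Pi.star_apply, star_trivial, Finset.mul_sum]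
    exact Finset.sum_congr rfl fun i _ => Finset.sum_congr rfl fun j _ => by ring
  · set p : Fin n → ℝ := fun j => partialDeriv j (h ∘ (extChartAt (𝓡 n) x).symm) y with hp
    refine ⟨chartVector x y (WithLp.toLp 2 ((A y).mulVec p)), fun f hf => ?_, fun w => ?_⟩
    · rw [differential_chartVector (hC.smooth f hf) hy, fderiv_eq_sum_partialDeriv,
        hΓ f hf h hh y hy]
      refine Finset.sum_congr rfl fun i _ => ?_
      simp only [Matrix.mulVec, dotProduct, Finset.sum_mul]
      exact Finset.sum_congr rfl fun j _ => by ring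
    · obtain ⟨w, rfl⟩ := (chartVector_bijective hy).2 w
      rw [differential_chartVector (hC.smooth h hh) hy, fderiv_eq_sum_partialDeriv]
      refine (hb _ _).trans ?_
      simp only [hc]
      have h1 : (A y)⁻¹.mulVec ((A y).mulVec p) = p := by
        rw [Matrix.mulVec_mulVec, Matrix.nonsing_inv_mul _ (hA.det_pos hy).ne'.isUnit,
          Matrix.one_mulVec]
      rw [Finset.sum_comm]
      refine Finset.sum_congr rfl fun j _ => ?_
      rw [← Finset.sum_mul, mul_comm]
      congr 1
      refine Eq.trans ?_ (congrFun h1 j)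
      simp only [Matrix.mulVec, dotProduct]
      exact Finset.sum_congr rfl fun i _ => by rw [hA.inv_comm hy i j]

theorem exists_isDualForm (hC : D.IsSmoothCore n) (hS : D.HasSmoothCalculus n)
    (hN : D.IsNondegenerate n) (p : M) : ∃ b, IsDualForm n D p b := by
  have h := exists_isDualForm_symm hC hS hN (mem_extChartAt_target (I := 𝓡 n) p)
  rwa [extChartAt_to_inv p] at h

/-- In a chart, the dual form has the inverse matrix of `Γ`. -/
theorem IsDualForm.apply_chartVector (hC : D.IsSmoothCore n) {x : M}
    {A : EuclideanSpace ℝ (Fin n) → Matrix (Fin n) (Fin n) ℝ}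
    (hA : IsMetricField (extChartAt (𝓡 n) x).target A)
    (hΓ : ∀ f ∈ D.core, ∀ h ∈ D.core, ∀ y ∈ (extChartAt (𝓡 n) x).target,
      D.carreDuChamp n f h ((extChartAt (𝓡 n) x).symm y) =
        ∑ i, ∑ j, A y i j * partialDeriv i (f ∘ (extChartAt (𝓡 n) x).symm) y *
          partialDeriv j (h ∘ (extChartAt (𝓡 n) x).symm) y)
    {y : EuclideanSpace ℝ (Fin n)} (hy : y ∈ (extChartAt (𝓡 n) x).target)
    {b : TangentSpace (𝓡 n) ((extChartAt (𝓡 n) x).symm y) →L[ℝ]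
      TangentSpace (𝓡 n) ((extChartAt (𝓡 n) x).symm y) →L[ℝ] ℝ}
    (hb : IsDualForm n D ((extChartAt (𝓡 n) x).symm y) b) (i j : Fin n) :
    b (chartVector x y (EuclideanSpace.single i 1)) (chartVector x y (EuclideanSpace.single j 1)) =
      (A y)⁻¹ i j := by
  have hex : ∀ p : Fin n → ℝ, ∃ f ∈ D.core,
      ∀ k, partialDeriv k (f ∘ (extChartAt (𝓡 n) x).symm) y = p k := fun p => by
    obtain ⟨f, hf, hfc, h1, -⟩ := exists_testFunction_jet hy p 0 fun _ _ => rfl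
    exact ⟨f, hC.testFunctions f hf hfc, h1⟩
  -- The function whose gradient is the `i`-th coordinate vector.
  obtain ⟨h, hh, hp⟩ := hex fun k => (A y)⁻¹ k i
  obtain ⟨X, hX, hbX⟩ := hb.2.2 h hh
  obtain ⟨u, rfl⟩ := (chartVector_bijective hy).2 X
  have hu : u = EuclideanSpace.single i 1 := by
    ext k
    obtain ⟨f, hf, hfp⟩ := hex (Pi.single k 1)
    have h1 := hX f hf
    rw [differential_chartVector (hC.smooth f hf) hy, fderiv_eq_sum_partialDeriv,
      hΓ f hf h hh y hy] at h1
    simp only [hfp, hp] at h1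
    have h2 : (A y * (A y)⁻¹) k i = (1 : Matrix (Fin n) (Fin n) ℝ) k i := by
      rw [Matrix.mul_nonsing_inv _ (hA.det_pos hy).ne'.isUnit]
    rw [Matrix.mul_apply, Matrix.one_apply] at h2
    simpa [Pi.single_apply, h2] using h1
  rw [← hu, hbX, differential_chartVector_single (hC.smooth h hh) hy, hp, hA.inv_comm hy]

/-- The Riemannian metric whose cometric is `Γ`. -/
theorem exists_metric (hC : D.IsSmoothCore n) (hS : D.HasSmoothCalculus n)
    (hN : D.IsNondegenerate n) : ∃ g : Metric n M, ∀ f ∈ D.core, ∀ h ∈ D.core, ∀ x,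
      D.carreDuChamp n f h x = g.cometric f h x := by
  choose b hb using exists_isDualForm hC hS hN
  let g : Metric n M :=
    { inner := b
      symm := fun p => (hb p).1
      pos := fun p => (hb p).2.1
      isVonNBounded := fun p => isVonNBounded_of_pos (E := EuclideanSpace ℝ (Fin n)) (b p)
        (hb p).2.1
      contMDiff := fun p => by
        obtain ⟨A, hA, hΓ⟩ := exists_carreDuChamp_matrix hC hS hN p
        have hy := mem_extChartAt_target (I := 𝓡 n) p
        have h := (contMDiffAt_bilin_iff b hy).2 fun i j => by
          refine (hA.contDiffAt_inv hy i j).congr_of_eventuallyEq ?_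
          filter_upwards [(isOpen_extChartAt_target (I := 𝓡 n) p).mem_nhds hy] with z hz
          exact (hb _).apply_chartVector hC hA hΓ hz i j
        rwa [extChartAt_to_inv p] at h }
  refine ⟨g, fun f hf h hh x => ?_⟩
  obtain ⟨X, hX, hbX⟩ := (hb x).2.2 h hh
  rw [← hX f hf, g.eq_gradient hbX, Metric.cometric, g.inner_gradient]

end DiffusionData

end MetricExistence

/-! ### The density with respect to the Riemannian volume -/

section Density

variable {n : ℕ} {M : Type*} [TopologicalSpace M] [ChartedSpace (EuclideanSpace ℝ (Fin n)) M]

/-- The coordinate change from the preferred chart at `x` to that at `p`. -/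
def chartTransition (x p : M) : EuclideanSpace ℝ (Fin n) → EuclideanSpace ℝ (Fin n) :=
  extChartAt (𝓡 n) p ∘ (extChartAt (𝓡 n) x).symm

/-- The set on which the coordinate change from the preferred chart at `x` to that at `p` is
defined. -/
def overlap (x p : M) : Set (EuclideanSpace ℝ (Fin n)) :=
  (extChartAt (𝓡 n) x).target ∩ (extChartAt (𝓡 n) x).symm ⁻¹' (extChartAt (𝓡 n) p).source

theorem isOpen_overlap (x p : M) : IsOpen (overlap (n := n) x p) :=
  (continuousOn_extChartAt_symm x).isOpen_inter_preimage (isOpen_extChartAt_target x)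
    (isOpen_extChartAt_source p)

theorem mapsTo_chartTransition (x p : M) :
    MapsTo (chartTransition (n := n) x p) (overlap x p) (extChartAt (𝓡 n) p).target :=
  fun _ hz => (extChartAt (𝓡 n) p).map_source hz.2

theorem injOn_chartTransition (x p : M) : InjOn (chartTransition (n := n) x p) (overlap x p) :=
  fun _ hz _ hz' h => (extChartAt (𝓡 n) x).symm.injOn hz.1 hz'.1
    ((extChartAt (𝓡 n) p).injOn hz.2 hz'.2 h)

variable [IsManifold (𝓡 n) ∞ M]

theorem contDiffOn_chartTransition (x p : M) :
    ContDiffOn ℝ ∞ (chartTransition (n := n) x p) (overlap x p) := by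
  refine ContMDiffOn.contDiffOn ?_
  exact (contMDiffOn_extChartAt (I := 𝓡 n) (n := ∞) (x := p)).comp
    ((contMDiffOn_extChartAt_symm x).mono inter_subset_left)
    (fun z hz => by simpa using hz.2)

theorem hasFDerivAt_chartTransition {x p : M} {z : EuclideanSpace ℝ (Fin n)}
    (hz : z ∈ overlap x p) :
    HasFDerivAt (chartTransition x p) (fderiv ℝ (chartTransition (n := n) x p) z) z :=
  (((contDiffOn_chartTransition x p).contDiffAt ((isOpen_overlap x p).mem_nhds hz)).differentiableAt
    (by simp)).hasFDerivAt

theorem mvfderiv_chartVector_eq_fderiv {x p : M} {z : EuclideanSpace ℝ (Fin n)}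
    (hz : z ∈ overlap x p) (v : EuclideanSpace ℝ (Fin n)) :
    mvfderiv (𝓡 n) (extChartAt (𝓡 n) p) ((extChartAt (𝓡 n) x).symm z) (chartVector x z v) =
      fderiv ℝ (chartTransition x p) z v := by
  have h := mfderiv_comp_apply z (mdifferentiableAt_extChartAt (I := 𝓡 n)
    (x := p) (by simpa using hz.2)) (mdifferentiableAt_symm hz.1) v
  rw [mfderiv_eq_fderiv] at h
  exact h.symm

namespace Metric

/-- The transformation rule of the Gram determinant. -/
theorem det_matrix_eq (g : Metric n M) {x p : M} {z : EuclideanSpace ℝ (Fin n)}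
    (hz : z ∈ overlap x p) :
    (matrix g x z).det =
      (fderiv ℝ (chartTransition x p) z).det ^ 2 * (matrix g p (chartTransition x p z)).det := by
  let B := (EuclideanSpace.basisFun (Fin n) ℝ).toBasis
  let J := LinearMap.toMatrix B B (fderiv ℝ (chartTransition x p) z).toLinearMap
  have hJ : ∀ a i, J a i = fderiv ℝ (chartTransition x p) z (EuclideanSpace.single i 1) a :=
    fun a i => by simp [J, B, LinearMap.toMatrix_apply]
  have hdet : J.det = (fderiv ℝ (chartTransition x p) z).det := LinearMap.det_toMatrix B _
  have hG : matrix g x z = J.transpose * matrix g p (chartTransition x p z) * J := by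
    ext i j
    rw [matrix_apply, inner_eq_sum g hz.2, mvfderiv_chartVector_eq_fderiv hz,
      mvfderiv_chartVector_eq_fderiv hz]
    simp only [Matrix.mul_apply, Matrix.transpose_apply, hJ, Finset.sum_mul]
    rw [Finset.sum_comm]
    exact Finset.sum_congr rfl fun a _ => Finset.sum_congr rfl fun b _ => by
      rw [chartTransition, Function.comp_apply]; ring
  rw [hG, Matrix.det_mul, Matrix.det_mul, Matrix.det_transpose, hdet]
  ring

theorem det_fderiv_chartTransition_ne_zero (g : Metric n M) {x p : M}
    {z : EuclideanSpace ℝ (Fin n)} (hz : z ∈ overlap x p) :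
    (fderiv ℝ (chartTransition x p) z).det ≠ 0 := fun h0 => by
  have h := g.det_matrix_eq hz
  rw [h0] at h
  exact (g.posDef_matrix hz.1).det_pos.ne' (by simpa using h)

variable [MeasurableSpace M] {μ : Measure M} {w : M → EuclideanSpace ℝ (Fin n) → ℝ}

/-- The transformation rule of a density. -/
theorem density_eq (g : Metric n M) (h : HasChartDensity μ w)
    (hw : ∀ x, ContinuousOn (w x) (extChartAt (𝓡 n) x).target)
    (hw0 : ∀ x, ∀ y ∈ (extChartAt (𝓡 n) x).target, 0 < w x y) {x p : M} :
    EqOn (w x) (fun z => |(fderiv ℝ (chartTransition x p) z).det| * w p (chartTransition x p z))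
      (overlap x p) := by
  have hτ := contDiffOn_chartTransition (n := n) x p
  have hτm := mapsTo_chartTransition (n := n) x p
  refine eqOn_of_setLIntegral_eq (isOpen_overlap x p) ((hw x).mono inter_subset_left) ?_
    (fun z hz => hw0 x z hz.1) (fun z hz => mul_pos
      (abs_pos.2 (g.det_fderiv_chartTransition_ne_zero hz)) (hw0 p _ (hτm hz))) ?_
  · have hd : ContinuousOn (fderiv ℝ (chartTransition (n := n) x p)) (overlap x p) :=
      hτ.continuousOn_fderiv_of_isOpen (isOpen_overlap x p) (by simp)
    exact ((ContinuousLinearMap.continuous_det.comp_continuousOn hd).abs).mul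
      ((hw p).comp hτ.continuousOn hτm)
  · intro A hA hAN
    have hder : ∀ z ∈ A, HasFDerivWithinAt (chartTransition x p)
        (fderiv ℝ (chartTransition (n := n) x p) z) A z := fun z hz =>
      (hasFDerivAt_chartTransition (hAN hz)).hasFDerivWithinAt
    have hinj := (injOn_chartTransition (n := n) x p).mono hAN
    have himg : chartTransition x p '' A ⊆ (extChartAt (𝓡 n) p).target :=
      (hτm.mono_left hAN).image_subset
    have hset : (extChartAt (𝓡 n) x).source ∩ extChartAt (𝓡 n) x ⁻¹' A =
        (extChartAt (𝓡 n) p).source ∩ extChartAt (𝓡 n) p ⁻¹' (chartTransition x p '' A) := by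
      ext q
      constructor
      · rintro ⟨hq, hqA⟩
        have hq2 := (hAN hqA).2
        rw [mem_preimage, (extChartAt (𝓡 n) x).left_inv hq] at hq2
        exact ⟨hq2, _, hqA, by
          rw [chartTransition, Function.comp_apply, (extChartAt (𝓡 n) x).left_inv hq]⟩
      · rintro ⟨hq, z, hz, hzq⟩
        have hqz : (extChartAt (𝓡 n) x).symm z = q :=
          (extChartAt (𝓡 n) p).injOn (hAN hz).2 hq hzq
        subst hqz
        refine ⟨(extChartAt (𝓡 n) x).map_target (hAN hz).1, ?_⟩
        rwa [mem_preimage, (extChartAt (𝓡 n) x).right_inv (hAN hz).1]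
    rw [← h x A hA (hAN.trans inter_subset_left), hset,
      h p _ (measurable_image_of_fderivWithin hA hder hinj) himg,
      lintegral_image_eq_lintegral_abs_det_fderiv_mul volume hA hder hinj]
    exact setLIntegral_congr_fun hA fun z _ => (ENNReal.ofReal_mul (abs_nonneg _)).symm

theorem exists_density (g : Metric n M) (hμ : IsSmoothPositiveMeasure (n := n) μ) :
    ∃ ρ : M → ℝ, IsSmooth n ρ ∧ (∀ x, 0 < ρ x) ∧ g.IsWeightedVolume ρ μ := by
  obtain ⟨w, hw, hw0, h⟩ := hμ
  let ρ : M → ℝ := fun p =>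
    w p (extChartAt (𝓡 n) p p) / √(matrix g p (extChartAt (𝓡 n) p p)).det
  have hdet : ∀ {x : M} {y}, y ∈ (extChartAt (𝓡 n) x).target → 0 < (matrix g x y).det :=
    fun hy => (g.posDef_matrix hy).det_pos
  -- Both densities are multiplied by the Jacobian, so their quotient does not see the chart.
  have hρ : ∀ (x : M), ∀ y ∈ (extChartAt (𝓡 n) x).target,
      ρ ((extChartAt (𝓡 n) x).symm y) = w x y / √(matrix g x y).det := fun x y hy => by
    set p := (extChartAt (𝓡 n) x).symm y with hp
    have hz : y ∈ overlap x p := ⟨hy, mem_extChartAt_source p⟩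
    have hJ := abs_pos.2 (g.det_fderiv_chartTransition_ne_zero hz)
    have hw1 := g.density_eq h (fun x => (hw x).continuousOn) hw0 hz
    have hτ : chartTransition x p y = extChartAt (𝓡 n) p p := rfl
    simp only [hτ] at hw1
    rw [hw1, g.det_matrix_eq hz, hτ, Real.sqrt_mul (sq_nonneg _), Real.sqrt_sq_eq_abs,
      mul_div_mul_left _ _ hJ.ne']
  refine ⟨ρ, isSmooth_of_contDiffAt_comp_symm fun x => ?_, fun x => ?_, fun x A hA hAs => ?_⟩
  · have hy := mem_extChartAt_target (I := 𝓡 n) x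
    have hn := (isOpen_extChartAt_target (I := 𝓡 n) x).mem_nhds hy
    have hd : ContDiffAt ℝ ∞ (fun z => √(matrix g x z).det) (extChartAt (𝓡 n) x x) :=
      (contDiffAt_det ((g.isMetricField_matrix x).contDiffAt hy)).sqrt (hdet hy).ne'
    refine (((hw x).contDiffAt hn).div hd (Real.sqrt_pos.2 (hdet hy)).ne').congr_of_eventuallyEq ?_
    filter_upwards [hn] with z hz using hρ x z hz
  · exact div_pos (hw0 _ _ (mem_extChartAt_target x))
      (Real.sqrt_pos.2 (hdet (mem_extChartAt_target x)))
  · rw [h x A hA hAs]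
    refine setLIntegral_congr_fun hA fun y hy => ?_
    simp only
    rw [hρ x y (hAs hy), div_mul_cancel₀ _ (Real.sqrt_pos.2 (hdet (hAs hy))).ne']

end Metric

end Density

/-! ### The recovered weighted manifold -/

namespace DiffusionData

variable {n : ℕ} {M : Type*} [TopologicalSpace M] [ChartedSpace (EuclideanSpace ℝ (Fin n)) M]
  [IsManifold (𝓡 n) ∞ M] [MeasurableSpace M] {D : DiffusionData M} {g g' : Metric n M}
  {ρ ρ' : M → ℝ}

theorem IsRecovered.metric_unique [T2Space M] (hR : D.IsRecovered g ρ) (hR' : D.IsRecovered g' ρ')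
    (hC : D.IsSmoothCore n) : g = g' := by
  refine Metric.ext_inv_matrix fun x => ?_
  have hy := mem_extChartAt_target (I := 𝓡 n) x
  have hx := mem_extChartAt_source (I := 𝓡 n) x
  have hG := g.isMetricField_matrix x
  have hG' := g'.isMetricField_matrix x
  refine matrix_eq_of_quadratic (hG.inv_comm hy) (hG'.inv_comm hy) fun q => ?_
  obtain ⟨f, hf, hfc, h1, -⟩ := exists_testFunction_jet hy q 0 fun _ _ => rfl
  have hfC := hC.testFunctions f hf hfc
  have h := (hR.carreDuChamp_eq f hfC f hfC x).symm.trans (hR'.carreDuChamp_eq f hfC f hfC x)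
  rw [g.cometric_eq hf hf hx, g'.cometric_eq hf hf hx] at h
  simp only [cometricCoord, h1] at h
  simpa only [mul_comm, mul_left_comm] using h

theorem IsRecovered.density_unique (hR : D.IsRecovered g ρ) (hR' : D.IsRecovered g ρ') :
    ρ = ρ' := by
  funext x
  have hy := mem_extChartAt_target (I := 𝓡 n) x
  have h := hR.measure_eq.eqOn hR'.measure_eq (x := x) (hR.contDiffOn_density x).continuousOn
    (hR'.contDiffOn_density x).continuousOn (fun _ hy => hR.density_pos' hy)
    (fun _ hy => hR'.density_pos' hy) hy
  simp only [extChartAt_to_inv] at h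
  exact mul_right_cancel₀ (Real.sqrt_pos.2 ((g.isMetricField_matrix x).det_pos hy)).ne' h

theorem existsUnique_isRecovered [T2Space M] (hD : D.IsDiffusion n) (hC : D.IsSmoothCore n)
    (hS : D.HasSmoothCalculus n) (hN : D.IsNondegenerate n) :
    ∃! p : Metric n M × (M → ℝ), D.IsRecovered p.1 p.2 := by
  obtain ⟨g, hg⟩ := exists_metric hC hS hN
  obtain ⟨ρ, hρ, hρ0, hμ⟩ := g.exists_density hD.smoothMeasure
  have hR : D.IsRecovered g ρ := ⟨hg, hρ, hρ0, hμ⟩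
  refine ⟨(g, ρ), hR, ?_⟩
  rintro ⟨g', ρ'⟩ hR'
  obtain rfl : g' = g := IsRecovered.metric_unique hR' hR hC
  obtain rfl : ρ' = ρ := IsRecovered.density_unique hR' hR
  rfl

/-- For a given metric, `Γ₂` on test functions determines the Bakry-Émery tensor. -/
theorem IsRecovered.bakryEmeryRicci_eq_of_gammaTwo_eq [BorelSpace M] [T2Space M]
    [SecondCountableTopology M] {D' : DiffusionData M} (hR : D.IsRecovered g ρ)
    (hD : D.IsDiffusion n) (hC : D.IsSmoothCore n) (hS : D.HasSmoothCalculus n)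
    (hR' : D'.IsRecovered g ρ') (hD' : D'.IsDiffusion n) (hC' : D'.IsSmoothCore n)
    (hS' : D'.HasSmoothCalculus n)
    (h : ∀ f : M → ℝ, IsSmooth n f → HasCompactSupport f → D.gammaTwo n f = D'.gammaTwo n f) :
    g.bakryEmeryRicci ρ = g.bakryEmeryRicci ρ' := by
  funext x v w
  obtain ⟨f, hf, hfc, rfl, hf0⟩ := g.exists_testFunction_gradient x v
  obtain ⟨k, hk, hkc, rfl, -⟩ := g.exists_testFunction_gradient x w
  rw [hR.bakryEmeryRicci_eq_gammaTwoPolar hD hC hS (hC.testFunctions f hf hfc)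
      (hC.testFunctions k hk hkc) hf0,
    hR'.bakryEmeryRicci_eq_gammaTwoPolar hD' hC' hS' (hC'.testFunctions f hf hfc)
      (hC'.testFunctions k hk hkc) hf0, gammaTwoPolar, gammaTwoPolar,
    h (f + k) (ContMDiff.add hf hk) (hfc.add hkc), h (f - k) (ContMDiff.sub hf hk) (hfc.sub hkc)]

end DiffusionData

end DiffGeo

end

open DiffGeo in
theorem theorem4p6 (n : ℕ) (M : Type*) [TopologicalSpace M] [T2Space M]
    [SecondCountableTopology M] [ConnectedSpace M] [ChartedSpace (EuclideanSpace ℝ (Fin n)) M]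
    [IsManifold (𝓡 n) ∞ M] [MeasurableSpace M] [BorelSpace M]
    (D : DiffusionData M) (hdiff : D.IsDiffusion n) (hcore : D.IsSmoothCore n)
    (hcalc : D.HasSmoothCalculus n) (hnd : D.IsNondegenerate n) :
    -- the recovered weighted manifold exists and is unique
    (∃! p : DiffGeo.Metric n M × (M → ℝ), D.IsRecovered p.1 p.2) ∧
    (∀ (g : DiffGeo.Metric n M) (ρ : M → ℝ), D.IsRecovered g ρ →
      -- the weighted Bochner identity on the core
      (∀ f ∈ D.core, ∀ h ∈ D.core, ∀ x : M,
        D.gammaTwoPolar n f h x =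
          g.hessianInner f h x + g.bakryEmeryRicci ρ x (g.gradient f x) (g.gradient h x)) ∧
      -- pointwise recovery of the tensor from `Γ₂`
      (∀ (x : M) (v w : TangentSpace (𝓡 n) x),
        (∃ f h : M → ℝ, IsSmooth n f ∧ HasCompactSupport f ∧ IsSmooth n h ∧
          HasCompactSupport h ∧ g.gradient f x = v ∧ g.gradient h x = w ∧
          g.hessian f x = 0 ∧ g.hessian h x = 0) ∧
        (∀ f ∈ D.core, ∀ h ∈ D.core, g.gradient f x = v → g.gradient h x = w →
          g.hessian f x = 0 → g.hessian h x = 0 →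
          g.bakryEmeryRicci ρ x v w = D.gammaTwoPolar n f h x)) ∧
      -- the unweighted case
      ((∃ c : ℝ, ∀ x, ρ x = c) → g.bakryEmeryRicci ρ = g.ricci)) ∧
    -- two diffusions with the same `Γ₂` have the same metric and the same tensors
    (∀ D' : DiffusionData M, D'.IsDiffusion n → D'.IsSmoothCore n → D'.HasSmoothCalculus n →
      D'.IsNondegenerate n →
      (∀ f : M → ℝ, IsSmooth n f → HasCompactSupport f → D.gammaTwo n f = D'.gammaTwo n f) →
      ∀ (g g' : DiffGeo.Metric n M) (ρ ρ' : M → ℝ), D.IsRecovered g ρ → D'.IsRecovered g' ρ' →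
        g = g' ∧ g.bakryEmeryRicci ρ = g'.bakryEmeryRicci ρ' ∧
        (∀ (x : M) (v w : TangentSpace (𝓡 n) x),
          g.ricci x v w + g.hessian (fun y => Real.log (ρ y)) x v w =
            g'.ricci x v w + g'.hessian (fun y => Real.log (ρ' y)) x v w)) := by
  refine ⟨DiffusionData.existsUnique_isRecovered hdiff hcore hcalc hnd, fun g ρ hR =>
    ⟨fun f hf h hh x => hR.gammaTwoPolar_eq hdiff hcore hcalc hf hh x, fun x v w => ⟨?_, ?_⟩,
      g.bakryEmeryRicci_of_const⟩, ?_⟩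
  · obtain ⟨f, hf, hfc, hv, hf0⟩ := g.exists_testFunction_gradient x v
    obtain ⟨h, hh, hhc, hw, hh0⟩ := g.exists_testFunction_gradient x w
    exact ⟨f, h, hf, hfc, hh, hhc, hv, hw, hf0, hh0⟩
  · rintro f hf h hh rfl rfl hf0 -
    exact hR.bakryEmeryRicci_eq_gammaTwoPolar hdiff hcore hcalc hf hh hf0
  · intro D' hdiff' hcore' hcalc' _ hΓ g g' ρ ρ' hR hR'
    obtain rfl : g = g' :=
      hR.metric_eq_of_gammaTwo_eq hdiff hcore hcalc hR' hdiff' hcore' hcalc' hΓ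
    have hBE := hR.bakryEmeryRicci_eq_of_gammaTwo_eq hdiff hcore hcalc hR' hdiff' hcore' hcalc' hΓ
    refine ⟨rfl, hBE, fun x v w => ?_⟩
    -- `Ric + ∇² log ρ = 2 Ric - Ric_μ`
    have h := congrFun (congrFun (congrFun hBE x) v) w
    simp only [Metric.bakryEmeryRicci] at h
    linarith
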